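/- A polyhedron with an algebraic description in $\mathbb{R}^d$ is a set $\{x\in\mathbb{R}^d : Mx\le b\}$ given by a real matrix $M$ and a real vector $b$ with finitely many rows (possibly none) and algebraic entries. An instance of the \emph{Generalised Matrix-Exponential Problem} (Generalised MEP) consists of matrices $A_1,\dots,A_k,C\in\overline{\mathbb{Q}}^{\,n\times n}$ with complex algebraic entries and a polyhedron $\mathcal{P}\subseteq\mathbb{R}^{2k}$ with an algebraic description. It is positive if there are $t_1,\dots,t_k\in\mathbb{C}$ such that $$\prod_{i=1}^{k}\exp(A_i t_i)=C\quad\text{and}\quad(\operatorname{Re}t_1,\dots,\operatorname{Re}t_k,\operatorname{Im}t_1,\dots,\operatorname{Im}t_k)\in\mathcal{P}.$$ An instance of the \emph{Linear-Exponential Problem} (LEP) consists of finitely many equations $$\exp\Big(\sum_{i=1}^{k}\lambda_i^{(j)}t_i\Big)=c_j\exp(d_j)\qquad(j\in J)$$ with complex algebraic constants $\lambda_i^{(j)},c_j,d_j$, together with a polyhedron $\mathcal{P}\subseteq\mathbb{R}^{2k}$ with an algebraic description. It is positive if there are $t_1,\dots,t_k\in\mathbb{C}$ that satisfy all the equations and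 $(\operatorname{Re}t_1,\dots,\operatorname{Re}t_k,\operatorname{Im}t_1,\dots,\operatorname{Im}t_k)\in\mathcal{P}$. Instances are given by finite codes, in which an algebraic number $\alpha$ is stored as its minimal polynomial over $\mathbb{Q}$ together with a point $q\in\mathbb{Q}+i\mathbb{Q}$ and a rational radius $r$ such that $\alpha$ is the only complex root of that polynomial at distance less than $r$ from $q$. \textbf{Theorem.} The Generalised MEP with commuting matrices reduces effectively to LEP: there is an algorithm (a partial computable function on codes) which, on every code of an instance of the Generalised MEP whose matrices $A_1,\dots,A_k$ commute pairwise, halts and outputs a code of an instance of LEP that is positive if and only if the given instance is positive. -/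

import Mathlib

/-- Codes of rational numbers: the pair `(z, n)` stands for `z / (n + 1)`. -/
abbrev RatCode := ℤ × ℕ

/-- The rational number denoted by a code. -/
def RatCode.val (q : RatCode) : ℚ := (q.1 : ℚ) / ((q.2 : ℚ) + 1)

/-- The polynomial `c₀ + c₁ X + c₂ X² + ⋯` given by a finite list of codes of its rational
coefficients, constant coefficient first. -/
noncomputable def polyOfCode (l : List RatCode) : Polynomial ℚ :=
  ∑ i : Fin l.length, Polynomial.monomial (i : ℕ) (l.get i).val

/-- Codes of algebraic numbers: a polynomial, the real and imaginary part of a rational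
approximation, and a rational radius. -/
abbrev AlgCode := List RatCode × RatCode × RatCode × RatCode

/-- The Gaussian rational `x + i y` used as numerical approximation. -/
noncomputable def AlgCode.center (w : AlgCode) : ℂ :=
  ⟨((RatCode.val w.2.1 : ℚ) : ℝ), ((RatCode.val w.2.2.1 : ℚ) : ℝ)⟩

/-- The radius (precision of the approximation). -/
noncomputable def AlgCode.radius (w : AlgCode) : ℝ := ((RatCode.val w.2.2.2 : ℚ) : ℝ)

/-- `w.Represents α`: the complex number `α` is algebraic, `w` stores its minimal polynomial over
`ℚ` and a rational approximation of `α` that is precise enough to tell `α` from all the other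
complex roots of that polynomial. -/
def AlgCode.Represents (w : AlgCode) (α : ℂ) : Prop :=
  IsAlgebraic ℚ α ∧ polyOfCode w.1 = minpoly ℚ α ∧ ‖α - AlgCode.center w‖ < AlgCode.radius w ∧
    ∀ β : ℂ, Polynomial.aeval β (polyOfCode w.1) = 0 →
      ‖β - AlgCode.center w‖ < AlgCode.radius w → β = α

/-- A list of codes represents a vector of complex numbers, entry by entry (the list has exactly
as many entries as the vector). -/
def RepresentsVec {n : ℕ} (w : List AlgCode) (v : Fin n → ℂ) : Prop :=
  List.Forall₂ AlgCode.Represents w (List.ofFn v)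

/-- A list of rows represents a matrix of complex numbers. -/
def RepresentsMat {m n : ℕ} (w : List (List AlgCode)) (A : Matrix (Fin m) (Fin n) ℂ) : Prop :=
  List.Forall₂ RepresentsVec w (List.ofFn fun i : Fin m => (A i : Fin n → ℂ))

/-- A description `M x ≤ b` of a polyhedron in `ℝ ^ d` by finitely many (possibly no) linear
inequalities with real algebraic coefficients. -/
structure AlgPolyhedron (d : ℕ) where
  m : ℕ
  M : Matrix (Fin m) (Fin d) ℝ
  b : Fin m → ℝ
  algebraic_M : ∀ i j, IsAlgebraic ℚ (M i j)
  algebraic_b : ∀ i, IsAlgebraic ℚ (b i)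

/-- The polyhedron `{x ∈ ℝ ^ d : M x ≤ b}` itself. -/
def AlgPolyhedron.carrier {d : ℕ} (P : AlgPolyhedron d) : Set (Fin d → ℝ) :=
  {x | ∀ i, (P.M.mulVec x) i ≤ P.b i}

/-- Codes of polyhedra: the rows of `M`, and `b`. -/
abbrev PolyhedronCode := List (List AlgCode) × List AlgCode

def PolyhedronCode.Represents {d : ℕ} (w : PolyhedronCode) (P : AlgPolyhedron d) : Prop :=
  RepresentsMat w.1 (P.M.map Complex.ofReal) ∧ RepresentsVec w.2 (fun i => (P.b i : ℂ))

/-- The vector `(Re t₁, …, Re tₖ, Im t₁, …, Im tₖ)`. -/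
def reIm {k : ℕ} (t : Fin k → ℂ) : Fin (k + k) → ℝ :=
  Fin.append (fun i => (t i).re) (fun i => (t i).im)

/-- Instances of the Generalised Matrix-Exponential Problem. -/
structure GenMEP where
  n : ℕ
  k : ℕ
  A : Fin k → Matrix (Fin n) (Fin n) ℂ
  C : Matrix (Fin n) (Fin n) ℂ
  P : AlgPolyhedron (k + k)
  algebraic_A : ∀ l i j, IsAlgebraic ℚ (A l i j)
  algebraic_C : ∀ i j, IsAlgebraic ℚ (C i j)

/-- The matrices `A₁, …, Aₖ` commute pairwise. -/
def GenMEP.Commuting (I : GenMEP) : Prop := ∀ i j, Commute (I.A i) (I.A j)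

/-- There are `t₁, …, tₖ ∈ ℂ` with `exp (A₁ t₁) ⋯ exp (Aₖ tₖ) = C` that satisfy the polyhedral
constraint. -/
def GenMEP.Solvable (I : GenMEP) : Prop :=
  ∃ t : Fin I.k → ℂ,
    (List.ofFn fun i => NormedSpace.exp (t i • I.A i)).prod = I.C ∧ reIm t ∈ I.P.carrier

/-- Codes of instances of the Generalised Matrix-Exponential Problem: the list of the matrices
`A₁, …, Aₖ`, the matrix `C`, and the polyhedron. -/
abbrev GenMEPCode := List (List (List AlgCode)) × List (List AlgCode) × PolyhedronCode

def GenMEPCode.Represents (w : GenMEPCode) (I : GenMEP) : Prop :=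
  List.Forall₂ RepresentsMat w.1 (List.ofFn I.A) ∧ RepresentsMat w.2.1 I.C ∧
    PolyhedronCode.Represents w.2.2 I.P

/-- Instances of the Linear-Exponential Problem: `e` equations in `k` unknowns. -/
structure LEP where
  k : ℕ
  e : ℕ
  lam : Matrix (Fin e) (Fin k) ℂ
  c : Fin e → ℂ
  d : Fin e → ℂ
  P : AlgPolyhedron (k + k)
  algebraic_lam : ∀ j i, IsAlgebraic ℚ (lam j i)
  algebraic_c : ∀ j, IsAlgebraic ℚ (c j)
  algebraic_d : ∀ j, IsAlgebraic ℚ (d j)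

/-- There are `t₁, …, tₖ ∈ ℂ` with `exp (∑ i, λ j i * t i) = c j * exp (d j)` for all `j` that
satisfy the polyhedral constraint. -/
def LEP.Solvable (L : LEP) : Prop :=
  ∃ t : Fin L.k → ℂ,
    (∀ j, Complex.exp (∑ i, L.lam j i * t i) = L.c j * Complex.exp (L.d j)) ∧
      reIm t ∈ L.P.carrier

/-- Codes of instances of the Linear-Exponential Problem: the number of unknowns, the coefficients
`λ`, the constants `c` and `d`, and the polyhedron. -/
abbrev LEPCode :=
  ℕ × List (List AlgCode) × List AlgCode × List AlgCode × PolyhedronCode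

def LEPCode.Represents (w : LEPCode) (L : LEP) : Prop :=
  w.1 = L.k ∧ RepresentsMat w.2.1 L.lam ∧ RepresentsVec w.2.2.1 L.c ∧
    RepresentsVec w.2.2.2.1 L.d ∧ PolyhedronCode.Represents w.2.2.2.2 L.P

/-!
The Generalised MEP with commuting matrices reduces effectively to LEP.

*Idea of the reduction.* If the commuting matrices `A i` commute with an invertible matrix `C`, then
over the field of algebraic numbers they have a common normal form (`exists_normal_form`): in a
suitable basis `A i` is `D i + N i` and `C` is `D * exp L`, where the `D i` and `D` are diagonal,
the `N i` and `L` are nilpotent, and all these matrices commute. As the decomposition of a matrix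
into a diagonal and a commuting unipotent factor is unique and a nilpotent matrix is determined by
its exponential, `∏ exp (t i • A i) = C` holds exactly when `exp (∑ t i • D i) = D` and
`∑ t i • N i = L` (`Matrix.prod_exp_eq_iff`). The first identity is an equation of LEP for each
diagonal entry. The second one is linear, and a linear equation `z = w` is expressed by the two
equations `exp z = exp w` and `exp (i z) = exp (i w)` of LEP, because a complex number and its
multiple by `i` can be periods of the exponential only if they are zero. Hence the same unknowns and
the same polyhedron serve for the instance of LEP. If `C` fails to be invertible or to commute with
some `A i`, then no product of exponentials is equal to `C`, and the equation `exp 0 = 0` is an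
equivalent instance of LEP.

*Effectivity.* The output is not computed but searched for, together with a certificate of its
correctness. A predicate is semidecidable (`SemiDec`) if it is the projection of a primitive
recursive one; such predicates are closed under conjunction, disjunction, existential and bounded
universal quantification, and a semidecidable relation is uniformized by a partial recursive
function (`SemiDec.exists_partrec`). So it suffices that "`v` is justified as an output for `w`"
is semidecidable (`semiDec_isReduction`), that justified outputs are correct
(`IsReduction.exists_represents`) and that they exist (`exists_isReduction`). A justification is a
normal form, or a nonzero commutator, or a nonzero matrix annihilated by `C`, and to verify it means
to verify polynomial identities between algebraic numbers.

*Arithmetic of algebraic numbers.* That a code represents some number is certified by the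
irreducibility of the polynomial over `ℚ`, by a small value of the polynomial at the centre of the
disc, which forces a root nearby, and by disc arithmetic for a difference quotient, which excludes a
second root (`Certified`). An identity `∑ a i * b i = ∑ c j * d j` is certified by a
generator `θ` of a field that contains all the numbers: each number is written as a polynomial in
`θ`, disc arithmetic shows that this polynomial picks the right conjugate, and the identity becomes a
divisibility by the polynomial of `θ` (`DotEq`). No elimination theory or root separation bounds
are needed, as only the existence of certificates matters.
-/

section Certificates

/-! ### Semidecidable predicates -/

-- These instances keep the search for encodings of nested products from falling back on the
-- encodings of denumerable types. They are local because the encoding chosen for `LEPCode` without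
-- them is a different term, though its encoding function, all that matters for an output type, is
-- definitionally equal.
local instance RatCode.primcodable : Primcodable RatCode := Primcodable.prod

local instance AlgCode.primcodable : Primcodable AlgCode := Primcodable.prod

/-- A predicate is semidecidable when it is the projection of a primitive recursive one: `p x` holds
exactly when some natural number `c`, a certificate, passes a primitive recursive check. -/
def SemiDec {α : Type*} [Primcodable α] (p : α → Prop) : Prop :=
  ∃ q : α × ℕ → Bool, Primrec q ∧ ∀ x, p x ↔ ∃ c, q (x, c) = true

namespace SemiDec

variable {α β : Type*} [Primcodable α] [Primcodable β]

theorem of_primrec {p : α → Prop} (hp : PrimrecPred p) : SemiDec p := by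
  obtain ⟨_, hp⟩ := hp
  exact ⟨fun x => decide (p x.1), hp.comp Primrec.fst, fun x => by simp⟩

theorem of_iff {p q : α → Prop} (hp : SemiDec p) (h : ∀ x, q x ↔ p x) : SemiDec q := by
  obtain ⟨r, hr, hpr⟩ := hp
  exact ⟨r, hr, fun x => (h x).trans (hpr x)⟩

theorem comp {p : β → Prop} (hp : SemiDec p) {f : α → β} (hf : Primrec f) :
    SemiDec fun x => p (f x) := by
  obtain ⟨q, hq, hpq⟩ := hp
  exact ⟨fun x => q (f x.1, x.2), hq.comp ((hf.comp Primrec.fst).pair Primrec.snd),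
    fun x => hpq _⟩

theorem and {p q : α → Prop} (hp : SemiDec p) (hq : SemiDec q) : SemiDec fun x => p x ∧ q x := by
  obtain ⟨r, hr, hpr⟩ := hp
  obtain ⟨s, hs, hqs⟩ := hq
  refine ⟨fun x => r (x.1, x.2.unpair.1) && s (x.1, x.2.unpair.2), ?_, fun x => ?_⟩
  · have h1 : Primrec fun x : α × ℕ => x.2.unpair := Primrec.unpair.comp Primrec.snd
    exact Primrec.and.comp (hr.comp (Primrec.fst.pair (Primrec.fst.comp h1)))
      (hs.comp (Primrec.fst.pair (Primrec.snd.comp h1)))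
  · dsimp only
    rw [hpr, hqs]
    constructor
    · rintro ⟨⟨c, hc⟩, ⟨d, hd⟩⟩
      exact ⟨Nat.pair c d, by simp [hc, hd]⟩
    · rintro ⟨c, hc⟩
      simp only [Bool.and_eq_true] at hc
      exact ⟨⟨_, hc.1⟩, ⟨_, hc.2⟩⟩

theorem or {p q : α → Prop} (hp : SemiDec p) (hq : SemiDec q) : SemiDec fun x => p x ∨ q x := by
  obtain ⟨r, hr, hpr⟩ := hp
  obtain ⟨s, hs, hqs⟩ := hq
  refine ⟨fun x => r x || s x, Primrec.or.comp hr hs, fun x => ?_⟩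
  dsimp only
  rw [hpr, hqs, ← exists_or]
  simp

theorem exists_ {p : α × β → Prop} (hp : SemiDec p) : SemiDec fun x => ∃ y, p (x, y) := by
  obtain ⟨q, hq, hpq⟩ := hp
  refine ⟨fun x => ((Encodable.decode (α := β) x.2.unpair.1).map
    fun y => q ((x.1, y), x.2.unpair.2)).getD false, ?_, fun x => ?_⟩
  · have h1 : Primrec fun x : α × ℕ => x.2.unpair := Primrec.unpair.comp Primrec.snd
    refine Primrec.option_getD.comp (Primrec.option_map
      (Primrec.decode.comp (Primrec.fst.comp h1)) ?_) (Primrec.const false)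
    refine hq.comp (Primrec.pair (Primrec.pair (Primrec.fst.comp Primrec.fst) Primrec.snd) ?_)
    exact Primrec.snd.comp (h1.comp Primrec.fst)
  · constructor
    · rintro ⟨y, hy⟩
      obtain ⟨c, hc⟩ := (hpq _).1 hy
      exact ⟨Nat.pair (Encodable.encode y) c, by simp [hc]⟩
    · rintro ⟨c, hc⟩
      dsimp only at hc
      cases hd : Encodable.decode (α := β) c.unpair.1 with
      | none => simp [hd] at hc
      | some y => exact ⟨y, (hpq _).2 ⟨c.unpair.2, by simpa [hd] using hc⟩⟩

/-- Bounded universal quantification: a certificate is the list of the certificates of the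
instances. -/
theorem forall_mem {p : α × β → Prop} (hp : SemiDec p) {l : α → List β} (hl : Primrec l) :
    SemiDec fun x => ∀ y ∈ l x, p (x, y) := by
  obtain ⟨q, hq, hpq⟩ := hp
  have hR : PrimrecRel fun (i : ℕ) (z : α × List ℕ) =>
      (((l z.1)[i]?).map fun y => q ((z.1, y), z.2.getD i 0)).getD true = true := by
    refine Primrec.eq.comp (Primrec.option_getD.comp (Primrec.option_map
      (Primrec.list_getElem?.comp (hl.comp (Primrec.fst.comp Primrec.snd)) Primrec.fst) ?_)
      (Primrec.const true)) (Primrec.const true)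
    refine hq.comp (Primrec.pair (Primrec.pair
      (Primrec.fst.comp (Primrec.snd.comp Primrec.fst)) Primrec.snd) ?_)
    exact (Primrec.list_getD 0).comp (Primrec.snd.comp (Primrec.snd.comp Primrec.fst))
      (Primrec.fst.comp Primrec.fst)
  have hS : SemiDec fun x => ∃ cs : List ℕ, ∀ i < (l x).length,
      (((l x)[i]?).map fun y => q ((x, y), cs.getD i 0)).getD true = true := by
    refine exists_ (p := fun z : α × List ℕ => ∀ i < (l z.1).length,
      (((l z.1)[i]?).map fun y => q ((z.1, y), z.2.getD i 0)).getD true = true) (of_primrec ?_)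
    have h := hR.forall_mem_list.comp (f := fun z : α × List ℕ => List.range (l z.1).length)
      (Primrec.list_range.comp (Primrec.list_length.comp (hl.comp Primrec.fst))) Primrec.id
    exact h.of_eq fun z => by simp only [List.mem_range, id]
  refine hS.of_iff fun x => ?_
  constructor
  · intro h
    have h' : ∀ i : ℕ, ∃ c, ∀ hi : i < (l x).length, q ((x, (l x)[i]), c) = true := by
      intro i
      by_cases hi : i < (l x).length
      · obtain ⟨c, hc⟩ := (hpq _).1 (h _ (List.getElem_mem hi))
        exact ⟨c, fun _ => hc⟩
      · exact ⟨0, fun h => absurd h hi⟩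
    choose c hc using h'
    refine ⟨(List.range (l x).length).map c, fun i hi => ?_⟩
    simp [hi, List.getD, hc i hi]
  · rintro ⟨cs, h⟩ y hy
    obtain ⟨i, hi, rfl⟩ := List.getElem_of_mem hy
    exact (hpq _).2 ⟨_, by simpa [hi] using h i hi⟩

/-- A semidecidable relation contains the graph of a partial recursive function that is defined
wherever the relation allows it: search through all values and all certificates. -/
theorem exists_partrec {p : α × β → Prop} (hp : SemiDec p) :
    ∃ f : α →. β, Partrec f ∧ ∀ x, (∃ y, p (x, y)) → ∃ y ∈ f x, p (x, y) := by
  obtain ⟨q, hq, hpq⟩ := hp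
  let g : α → ℕ → Option β := fun x n => (Encodable.decode (α := β × ℕ) n).bind
    fun yc => bif q ((x, yc.1), yc.2) then some yc.1 else none
  have hg : Primrec₂ g := by
    refine Primrec.option_bind (Primrec.decode.comp Primrec.snd) ?_
    refine Primrec.cond (hq.comp (Primrec.pair (Primrec.pair (Primrec.fst.comp Primrec.fst)
      (Primrec.fst.comp Primrec.snd)) (Primrec.snd.comp Primrec.snd)))
      (Primrec.option_some.comp (Primrec.fst.comp Primrec.snd)) (Primrec.const none)
  refine ⟨fun x => Nat.rfindOpt (g x), Partrec.rfindOpt hg.to_comp, ?_⟩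
  rintro x ⟨y, hy⟩
  obtain ⟨c, hc⟩ := (hpq _).1 hy
  have hd : (Nat.rfindOpt (g x)).Dom := by
    refine Nat.rfindOpt_dom.2 ⟨Encodable.encode (y, c), y, ?_⟩
    simp [g, hc]
  refine ⟨_, Part.get_mem hd, ?_⟩
  obtain ⟨n, hn⟩ := Nat.rfindOpt_spec (Part.get_mem hd)
  generalize (Nat.rfindOpt (g x)).get hd = z at hn
  simp only [g] at hn
  cases h : Encodable.decode (α := β × ℕ) n with
  | none => simp [h] at hn
  | some yc =>
    simp only [h, Option.bind_some, Option.mem_def] at hn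
    cases hb : q ((x, yc.1), yc.2) with
    | false => simp [hb] at hn
    | true =>
      simp only [hb, cond_true, Option.some.injEq] at hn
      exact hn ▸ (hpq _).2 ⟨_, hb⟩

end SemiDec

/-! ### Integer arithmetic is primitive recursive -/

namespace Primrec

theorem int_subNatNat : Primrec₂ Int.subNatNat := by
  have h : Primrec₂ fun m n : ℕ => bif decide (n ≤ m) then 2 * (m - n) else 2 * (n - m - 1) + 1 := by
    have h1 : Primrec fun p : ℕ × ℕ => decide (p.2 ≤ p.1) :=
      (PrimrecRel.comp Primrec.nat_le Primrec.snd Primrec.fst).decide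
    refine Primrec.cond h1 ?_ ?_
    · exact Primrec.nat_double.comp (Primrec.nat_sub.comp Primrec.fst Primrec.snd)
    · exact Primrec.nat_double_succ.comp (Primrec.nat_sub.comp
        (Primrec.nat_sub.comp Primrec.snd Primrec.fst) (Primrec.const 1))
  refine Primrec₂.encode_iff.1 (h.of_eq fun m n => ?_)
  by_cases hmn : n ≤ m
  · rw [Int.subNatNat_of_le hmn]
    simp only [hmn, decide_true, cond_true]
    rfl
  · have hlt : m < n := not_le.1 hmn
    obtain ⟨k, rfl⟩ : ∃ k, n = m + k + 1 := ⟨n - m - 1, by omega⟩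
    rw [show m + k + 1 = m + (k + 1) by ring, Int.subNatNat_of_sub_eq_succ (k := k) (by omega)]
    simp only [show ¬ (m + (k + 1) ≤ m) by omega, decide_false, cond_false]
    rw [show m + (k + 1) - m - 1 = k by omega]
    rfl

theorem int_toNat : Primrec Int.toNat := by
  have h : Primrec fun n : ℕ => bif n.bodd then 0 else n.div2 :=
    Primrec.cond Primrec.nat_bodd (Primrec.const 0) Primrec.nat_div2
  refine (h.comp Primrec.encode).of_eq fun z => ?_
  cases z with
  | ofNat n =>
    have : Encodable.encode (n : ℤ) = 2 * n := rfl
    simp [this]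
  | negSucc n =>
    have : Encodable.encode (Int.negSucc n) = 2 * n + 1 := rfl
    simp [this]

theorem int_neg_toNat : Primrec fun z : ℤ => (-z).toNat := by
  have h : Primrec fun n : ℕ => bif n.bodd then n.div2 + 1 else 0 :=
    Primrec.cond Primrec.nat_bodd (Primrec.succ.comp Primrec.nat_div2) (Primrec.const 0)
  refine (h.comp Primrec.encode).of_eq fun z => ?_
  cases z with
  | ofNat n =>
    have : Encodable.encode (n : ℤ) = 2 * n := rfl
    simp [this]
  | negSucc n =>
    have : Encodable.encode (Int.negSucc n) = 2 * n + 1 := rfl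
    simp [this]

theorem nat_cast_int : Primrec (fun n : ℕ => (n : ℤ)) :=
  (int_subNatNat.comp Primrec.id (Primrec.const 0)).of_eq fun n => by simp [Int.subNatNat_of_le]

theorem int_neg : Primrec (fun z : ℤ => -z) :=
  (int_subNatNat.comp int_neg_toNat int_toNat).of_eq fun z => by
    rw [Int.subNatNat_eq_coe]; omega

theorem int_add : Primrec₂ ((· + ·) : ℤ → ℤ → ℤ) := by
  have h1 : Primrec fun p : ℤ × ℤ => p.1.toNat + p.2.toNat :=
    Primrec.nat_add.comp (int_toNat.comp Primrec.fst) (int_toNat.comp Primrec.snd)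
  have h2 : Primrec fun p : ℤ × ℤ => (-p.1).toNat + (-p.2).toNat :=
    Primrec.nat_add.comp (int_neg_toNat.comp Primrec.fst) (int_neg_toNat.comp Primrec.snd)
  refine (int_subNatNat.comp h1 h2).of_eq fun p => ?_
  rw [Int.subNatNat_eq_coe]; push_cast; omega

theorem int_mul : Primrec₂ ((· * ·) : ℤ → ℤ → ℤ) := by
  have p1 : Primrec fun p : ℤ × ℤ => p.1.toNat := int_toNat.comp Primrec.fst
  have p2 : Primrec fun p : ℤ × ℤ => p.2.toNat := int_toNat.comp Primrec.snd
  have n1 : Primrec fun p : ℤ × ℤ => (-p.1).toNat := int_neg_toNat.comp Primrec.fst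
  have n2 : Primrec fun p : ℤ × ℤ => (-p.2).toNat := int_neg_toNat.comp Primrec.snd
  have h1 := Primrec.nat_add.comp (Primrec.nat_mul.comp p1 p2) (Primrec.nat_mul.comp n1 n2)
  have h2 := Primrec.nat_add.comp (Primrec.nat_mul.comp p1 n2) (Primrec.nat_mul.comp n1 p2)
  refine (int_subNatNat.comp h1 h2).of_eq fun p => ?_
  rw [Int.subNatNat_eq_coe]
  obtain ⟨a, b⟩ := p
  have ha : a = (a.toNat : ℤ) - ((-a).toNat : ℤ) := by omega
  have hb : b = (b.toNat : ℤ) - ((-b).toNat : ℤ) := by omega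
  push_cast
  conv_rhs => rw [ha, hb]
  ring

theorem int_lt : PrimrecRel ((· < ·) : ℤ → ℤ → Prop) := by
  have h1 : Primrec fun p : ℤ × ℤ => p.1.toNat + (-p.2).toNat :=
    Primrec.nat_add.comp (int_toNat.comp Primrec.fst) (int_neg_toNat.comp Primrec.snd)
  have h2 : Primrec fun p : ℤ × ℤ => p.2.toNat + (-p.1).toNat :=
    Primrec.nat_add.comp (int_toNat.comp Primrec.snd) (int_neg_toNat.comp Primrec.fst)
  have h := PrimrecRel.comp Primrec.nat_lt h1 h2
  refine PrimrecPred.of_eq h fun p => ?_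
  omega

theorem int_abs : Primrec (fun z : ℤ => |z|) := by
  have h := Primrec.nat_add.comp int_toNat int_neg_toNat
  refine (nat_cast_int.comp h).of_eq fun z => ?_
  simp only [Nat.cast_add]
  rcases abs_cases z with h | h <;> omega

end Primrec

/-! ### Arithmetic on codes of rational numbers -/

namespace RatCode

/-- The code of the sum; the stored denominator is one less than the denominator. -/
def add (a b : RatCode) : RatCode :=
  (a.1 * ((b.2 + 1 : ℕ) : ℤ) + b.1 * ((a.2 + 1 : ℕ) : ℤ), (a.2 + 1) * (b.2 + 1) - 1)

/-- The code of the product. -/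
def mul (a b : RatCode) : RatCode := (a.1 * b.1, (a.2 + 1) * (b.2 + 1) - 1)

/-- The code of the negative. -/
def neg (a : RatCode) : RatCode := (-a.1, a.2)

/-- The code of the absolute value. -/
def abs (a : RatCode) : RatCode := (|a.1|, a.2)

theorem val_zero : RatCode.val (0, 0) = 0 := by simp [RatCode.val]

theorem val_one : RatCode.val (1, 0) = 1 := by simp [RatCode.val]

theorem val_add (a b : RatCode) : (add a b).val = a.val + b.val := by
  obtain ⟨a, m⟩ := a
  obtain ⟨b, n⟩ := b
  have hm : ((m : ℚ) + 1) ≠ 0 := by positivity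
  have hn : ((n : ℚ) + 1) ≠ 0 := by positivity
  have h : (((m + 1) * (n + 1) - 1 : ℕ) : ℚ) = (m + 1) * (n + 1) - 1 := by
    rw [Nat.cast_sub (Nat.one_le_iff_ne_zero.2 (by positivity))]; push_cast; ring
  simp only [RatCode.val, add, h]
  push_cast
  field_simp
  ring

theorem val_mul (a b : RatCode) : (mul a b).val = a.val * b.val := by
  obtain ⟨a, m⟩ := a
  obtain ⟨b, n⟩ := b
  have hm : ((m : ℚ) + 1) ≠ 0 := by positivity
  have hn : ((n : ℚ) + 1) ≠ 0 := by positivity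
  have h : (((m + 1) * (n + 1) - 1 : ℕ) : ℚ) = (m + 1) * (n + 1) - 1 := by
    rw [Nat.cast_sub (Nat.one_le_iff_ne_zero.2 (by positivity))]; push_cast; ring
  simp only [RatCode.val, mul, h]
  push_cast
  field_simp
  ring

theorem val_neg (a : RatCode) : (neg a).val = -a.val := by
  simp [RatCode.val, neg, neg_div]

theorem val_abs (a : RatCode) : (abs a).val = |a.val| := by
  have h : (0 : ℚ) ≤ (a.2 : ℚ) + 1 := by positivity
  simp [RatCode.val, abs, abs_div, abs_of_nonneg h]

theorem val_lt_iff (a b : RatCode) :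
    a.val < b.val ↔ a.1 * ((b.2 + 1 : ℕ) : ℤ) < b.1 * ((a.2 + 1 : ℕ) : ℤ) := by
  unfold RatCode.val
  rw [div_lt_div_iff₀ (by positivity) (by positivity)]
  exact_mod_cast Iff.rfl

theorem val_eq_iff (a b : RatCode) :
    a.val = b.val ↔ a.1 * ((b.2 + 1 : ℕ) : ℤ) = b.1 * ((a.2 + 1 : ℕ) : ℤ) := by
  unfold RatCode.val
  rw [div_eq_div_iff (by positivity) (by positivity)]
  exact_mod_cast Iff.rfl

theorem exists_val_eq (x : ℚ) : ∃ a : RatCode, a.val = x := by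
  refine ⟨(x.num, x.den - 1), ?_⟩
  have h : ((x.den - 1 : ℕ) : ℚ) + 1 = x.den := by
    rw [Nat.cast_sub x.den_pos]; simp
  simp only [RatCode.val, h, Rat.num_div_den]

theorem primrec_den : Primrec fun a : RatCode => a.2 + 1 := Primrec.succ.comp Primrec.snd

theorem primrec_add : Primrec₂ add := by
  have d1 : Primrec fun p : RatCode × RatCode => p.1.2 + 1 := primrec_den.comp Primrec.fst
  have d2 : Primrec fun p : RatCode × RatCode => p.2.2 + 1 := primrec_den.comp Primrec.snd
  have n1 : Primrec fun p : RatCode × RatCode => p.1.1 := Primrec.fst.comp Primrec.fst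
  have n2 : Primrec fun p : RatCode × RatCode => p.2.1 := Primrec.fst.comp Primrec.snd
  exact Primrec.pair (Primrec.int_add.comp
    (Primrec.int_mul.comp n1 (Primrec.nat_cast_int.comp d2))
    (Primrec.int_mul.comp n2 (Primrec.nat_cast_int.comp d1)))
    (Primrec.nat_sub.comp (Primrec.nat_mul.comp d1 d2) (Primrec.const 1))

theorem primrec_mul : Primrec₂ mul := by
  have d1 : Primrec fun p : RatCode × RatCode => p.1.2 + 1 := primrec_den.comp Primrec.fst
  have d2 : Primrec fun p : RatCode × RatCode => p.2.2 + 1 := primrec_den.comp Primrec.snd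
  have n1 : Primrec fun p : RatCode × RatCode => p.1.1 := Primrec.fst.comp Primrec.fst
  have n2 : Primrec fun p : RatCode × RatCode => p.2.1 := Primrec.fst.comp Primrec.snd
  exact Primrec.pair (Primrec.int_mul.comp n1 n2)
    (Primrec.nat_sub.comp (Primrec.nat_mul.comp d1 d2) (Primrec.const 1))

theorem primrec_neg : Primrec neg :=
  Primrec.pair (Primrec.int_neg.comp Primrec.fst) Primrec.snd

theorem primrec_abs : Primrec abs :=
  Primrec.pair (Primrec.int_abs.comp Primrec.fst) Primrec.snd

theorem primrecRel_val_lt : PrimrecRel fun a b : RatCode => a.val < b.val := by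
  have h := PrimrecRel.comp Primrec.int_lt
    (Primrec.int_mul.comp (Primrec.fst.comp Primrec.fst)
      (Primrec.nat_cast_int.comp (primrec_den.comp Primrec.snd)))
    (Primrec.int_mul.comp (Primrec.fst.comp Primrec.snd)
      (Primrec.nat_cast_int.comp (primrec_den.comp Primrec.fst)))
    (α := RatCode × RatCode)
  exact h.of_eq fun p => (val_lt_iff p.1 p.2).symm

theorem primrecRel_val_eq : PrimrecRel fun a b : RatCode => a.val = b.val := by
  have h := PrimrecRel.comp Primrec.eq
    (Primrec.int_mul.comp (Primrec.fst.comp Primrec.fst)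
      (Primrec.nat_cast_int.comp (primrec_den.comp Primrec.snd)))
    (Primrec.int_mul.comp (Primrec.fst.comp Primrec.snd)
      (Primrec.nat_cast_int.comp (primrec_den.comp Primrec.fst)))
    (α := RatCode × RatCode)
  exact h.of_eq fun p => (val_eq_iff p.1 p.2).symm

end RatCode

/-! ### Arithmetic on codes of polynomials -/

section Poly

open Polynomial

theorem polyOfCode_nil : polyOfCode [] = 0 := by simp [polyOfCode]

theorem polyOfCode_cons (a : RatCode) (l : List RatCode) :
    polyOfCode (a :: l) = C a.val + X * polyOfCode l := by
  unfold polyOfCode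
  refine (Fin.sum_univ_succ (n := l.length) _).trans ?_
  rw [Finset.mul_sum]
  simp [X_mul_monomial]

theorem coeff_polyOfCode (l : List RatCode) (i : ℕ) :
    (polyOfCode l).coeff i = (l.getD i (0, 0)).val := by
  induction l generalizing i with
  | nil => simp [polyOfCode_nil, RatCode.val_zero]
  | cons a l ih =>
    rw [polyOfCode_cons]
    cases i with
    | zero => simp
    | succ i => simp [ih]

theorem exists_polyOfCode_eq (p : ℚ[X]) : ∃ l, polyOfCode l = p := by
  choose c hc using RatCode.exists_val_eq
  refine ⟨(List.range (p.natDegree + 1)).map fun i => c (p.coeff i), ?_⟩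
  ext i
  rw [coeff_polyOfCode]
  by_cases hi : i < p.natDegree + 1
  · simp [List.getD, hi, hc]
  · rw [coeff_eq_zero_of_natDegree_lt (by omega)]
    simp [List.getD, hi, RatCode.val_zero]

/-- Sum of coefficient lists. -/
def polyAdd (l m : List RatCode) : List RatCode :=
  (List.range (max l.length m.length)).map fun i =>
    RatCode.add (l.getD i (0, 0)) (m.getD i (0, 0))

/-- Product of coefficient lists, by `(a + X p) q = a q + X (p q)`. -/
def polyMul (l m : List RatCode) : List RatCode :=
  l.foldr (fun a acc => polyAdd (m.map (RatCode.mul a)) ((0, 0) :: acc)) []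

/-- Composition of coefficient lists, by Horner's rule. -/
def polyComp (l m : List RatCode) : List RatCode :=
  l.foldr (fun a acc => polyAdd [a] (polyMul m acc)) []

theorem polyOfCode_add (l m : List RatCode) :
    polyOfCode (polyAdd l m) = polyOfCode l + polyOfCode m := by
  ext i
  rw [coeff_add, coeff_polyOfCode, coeff_polyOfCode, coeff_polyOfCode]
  by_cases hi : i < max l.length m.length
  · simp [polyAdd, List.getD, hi, RatCode.val_add]
  · have h1 : l.length ≤ i := by omega
    have h2 : m.length ≤ i := by omega
    simp [polyAdd, List.getD, hi, h1, h2, RatCode.val_zero]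

theorem polyOfCode_map_mul (a : RatCode) (l : List RatCode) :
    polyOfCode (l.map (RatCode.mul a)) = C a.val * polyOfCode l := by
  induction l with
  | nil => simp [polyOfCode_nil]
  | cons b l ih =>
    rw [List.map_cons, polyOfCode_cons, polyOfCode_cons, ih, RatCode.val_mul, C_mul]
    ring

theorem polyOfCode_mul (l m : List RatCode) :
    polyOfCode (polyMul l m) = polyOfCode l * polyOfCode m := by
  induction l with
  | nil => simp [polyMul, polyOfCode_nil]
  | cons a l ih =>
    have h : polyMul (a :: l) m = polyAdd (m.map (RatCode.mul a)) ((0, 0) :: polyMul l m) := rfl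
    rw [h, polyOfCode_add, polyOfCode_map_mul, polyOfCode_cons, polyOfCode_cons, ih,
      RatCode.val_zero]
    simp
    ring

theorem polyOfCode_comp (l m : List RatCode) :
    polyOfCode (polyComp l m) = (polyOfCode l).comp (polyOfCode m) := by
  induction l with
  | nil => simp [polyComp, polyOfCode_nil]
  | cons a l ih =>
    have h : polyComp (a :: l) m = polyAdd [a] (polyMul m (polyComp l m)) := rfl
    rw [h, polyOfCode_add, polyOfCode_mul, polyOfCode_cons, polyOfCode_cons, ih, polyOfCode_nil]
    simp

theorem primrec_polyAdd : Primrec₂ polyAdd := by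
  have hl : Primrec fun p : List RatCode × List RatCode =>
      List.range (max p.1.length p.2.length) :=
    Primrec.list_range.comp (Primrec.nat_max.comp (Primrec.list_length.comp Primrec.fst)
      (Primrec.list_length.comp Primrec.snd))
  refine Primrec.list_map hl (RatCode.primrec_add.comp₂ ?_ ?_)
  · exact (Primrec.list_getD (0, 0)).comp₂ (Primrec.fst.comp₂ Primrec₂.left) Primrec₂.right
  · exact (Primrec.list_getD (0, 0)).comp₂ (Primrec.snd.comp₂ Primrec₂.left) Primrec₂.right

theorem primrec_polyMul : Primrec₂ polyMul := by
  have h : Primrec₂ fun (p : List RatCode × List RatCode) (z : RatCode × List RatCode) =>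
      polyAdd (p.2.map (RatCode.mul z.1)) ((0, 0) :: z.2) := by
    refine primrec_polyAdd.comp₂ ?_ ?_
    · refine Primrec.list_map (Primrec.snd.comp Primrec.fst) (RatCode.primrec_mul.comp₂ ?_
        Primrec₂.right)
      exact (Primrec.fst.comp Primrec.snd).comp₂ Primrec₂.left
    · exact Primrec.list_cons.comp₂ (Primrec₂.const (0, 0)) (Primrec.snd.comp₂ Primrec₂.right)
  exact Primrec.list_foldr Primrec.fst (Primrec.const []) h

theorem primrec_polyComp : Primrec₂ polyComp := by
  have h : Primrec₂ fun (p : List RatCode × List RatCode) (z : RatCode × List RatCode) =>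
      polyAdd [z.1] (polyMul p.2 z.2) := by
    refine primrec_polyAdd.comp₂ ?_ ?_
    · exact Primrec.list_cons.comp₂ (Primrec.fst.comp₂ Primrec₂.right) (Primrec₂.const [])
    · exact primrec_polyMul.comp₂ (Primrec.snd.comp₂ Primrec₂.left)
        (Primrec.snd.comp₂ Primrec₂.right)
  exact Primrec.list_foldr Primrec.fst (Primrec.const []) h

theorem polyOfCode_eq_iff (l m : List RatCode) : polyOfCode l = polyOfCode m ↔
    ∀ i ∈ List.range (max l.length m.length),
      (l.getD i (0, 0)).val = (m.getD i (0, 0)).val := by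
  rw [Polynomial.ext_iff]
  simp only [coeff_polyOfCode, List.mem_range]
  refine ⟨fun h i _ => h i, fun h i => ?_⟩
  by_cases hi : i < max l.length m.length
  · exact h i hi
  · have h1 : l.length ≤ i := by omega
    have h2 : m.length ≤ i := by omega
    simp [List.getD, h1, h2]

theorem primrecRel_polyOfCode_eq :
    PrimrecRel fun l m : List RatCode => polyOfCode l = polyOfCode m := by
  have h : PrimrecRel fun (i : ℕ) (p : List RatCode × List RatCode) =>
      (p.1.getD i (0, 0)).val = (p.2.getD i (0, 0)).val :=
    RatCode.primrecRel_val_eq.comp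
      ((Primrec.list_getD (0, 0)).comp (Primrec.fst.comp Primrec.snd) Primrec.fst)
      ((Primrec.list_getD (0, 0)).comp (Primrec.snd.comp Primrec.snd) Primrec.fst)
  have h2 := h.forall_mem_list.comp
    (f := fun p : List RatCode × List RatCode => List.range (max p.1.length p.2.length))
    (Primrec.list_range.comp (Primrec.nat_max.comp (Primrec.list_length.comp Primrec.fst)
      (Primrec.list_length.comp Primrec.snd))) Primrec.id
  exact h2.of_eq fun p => (polyOfCode_eq_iff p.1 p.2).symm

theorem semiDec_polyOfCode_dvd :
    SemiDec fun p : List RatCode × List RatCode => polyOfCode p.1 ∣ polyOfCode p.2 := by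
  have h : SemiDec fun p : List RatCode × List RatCode =>
      ∃ m, polyOfCode p.2 = polyOfCode (polyMul p.1 m) := by
    refine SemiDec.exists_ (p := fun z : (List RatCode × List RatCode) × List RatCode =>
      polyOfCode z.1.2 = polyOfCode (polyMul z.1.1 z.2)) (SemiDec.of_primrec ?_)
    exact primrecRel_polyOfCode_eq.comp (Primrec.snd.comp Primrec.fst)
      (primrec_polyMul.comp (Primrec.fst.comp Primrec.fst) Primrec.snd)
  refine h.of_iff fun p => ⟨fun ⟨q, hq⟩ => ?_, fun ⟨m, hm⟩ => ⟨_, hm.trans (polyOfCode_mul _ _)⟩⟩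
  obtain ⟨m, rfl⟩ := exists_polyOfCode_eq q
  exact ⟨m, by rw [hq, polyOfCode_mul]⟩

theorem polyOfCode_append (l m : List RatCode) :
    polyOfCode (l ++ m) = polyOfCode l + X ^ l.length * polyOfCode m := by
  induction l with
  | nil => simp [polyOfCode_nil]
  | cons a l ih =>
    rw [List.cons_append, polyOfCode_cons, polyOfCode_cons, ih, List.length_cons]
    ring

theorem degree_polyOfCode_lt (l : List RatCode) : (polyOfCode l).degree < l.length := by
  rw [Polynomial.degree_lt_iff_coeff_zero]
  intro i hi
  rw [coeff_polyOfCode]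
  simp [List.getD, hi, RatCode.val_zero]

/-- The code of the monic polynomial with the given lower coefficients. -/
def monicCode (l : List RatCode) : List RatCode := l ++ [(1, 0)]

theorem polyOfCode_monicCode (l : List RatCode) :
    polyOfCode (monicCode l) = X ^ l.length + polyOfCode l := by
  rw [monicCode, polyOfCode_append, polyOfCode_cons, polyOfCode_nil, RatCode.val_one]
  simp [add_comm]

theorem monic_polyOfCode_monicCode (l : List RatCode) : (polyOfCode (monicCode l)).Monic := by
  rw [polyOfCode_monicCode]
  exact monic_X_pow_add (degree_polyOfCode_lt l)

theorem natDegree_polyOfCode_monicCode (l : List RatCode) :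
    (polyOfCode (monicCode l)).natDegree = l.length := by
  rw [polyOfCode_monicCode]
  exact natDegree_eq_of_degree_eq_some
    ((degree_add_eq_left_of_degree_lt (by simpa using degree_polyOfCode_lt l)).trans (by simp))

theorem primrec_monicCode : Primrec monicCode :=
  Primrec.list_append.comp Primrec.id (Primrec.const [(1, 0)])

end Poly

/-! ### Disc arithmetic -/

/-- Codes of closed discs in the complex plane: real and imaginary part of the centre, radius. -/
abbrev Disc := RatCode × RatCode × RatCode

local instance Disc.primcodable : Primcodable Disc := Primcodable.prod

namespace Disc

open Polynomial Filter Topology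

/-- The centre of the disc. -/
noncomputable def center (d : Disc) : ℂ :=
  ⟨((RatCode.val d.1 : ℚ) : ℝ), ((RatCode.val d.2.1 : ℚ) : ℝ)⟩

/-- The radius of the disc, possibly negative for a meaningless code. -/
noncomputable def radius (d : Disc) : ℝ := ((RatCode.val d.2.2 : ℚ) : ℝ)

/-- Membership in the closed disc. -/
def Contains (d : Disc) (z : ℂ) : Prop := ‖z - d.center‖ ≤ d.radius

/-- The disc of radius zero around a rational number. -/
def const (a : RatCode) : Disc := (a, (0, 0), (0, 0))

/-- A disc containing all sums. -/
def add (d e : Disc) : Disc :=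
  (RatCode.add d.1 e.1, RatCode.add d.2.1 e.2.1, RatCode.add d.2.2 e.2.2)

/-- A disc containing all products; the absolute values of the centres are estimated from above by
the sum of the absolute values of real and imaginary part, to stay within the rationals. -/
def mul (d e : Disc) : Disc :=
  (RatCode.add (RatCode.mul d.1 e.1) (RatCode.neg (RatCode.mul d.2.1 e.2.1)),
    RatCode.add (RatCode.mul d.1 e.2.1) (RatCode.mul d.2.1 e.1),
    RatCode.add (RatCode.mul d.2.2 e.2.2) (RatCode.add
      (RatCode.mul d.2.2 (RatCode.add (RatCode.abs e.1) (RatCode.abs e.2.1)))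
      (RatCode.mul e.2.2 (RatCode.add (RatCode.abs d.1) (RatCode.abs d.2.1)))))

theorem center_const (a : RatCode) : (const a).center = ((a.val : ℚ) : ℂ) := by
  apply Complex.ext <;> simp [const, center, RatCode.val_zero]

theorem radius_const (a : RatCode) : (const a).radius = 0 := by
  simp [const, radius, RatCode.val_zero]

theorem center_add (d e : Disc) : (add d e).center = d.center + e.center := by
  apply Complex.ext <;> simp [add, center, RatCode.val_add]

theorem radius_add (d e : Disc) : (add d e).radius = d.radius + e.radius := by
  simp [add, radius, RatCode.val_add]

theorem center_mul (d e : Disc) : (mul d e).center = d.center * e.center := by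
  apply Complex.ext <;>
    simp [mul, center, RatCode.val_add, RatCode.val_mul, RatCode.val_neg, sub_eq_add_neg]

theorem radius_mul (d e : Disc) : (mul d e).radius = d.radius * e.radius +
    (d.radius * (|e.center.re| + |e.center.im|) + e.radius * (|d.center.re| + |d.center.im|)) := by
  simp [mul, center, radius, RatCode.val_add, RatCode.val_mul, RatCode.val_abs]

theorem contains_const (a : RatCode) : (const a).Contains ((a.val : ℚ) : ℂ) := by
  simp [Contains, center_const, radius_const]

theorem Contains.add {d e : Disc} {z w : ℂ} (h : d.Contains z) (k : e.Contains w) :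
    (add d e).Contains (z + w) := by
  unfold Contains at *
  rw [center_add, radius_add, add_sub_add_comm]
  exact (norm_add_le _ _).trans (add_le_add h k)

theorem Contains.mul {d e : Disc} {z w : ℂ} (h : d.Contains z) (k : e.Contains w) :
    (mul d e).Contains (z * w) := by
  unfold Contains at *
  rw [center_mul, radius_mul]
  have h0 : 0 ≤ d.radius := (norm_nonneg _).trans h
  have k0 : 0 ≤ e.radius := (norm_nonneg _).trans k
  have e1 : z * w - d.center * e.center =
      (z - d.center) * (w - e.center) + ((z - d.center) * e.center + (w - e.center) * d.center) := by
    ring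
  rw [e1]
  refine (norm_add_le _ _).trans (add_le_add ?_ ((norm_add_le _ _).trans (add_le_add ?_ ?_)))
  · rw [norm_mul]; gcongr
  · rw [norm_mul]; gcongr; exact Complex.norm_le_abs_re_add_abs_im _
  · rw [norm_mul]; gcongr; exact Complex.norm_le_abs_re_add_abs_im _

/-- The filter of discs that shrink to the point `z`. -/
noncomputable def shrink (z : ℂ) : Filter Disc := comap (fun d => (d.center, d.radius)) (𝓝 (z, 0))

theorem tendsto_shrink_iff {α : Type*} {l : Filter α} {f : α → Disc} {z : ℂ} :
    Tendsto f l (shrink z) ↔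
      Tendsto (fun x => (f x).center) l (𝓝 z) ∧ Tendsto (fun x => (f x).radius) l (𝓝 0) := by
  rw [shrink, tendsto_comap_iff, Prod.tendsto_iff]
  rfl

theorem tendsto_center (z : ℂ) : Tendsto center (shrink z) (𝓝 z) :=
  (tendsto_shrink_iff.1 tendsto_id).1

theorem tendsto_radius (z : ℂ) : Tendsto radius (shrink z) (𝓝 0) :=
  (tendsto_shrink_iff.1 tendsto_id).2

theorem tendsto_const {α : Type*} {l : Filter α} (a : RatCode) :
    Tendsto (fun _ => const a) l (shrink ((a.val : ℚ) : ℂ)) := by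
  rw [tendsto_shrink_iff]
  simp only [center_const, radius_const]
  exact ⟨tendsto_const_nhds, tendsto_const_nhds⟩

theorem tendsto_add {α : Type*} {l : Filter α} {f g : α → Disc} {z w : ℂ}
    (hf : Tendsto f l (shrink z)) (hg : Tendsto g l (shrink w)) :
    Tendsto (fun x => add (f x) (g x)) l (shrink (z + w)) := by
  rw [tendsto_shrink_iff] at *
  simp only [center_add, radius_add]
  exact ⟨hf.1.add hg.1, by simpa using hf.2.add hg.2⟩

theorem tendsto_mul {α : Type*} {l : Filter α} {f g : α → Disc} {z w : ℂ}
    (hf : Tendsto f l (shrink z)) (hg : Tendsto g l (shrink w)) :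
    Tendsto (fun x => mul (f x) (g x)) l (shrink (z * w)) := by
  rw [tendsto_shrink_iff] at *
  simp only [center_mul, radius_mul]
  have h1 : ∀ {f : α → Disc} {z : ℂ}, Tendsto (fun x => (f x).center) l (𝓝 z) →
      Tendsto (fun x => |(f x).center.re| + |(f x).center.im|) l (𝓝 (|z.re| + |z.im|)) := by
    intro f z h
    exact ((Complex.continuous_re.tendsto _).comp h).abs.add
      ((Complex.continuous_im.tendsto _).comp h).abs
  exact ⟨hf.1.mul hg.1, by
    simpa using (hf.2.mul hg.2).add ((hf.2.mul (h1 hg.1)).add (hg.2.mul (h1 hf.1)))⟩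

theorem contains_const_zero : (const (0, 0)).Contains 0 := by
  simpa [RatCode.val_zero] using contains_const (0, 0)

theorem tendsto_const_zero {α : Type*} {l : Filter α} :
    Tendsto (fun _ => const (0, 0)) l (shrink 0) := by
  simpa [RatCode.val_zero] using tendsto_const (l := l) (0, 0)

/-- Horner's rule in disc arithmetic: a disc containing the values of the polynomial on `d`. -/
def horner (l : List RatCode) (d : Disc) : Disc :=
  l.foldr (fun a s => add (const a) (mul d s)) (const (0, 0))

theorem horner_cons (a : RatCode) (l : List RatCode) (d : Disc) :
    horner (a :: l) d = add (const a) (mul d (horner l d)) := rfl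

theorem contains_horner (l : List RatCode) {d : Disc} {z : ℂ} (h : d.Contains z) :
    (horner l d).Contains (aeval z (polyOfCode l)) := by
  induction l with
  | nil => rw [polyOfCode_nil, map_zero]; exact contains_const_zero
  | cons a l ih =>
    rw [polyOfCode_cons, horner_cons]
    simpa using (contains_const a).add (h.mul ih)

theorem center_horner (l : List RatCode) (d : Disc) :
    (horner l d).center = aeval d.center (polyOfCode l) := by
  induction l with
  | nil => simp [horner, polyOfCode_nil, center_const, RatCode.val_zero]
  | cons a l ih =>
    rw [horner_cons, center_add, center_mul, ih, center_const, polyOfCode_cons]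
    simp

theorem tendsto_horner (l : List RatCode) (z : ℂ) :
    Tendsto (horner l) (shrink z) (shrink (aeval z (polyOfCode l))) := by
  induction l with
  | nil => rw [polyOfCode_nil, map_zero]; exact tendsto_const_zero
  | cons a l ih =>
    rw [polyOfCode_cons, show horner (a :: l) = _ from funext (horner_cons a l)]
    simpa using tendsto_add (tendsto_const a) (tendsto_mul tendsto_id ih)

/-- Disc arithmetic for the difference quotient, by `P[u, v] = Q(u) + v Q[u, v]` for
`P = a + X Q`; the first component is `horner l d`. -/
def slopeAux (l : List RatCode) (d : Disc) : Disc × Disc :=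
  l.foldr (fun a s => (add (const a) (mul d s.1), add s.1 (mul d s.2))) (const (0, 0), const (0, 0))

/-- A disc containing the difference quotients of the polynomial on `d`. -/
def slope (l : List RatCode) (d : Disc) : Disc := (slopeAux l d).2

theorem slopeAux_fst (l : List RatCode) (d : Disc) : (slopeAux l d).1 = horner l d := by
  induction l with
  | nil => rfl
  | cons a l ih =>
    change add (const a) (mul d (slopeAux l d).1) = _
    rw [ih]
    rfl

theorem slope_cons (a : RatCode) (l : List RatCode) (d : Disc) :
    slope (a :: l) d = add (horner l d) (mul d (slope l d)) := by
  change add (slopeAux l d).1 (mul d (slopeAux l d).2) = _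
  rw [slopeAux_fst]
  rfl

theorem contains_slope (l : List RatCode) {d : Disc} {u v : ℂ} (hu : d.Contains u)
    (hv : d.Contains v) : ∃ δ, (slope l d).Contains δ ∧
      aeval u (polyOfCode l) - aeval v (polyOfCode l) = (u - v) * δ := by
  induction l with
  | nil => exact ⟨0, contains_const_zero, by simp [polyOfCode_nil]⟩
  | cons a l ih =>
    obtain ⟨δ, h1, h2⟩ := ih
    refine ⟨aeval u (polyOfCode l) + v * δ, ?_, ?_⟩
    · rw [slope_cons]
      exact (contains_horner l hu).add (hv.mul h1)
    · rw [polyOfCode_cons]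
      simp only [map_add, map_mul, aeval_C, aeval_X]
      linear_combination v * h2

/-- On a shrinking disc the difference quotients tend to the derivative. -/
theorem tendsto_slope (l : List RatCode) (z : ℂ) :
    Tendsto (slope l) (shrink z) (shrink (aeval z (derivative (polyOfCode l)))) := by
  induction l with
  | nil => rw [polyOfCode_nil, derivative_zero, map_zero]; exact tendsto_const_zero
  | cons a l ih =>
    rw [polyOfCode_cons, show slope (a :: l) = _ from funext (slope_cons a l)]
    simpa using tendsto_add (tendsto_horner l z) (tendsto_mul tendsto_id ih)

theorem shrink_basis {z : ℂ} {s : Set Disc} (hs : s ∈ shrink z) :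
    ∃ ε > 0, ∀ d : Disc, ‖d.center - z‖ < ε → |d.radius| < ε → d ∈ s := by
  obtain ⟨t, ht, hts⟩ := hs
  obtain ⟨ε, hε, hb⟩ := Metric.mem_nhds_iff.1 ht
  refine ⟨ε, hε, fun d h1 h2 => hts (hb ?_)⟩
  rw [Metric.mem_ball, Prod.dist_eq, max_lt_iff, dist_eq_norm, dist_eq_norm]
  exact ⟨h1, by simpa using h2⟩

theorem exists_center_mem {U : Set ℂ} (hU : IsOpen U) {z : ℂ} (hz : z ∈ U) :
    ∃ x y : RatCode, ∀ r, center (x, y, r) ∈ U := by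
  have hd : DenseRange fun p : ℚ × ℚ => (⟨(p.1 : ℝ), (p.2 : ℝ)⟩ : ℂ) := by
    have h1 : DenseRange (Prod.map ((↑) : ℚ → ℝ) ((↑) : ℚ → ℝ)) :=
      Rat.denseRange_cast.prodMap Rat.denseRange_cast
    have h2 := (Complex.equivRealProdCLM.symm.surjective.denseRange).comp h1
      Complex.equivRealProdCLM.symm.continuous
    exact h2
  obtain ⟨p, hp⟩ := hd.exists_mem_open hU ⟨z, hz⟩
  obtain ⟨x, hx⟩ := RatCode.exists_val_eq p.1
  obtain ⟨y, hy⟩ := RatCode.exists_val_eq p.2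
  exact ⟨x, y, fun r => by simpa [center, hx, hy] using hp⟩

/-- Near a zero `z` of `F` there are discs of any small size whose centre is almost a zero of
`F`. -/
theorem exists_mem_shrink {z : ℂ} {s : Set Disc} (hs : s ∈ shrink z) {F : ℂ → ℂ}
    (hF : Continuous F) (hz : F z = 0) (n : ℕ) :
    ∃ d ∈ s, 0 < d.radius ∧ ‖F d.center‖ < d.radius ^ n ∧
      ‖z - d.center‖ < d.radius := by
  obtain ⟨ε, hε, h⟩ := shrink_basis hs
  obtain ⟨q, hq0, hqε⟩ := exists_rat_btwn hε
  obtain ⟨r, hr⟩ := RatCode.exists_val_eq q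
  have hrad : ∀ x y, radius (x, y, r) = q := fun x y => by simp [radius, hr]
  obtain ⟨x, y, hxy⟩ := exists_center_mem
    (U := {c | ‖F c‖ < (q : ℝ) ^ n} ∩ {c | ‖c - z‖ < q})
    ((isOpen_lt hF.norm continuous_const).inter
      (isOpen_lt (continuous_id.sub continuous_const).norm continuous_const))
    (z := z) ⟨by simpa [hz] using pow_pos hq0 n, by simpa using hq0⟩
  refine ⟨(x, y, r), h _ ((hxy r).2.trans hqε) ?_, ?_, ?_, ?_⟩
  · rw [hrad, abs_of_pos hq0]; exact hqε
  · rw [hrad]; exact hq0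
  · rw [hrad]; exact (hxy r).1
  · rw [hrad, norm_sub_rev]; exact (hxy r).2

theorem primrec_const : Primrec const :=
  Primrec.pair Primrec.id (Primrec.const ((0, 0), (0, 0)))

theorem primrec_add : Primrec₂ add := by
  have h1 : Primrec fun p : Disc × Disc => RatCode.add p.1.1 p.2.1 :=
    RatCode.primrec_add.comp (Primrec.fst.comp Primrec.fst) (Primrec.fst.comp Primrec.snd)
  have h2 : Primrec fun p : Disc × Disc => RatCode.add p.1.2.1 p.2.2.1 :=
    RatCode.primrec_add.comp (Primrec.fst.comp (Primrec.snd.comp Primrec.fst))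
      (Primrec.fst.comp (Primrec.snd.comp Primrec.snd))
  have h3 : Primrec fun p : Disc × Disc => RatCode.add p.1.2.2 p.2.2.2 :=
    RatCode.primrec_add.comp (Primrec.snd.comp (Primrec.snd.comp Primrec.fst))
      (Primrec.snd.comp (Primrec.snd.comp Primrec.snd))
  exact h1.pair (h2.pair h3)

theorem primrec_mul : Primrec₂ mul := by
  have x1 : Primrec fun p : Disc × Disc => p.1.1 := Primrec.fst.comp Primrec.fst
  have y1 : Primrec fun p : Disc × Disc => p.1.2.1 :=
    Primrec.fst.comp (Primrec.snd.comp Primrec.fst)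
  have r1 : Primrec fun p : Disc × Disc => p.1.2.2 :=
    Primrec.snd.comp (Primrec.snd.comp Primrec.fst)
  have x2 : Primrec fun p : Disc × Disc => p.2.1 := Primrec.fst.comp Primrec.snd
  have y2 : Primrec fun p : Disc × Disc => p.2.2.1 :=
    Primrec.fst.comp (Primrec.snd.comp Primrec.snd)
  have r2 : Primrec fun p : Disc × Disc => p.2.2.2 :=
    Primrec.snd.comp (Primrec.snd.comp Primrec.snd)
  have A := RatCode.primrec_add
  have M := RatCode.primrec_mul
  exact (A.comp (M.comp x1 x2) (RatCode.primrec_neg.comp (M.comp y1 y2))).pair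
    ((A.comp (M.comp x1 y2) (M.comp y1 x2)).pair
      (A.comp (M.comp r1 r2) (A.comp
        (M.comp r1 (A.comp (RatCode.primrec_abs.comp x2) (RatCode.primrec_abs.comp y2)))
        (M.comp r2 (A.comp (RatCode.primrec_abs.comp x1) (RatCode.primrec_abs.comp y1))))))

theorem primrec_horner : Primrec₂ horner := by
  have h : Primrec₂ fun (p : List RatCode × Disc) (z : RatCode × Disc) =>
      add (const z.1) (mul p.2 z.2) :=
    primrec_add.comp₂ ((primrec_const.comp Primrec.fst).comp₂ Primrec₂.right)
      (primrec_mul.comp₂ (Primrec.snd.comp₂ Primrec₂.left) (Primrec.snd.comp₂ Primrec₂.right))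
  exact Primrec.list_foldr Primrec.fst (Primrec.const _) h

theorem primrec_slope : Primrec₂ slope := by
  have h : Primrec₂ fun (p : List RatCode × Disc) (z : RatCode × Disc × Disc) =>
      (add (const z.1) (mul p.2 z.2.1), add z.2.1 (mul p.2 z.2.2)) := by
    have s1 : Primrec fun q : (List RatCode × Disc) × RatCode × Disc × Disc => q.2.2.1 :=
      Primrec.fst.comp (Primrec.snd.comp Primrec.snd)
    have s2 : Primrec fun q : (List RatCode × Disc) × RatCode × Disc × Disc => q.2.2.2 :=
      Primrec.snd.comp (Primrec.snd.comp Primrec.snd)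
    have d : Primrec fun q : (List RatCode × Disc) × RatCode × Disc × Disc => q.1.2 :=
      Primrec.snd.comp Primrec.fst
    exact (primrec_add.comp (primrec_const.comp (Primrec.fst.comp Primrec.snd))
      (primrec_mul.comp d s1)).pair (primrec_add.comp s1 (primrec_mul.comp d s2))
  exact Primrec.snd.comp (Primrec.list_foldr Primrec.fst (Primrec.const _) h)

/-- The squared absolute value of the centre. -/
def normSq (d : Disc) : RatCode := RatCode.add (RatCode.mul d.1 d.1) (RatCode.mul d.2.1 d.2.1)

theorem val_normSq (d : Disc) : (((normSq d).val : ℚ) : ℝ) = ‖d.center‖ ^ 2 := by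
  rw [← Complex.normSq_eq_norm_sq, Complex.normSq_apply]
  simp [normSq, RatCode.val_add, RatCode.val_mul, center]

theorem primrec_normSq : Primrec normSq := by
  have x : Primrec fun p : Disc => p.1 := Primrec.fst
  have y : Primrec fun p : Disc => p.2.1 := Primrec.fst.comp Primrec.snd
  exact RatCode.primrec_add.comp (RatCode.primrec_mul.comp x x) (RatCode.primrec_mul.comp y y)

/-- Whether the norm of the centre is less than a given rational number. -/
theorem primrecRel_norm_center_lt :
    PrimrecRel fun (d : Disc) (r : RatCode) => ‖d.center‖ < ((r.val : ℚ) : ℝ) := by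
  have h1 : PrimrecPred fun p : Disc × RatCode => (RatCode.val (0, 0)) < p.2.val :=
    RatCode.primrecRel_val_lt.comp (Primrec.const (0, 0)) Primrec.snd
  have h2 : PrimrecPred fun p : Disc × RatCode => (normSq p.1).val < (RatCode.mul p.2 p.2).val :=
    RatCode.primrecRel_val_lt.comp (primrec_normSq.comp Primrec.fst)
      (RatCode.primrec_mul.comp Primrec.snd Primrec.snd)
  refine (h1.and h2).of_eq fun p => ?_
  rw [RatCode.val_zero, RatCode.val_mul, ← Rat.cast_lt (K := ℝ), ← Rat.cast_lt (K := ℝ),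
    val_normSq, Rat.cast_mul, ← sq, Rat.cast_zero]
  constructor
  · rintro ⟨h0, h⟩
    exact lt_of_pow_lt_pow_left₀ 2 h0.le h
  · intro h
    exact ⟨(norm_nonneg _).trans_lt h, pow_lt_pow_left₀ h (norm_nonneg _) two_ne_zero⟩

end Disc

/-! ### Irreducibility by bounded search for factors -/

section Irreducible

open Polynomial

/-- The coefficients of a monic factor of a monic rational polynomial have a bounded denominator
(after rescaling the roots the polynomial is integral, and `ℤ` is integrally closed) and bounded
absolute value (by the bound on the complex roots). -/
theorem exists_int_coeff_of_dvd {m g : ℚ[X]} (hm : m.Monic) (hg : g.Monic) (hgm : g ∣ m) {H D : ℕ}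
    (hD : 0 < D) (hH : ∀ i < m.natDegree, |m.coeff i| ≤ H)
    (hmD : ∀ i, ∃ z : ℤ, (D : ℚ) * m.coeff i = z) (i : ℕ) :
    ∃ z : ℤ, (D : ℚ) ^ m.natDegree * g.coeff i = z ∧
      |z| ≤ ((D ^ m.natDegree * (2 * (H + 1)) ^ m.natDegree : ℕ) : ℤ) := by
  have hle : g.natDegree ≤ m.natDegree := natDegree_le_of_dvd hgm hm.ne_zero
  have hD0 : (D : ℚ) ≠ 0 := by exact_mod_cast hD.ne'
  -- the polynomial with roots multiplied by `D` is integral, and hence so is its factor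
  have hint : ∃ z : ℤ, (D : ℚ) ^ m.natDegree * g.coeff i = z := by
    have hlift : m.scaleRoots (D : ℚ) ∈ lifts (algebraMap ℤ ℚ) := by
      rw [lifts_iff_coeff_lifts]
      intro j
      rw [coeff_scaleRoots]
      rcases lt_trichotomy j m.natDegree with hj | rfl | hj
      · obtain ⟨z, hz⟩ := hmD j
        refine ⟨z * (D : ℤ) ^ (m.natDegree - j - 1), ?_⟩
        have h1 : m.natDegree - j = (m.natDegree - j - 1) + 1 := by omega
        rw [h1, pow_succ]
        simp only [algebraMap_int_eq, eq_intCast, Int.cast_mul, Int.cast_pow, Int.cast_natCast,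
          ← hz, Nat.add_sub_cancel]
        ring
      · exact ⟨1, by simp [hm.coeff_natDegree]⟩
      · exact ⟨0, by simp [coeff_eq_zero_of_natDegree_lt hj]⟩
    obtain ⟨f, hf, -, hfm⟩ := lifts_and_natDegree_eq_and_monic hlift
      ((monic_scaleRoots_iff _).2 hm)
    obtain ⟨g', hg'⟩ := IsIntegrallyClosed.eq_map_mul_C_of_dvd ℚ hfm
      (hf ▸ scaleRoots_dvd g m (r := (D : ℚ)) hgm)
    rw [((monic_scaleRoots_iff (D : ℚ)).2 hg).leadingCoeff, C_1, mul_one] at hg'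
    have hc := congrArg (fun p => p.coeff i) hg'
    simp only [coeff_map, coeff_scaleRoots, algebraMap_int_eq, eq_intCast] at hc
    refine ⟨(D : ℤ) ^ (m.natDegree - (g.natDegree - i)) * g'.coeff i, ?_⟩
    push_cast
    rw [hc]
    have h2 : m.natDegree = (m.natDegree - (g.natDegree - i)) + (g.natDegree - i) := by omega
    conv_lhs => rw [h2, pow_add]
    ring
  obtain ⟨z, hz⟩ := hint
  refine ⟨z, hz, ?_⟩
  -- the roots of `g` are roots of `m`, and thus bounded by the Cauchy bound of `m`
  have hroots : ∀ w ∈ (g.map (algebraMap ℚ ℂ)).roots, ‖w‖ ≤ ((H + 1 : ℕ) : ℝ) := by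
    intro w hw
    have hm' : (m.map (algebraMap ℚ ℂ)) ≠ 0 := (hm.map _).ne_zero
    have hwm : (m.map (algebraMap ℚ ℂ)).IsRoot w :=
      (mem_roots'.1 hw).2.dvd (Polynomial.map_dvd _ hgm)
    have h1 := (hwm.norm_lt_cauchyBound hm').le
    have h2 : (m.map (algebraMap ℚ ℂ)).cauchyBound ≤ ((H + 1 : ℕ) : NNReal) := by
      unfold cauchyBound
      rw [(hm.map _).leadingCoeff, nnnorm_one, div_one, Nat.cast_add, Nat.cast_one]
      gcongr
      refine Finset.sup_le fun j hj => ?_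
      rw [Finset.mem_range, natDegree_map] at hj
      rw [coeff_map, ← NNReal.coe_le_coe]
      have := hH j hj
      simp only [eq_ratCast, coe_nnnorm, NNReal.coe_natCast, Complex.norm_ratCast]
      exact_mod_cast this
    exact_mod_cast h1.trans h2
  have hb := coeff_bdd_of_roots_le (algebraMap ℚ ℂ) hg (IsAlgClosed.splits _) hle hroots i
  rw [coeff_map, eq_ratCast, Complex.norm_ratCast, max_eq_left (by simp)] at hb
  have hb2 : |(g.coeff i : ℝ)| ≤ (2 * ((H : ℝ) + 1)) ^ m.natDegree := by
    refine hb.trans ?_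
    rw [mul_pow, mul_comm]
    push_cast
    gcongr
    exact_mod_cast Nat.choose_le_two_pow _ _
  have hb3 : |g.coeff i| ≤ (2 * ((H : ℚ) + 1)) ^ m.natDegree := by exact_mod_cast hb2
  have hz2 : |(z : ℚ)| = (D : ℚ) ^ m.natDegree * |g.coeff i| := by
    rw [← hz, abs_mul, abs_of_nonneg (by positivity)]
  have hz3 : |(z : ℚ)| ≤ (D : ℚ) ^ m.natDegree * (2 * ((H : ℚ) + 1)) ^ m.natDegree := by
    rw [hz2]; gcongr
  exact_mod_cast hz3

/-- All lists with entries from `S` that are as long as the list `l`. -/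
def tuples {α β : Type*} (S : List α) (l : List β) : List (List α) :=
  l.foldr (fun _ acc => S.flatMap fun a => acc.map fun t => a :: t) [[]]

theorem mem_tuples {α β : Type*} (S : List α) (l : List β) (t : List α) :
    t ∈ tuples S l ↔ t.length = l.length ∧ ∀ a ∈ t, a ∈ S := by
  induction l generalizing t with
  | nil => simp +contextual [tuples, List.length_eq_zero_iff]
  | cons b l ih =>
    have h : tuples S (b :: l) = S.flatMap fun a => (tuples S l).map fun t => a :: t := rfl
    rw [h]
    cases t with
    | nil => simp
    | cons c t => simp [ih, and_comm, and_assoc, and_left_comm]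

theorem primrec_tuples {α β : Type*} [Primcodable α] [Primcodable β] :
    Primrec₂ (tuples : List α → List β → List (List α)) := by
  have h1 : Primrec₂ fun (p : (List α × List β) × β × List (List α)) (a : α) =>
      p.2.2.map fun t => a :: t :=
    Primrec.list_map (Primrec.snd.comp (Primrec.snd.comp Primrec.fst))
      (Primrec.list_cons.comp₂ (Primrec.snd.comp₂ Primrec₂.left) Primrec₂.right)
  have h : Primrec₂ fun (p : List α × List β) (z : β × List (List α)) =>
      p.1.flatMap fun a => z.2.map fun t => a :: t :=
    Primrec.list_flatMap (Primrec.fst.comp Primrec.fst) h1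
  exact Primrec.list_foldr Primrec.snd (Primrec.const _) h

/-- The rational numbers `z / E` with `|z| ≤ N`, for `E = e + 1`. -/
def boundedRats (e N : ℕ) : List RatCode :=
  (List.range (2 * N + 1)).map fun j : ℕ => ((j : ℤ) + -(N : ℤ), e)

theorem mem_boundedRats {e N : ℕ} {z : ℤ} (hz : |z| ≤ N) : (z, e) ∈ boundedRats e N := by
  rw [boundedRats, List.mem_map]
  rw [abs_le] at hz
  refine ⟨(z + N).toNat, ?_, ?_⟩
  · rw [List.mem_range]; omega
  · ext
    · simp only; omega
    · rfl

theorem primrec_boundedRats : Primrec₂ boundedRats := by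
  have h : Primrec fun p : ℕ × ℕ => List.range (2 * p.2 + 1) :=
    Primrec.list_range.comp (Primrec.nat_double_succ.comp Primrec.snd)
  refine Primrec.list_map h (Primrec.pair (Primrec.int_add.comp
    (Primrec.nat_cast_int.comp Primrec.snd) (Primrec.int_neg.comp (Primrec.nat_cast_int.comp
      (Primrec.snd.comp Primrec.fst)))) (Primrec.fst.comp Primrec.fst))

/-- The candidates for the coefficient lists of proper factors of `monicCode l`, when the entries
of `l` have denominator `D + 1` and numerators of absolute value at most `H`. -/
def factorCandidates (l : List RatCode) (D H : ℕ) : List (List RatCode) :=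
  tuples (boundedRats ((D + 1) ^ l.length - 1)
    ((D + 1) ^ l.length * (2 * (H + 1)) ^ l.length)) l

theorem mem_factorCandidates {l : List RatCode} {D H : ℕ} (hD : ∀ e ∈ l, e.2 = D)
    (hH : ∀ e ∈ l, |e.1| ≤ H) {g : ℚ[X]} (hg : g.Monic) (hgm : g ∣ polyOfCode (monicCode l))
    (hdeg : g.natDegree < l.length) : ∃ c ∈ factorCandidates l D H, polyOfCode c = g := by
  have hm := monic_polyOfCode_monicCode l
  have hn := natDegree_polyOfCode_monicCode l
  have hlow : ∀ i < l.length, (polyOfCode (monicCode l)).coeff i = (l.getD i (0, 0)).val := by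
    intro i hi
    rw [polyOfCode_monicCode, coeff_add, coeff_X_pow, if_neg hi.ne, zero_add, coeff_polyOfCode]
  have hget : ∀ i < l.length, l.getD i (0, 0) ∈ l := by
    intro i hi
    rw [List.getD_eq_getElem _ _ hi]
    exact List.getElem_mem hi
  have key := exists_int_coeff_of_dvd hm hg hgm (H := H) (D := D + 1) (Nat.succ_pos D) ?_ ?_
  · rw [hn] at key
    choose z hz hzb using key
    have hE : (((D + 1) ^ l.length - 1 : ℕ) : ℚ) + 1 = ((D + 1 : ℕ) : ℚ) ^ l.length := by
      rw [Nat.cast_sub (Nat.one_le_pow _ _ (Nat.succ_pos D))]; push_cast; ring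
    refine ⟨(List.range l.length).map fun i => (z i, (D + 1) ^ l.length - 1), ?_, ?_⟩
    · rw [factorCandidates, mem_tuples]
      refine ⟨by simp, fun a ha => ?_⟩
      obtain ⟨i, -, rfl⟩ := List.mem_map.1 ha
      exact mem_boundedRats (hzb i)
    · ext i
      rw [coeff_polyOfCode]
      by_cases hi : i < l.length
      · have hne : ((D + 1 : ℕ) : ℚ) ^ l.length ≠ 0 := by positivity
        simp only [List.getD, List.getElem?_map, List.getElem?_range hi, Option.map_some,
          Option.getD_some, RatCode.val]
        rw [hE, ← hz]
        field_simp
      · rw [coeff_eq_zero_of_natDegree_lt (by omega)]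
        simp [List.getD, hi, RatCode.val_zero]
  · intro i hi
    rw [hn] at hi
    rw [hlow i hi]
    have h1 := hH _ (hget i hi)
    generalize l.getD i (0, 0) = e at h1
    have h2 : |(e.1 : ℚ)| ≤ H := by exact_mod_cast h1
    unfold RatCode.val
    rw [abs_div, abs_of_nonneg (by positivity : (0 : ℚ) ≤ (e.2 : ℚ) + 1)]
    exact (div_le_self (abs_nonneg _) (by linarith [(Nat.cast_nonneg e.2 : (0 : ℚ) ≤ e.2)])).trans h2
  · intro i
    rcases lt_trichotomy i l.length with hi | rfl | hi
    · rw [hlow i hi]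
      have h1 := hD _ (hget i hi)
      generalize l.getD i (0, 0) = e at h1
      refine ⟨e.1, ?_⟩
      subst h1
      unfold RatCode.val
      push_cast
      field_simp
    · refine ⟨(D + 1 : ℕ), ?_⟩
      have := hm.coeff_natDegree
      rw [hn] at this
      simp [this]
    · exact ⟨0, by rw [coeff_eq_zero_of_natDegree_lt (by omega)]; simp⟩

/-- The irreducibility test: no two candidates multiply to the polynomial. -/
def IrreducibleCheck (l : List RatCode) (D H : ℕ) : Prop :=
  l.length ≠ 0 ∧ (∀ e ∈ l, e.2 = D) ∧ (∀ e ∈ l, |e.1| < (H : ℤ) + 1) ∧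
    ∀ g ∈ factorCandidates l D H, ∀ h ∈ factorCandidates l D H,
      ¬ polyOfCode (polyMul g h) = polyOfCode (monicCode l)

theorem IrreducibleCheck.irreducible {l : List RatCode} {D H : ℕ} (h : IrreducibleCheck l D H) :
    Irreducible (polyOfCode (monicCode l)) := by
  obtain ⟨hl, hD, hH, hc⟩ := h
  have hm := monic_polyOfCode_monicCode l
  have hn := natDegree_polyOfCode_monicCode l
  have hH' : ∀ e ∈ l, |e.1| ≤ (H : ℤ) := fun e he => Int.lt_add_one_iff.1 (hH e he)
  rw [hm.irreducible_iff_natDegree]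
  refine ⟨fun h1 => hl (by rw [← hn, h1, natDegree_one]), fun f g hf hg hfg => ?_⟩
  by_contra! hcon
  have hsum : f.natDegree + g.natDegree = l.length := by
    rw [← hf.natDegree_mul hg, hfg, hn]
  obtain ⟨cf, hcf, rfl⟩ := mem_factorCandidates hD hH' hf ⟨g, hfg.symm⟩ (by omega)
  obtain ⟨cg, hcg, rfl⟩ := mem_factorCandidates hD hH' hg ⟨_, (mul_comm _ _).trans hfg |>.symm⟩
    (by omega)
  exact hc _ hcf _ hcg (by rw [polyOfCode_mul, hfg])

/-- Completeness of the irreducibility test, for suitable bounds on the coefficients. -/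
theorem exists_irreducibleCheck {m : ℚ[X]} (hm : m.Monic) (hi : Irreducible m) :
    ∃ l D H, polyOfCode (monicCode l) = m ∧ IrreducibleCheck l D H := by
  -- a common denominator `D + 1` of the coefficients
  obtain ⟨D, z, hz⟩ : ∃ (D : ℕ) (z : ℕ → ℤ), ∀ i < m.natDegree, m.coeff i = (z i : ℚ) / (D + 1) := by
    refine ⟨(∏ i ∈ Finset.range m.natDegree, (m.coeff i).den) - 1, fun i => (m.coeff i).num *
      ((∏ i ∈ Finset.range m.natDegree, (m.coeff i).den) / (m.coeff i).den : ℕ), fun i hi => ?_⟩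
    have hdvd := Finset.dvd_prod_of_mem (fun i => (m.coeff i).den) (Finset.mem_range.2 hi)
    have hpos : 0 < ∏ i ∈ Finset.range m.natDegree, (m.coeff i).den :=
      Finset.prod_pos fun j _ => (m.coeff j).den_pos
    generalize ∏ i ∈ Finset.range m.natDegree, (m.coeff i).den = P at *
    obtain ⟨c, rfl⟩ := hdvd
    have hd : ((m.coeff i).den : ℚ) ≠ 0 := by exact_mod_cast (m.coeff i).den_pos.ne'
    have hc : (c : ℚ) ≠ 0 := by
      rintro h
      have : c = 0 := by exact_mod_cast h
      simp [this] at hpos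
    dsimp only
    rw [Nat.mul_div_cancel_left _ (m.coeff i).den_pos, Nat.cast_sub hpos]
    push_cast
    rw [sub_add_cancel, mul_div_mul_right _ _ hc, Rat.num_div_den]
  have hlen : ((List.range m.natDegree).map fun i => (z i, D)).length = m.natDegree := by simp
  have hpoly : polyOfCode (monicCode ((List.range m.natDegree).map fun i => (z i, D))) = m := by
    ext i
    rw [polyOfCode_monicCode, coeff_add, coeff_polyOfCode, coeff_X_pow, hlen]
    rcases lt_trichotomy i m.natDegree with h | rfl | h
    · rw [if_neg h.ne, hz i h]
      simp [List.getD, h, RatCode.val]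
    · simp [List.getD, RatCode.val_zero, hm.coeff_natDegree]
    · rw [if_neg h.ne', coeff_eq_zero_of_natDegree_lt h]
      simp [List.getD, h.le, RatCode.val_zero]
  refine ⟨_, D, ∑ i ∈ Finset.range m.natDegree, (z i).natAbs, hpoly, ?_, ?_, ?_, ?_⟩
  · rw [hlen]
    exact hi.natDegree_pos.ne'
  · intro e he
    obtain ⟨i, -, rfl⟩ := List.mem_map.1 he
    rfl
  · intro e he
    obtain ⟨i, hir, rfl⟩ := List.mem_map.1 he
    have := Finset.single_le_sum (f := fun i => (z i).natAbs) (fun _ _ => Nat.zero_le _)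
      (Finset.mem_range.2 (List.mem_range.1 hir))
    simp only at this ⊢
    rw [Int.abs_eq_natAbs]
    omega
  · intro g hg h hh hgh
    rw [hpoly, polyOfCode_mul] at hgh
    -- both factors have degree less than that of `m`, so neither is a unit
    have hdeg : ∀ c ∈ factorCandidates ((List.range m.natDegree).map fun i => (z i, D)) D
        (∑ i ∈ Finset.range m.natDegree, (z i).natAbs), (polyOfCode c).degree < m.degree := by
      intro c hc
      have h1 := ((mem_tuples _ _ _).1 hc).1
      rw [hlen] at h1
      rw [degree_eq_natDegree hm.ne_zero, ← h1]
      exact degree_polyOfCode_lt c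
    have hne : m ≠ 0 := hm.ne_zero
    have hg0 : polyOfCode g ≠ 0 := fun h0 => hne (by rw [← hgh, h0, zero_mul])
    have hh0 : polyOfCode h ≠ 0 := fun h0 => hne (by rw [← hgh, h0, mul_zero])
    have hsum : (polyOfCode g).natDegree + (polyOfCode h).natDegree = m.natDegree := by
      rw [← hgh, natDegree_mul hg0 hh0]
    have hg1 := natDegree_lt_natDegree hg0 (hdeg g hg)
    have hh1 := natDegree_lt_natDegree hh0 (hdeg h hh)
    rcases hi.isUnit_or_isUnit hgh.symm with hu | hu
    · have := natDegree_eq_zero_of_isUnit hu; omega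
    · have := natDegree_eq_zero_of_isUnit hu; omega

theorem primrec_nat_pow : Primrec₂ ((· ^ ·) : ℕ → ℕ → ℕ) :=
  Primrec₂.unpaired'.1 Nat.Primrec.pow

theorem primrecPred_irreducibleCheck :
    PrimrecPred fun x : List RatCode × ℕ × ℕ => IrreducibleCheck x.1 x.2.1 x.2.2 := by
  have pl : Primrec fun x : List RatCode × ℕ × ℕ => x.1 := Primrec.fst
  have pD : Primrec fun x : List RatCode × ℕ × ℕ => x.2.1 := Primrec.fst.comp Primrec.snd
  have pH : Primrec fun x : List RatCode × ℕ × ℕ => x.2.2 := Primrec.snd.comp Primrec.snd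
  have pn : Primrec fun x : List RatCode × ℕ × ℕ => x.1.length := Primrec.list_length.comp pl
  have h1 : PrimrecPred fun x : List RatCode × ℕ × ℕ => x.1.length ≠ 0 :=
    (Primrec.eq.comp pn (Primrec.const 0)).not
  have h2 : PrimrecPred fun x : List RatCode × ℕ × ℕ => ∀ e ∈ x.1, e.2 = x.2.1 :=
    (PrimrecRel.forall_mem_list (R := fun (e : RatCode) (D : ℕ) => e.2 = D)
      (Primrec.eq.comp (Primrec.snd.comp Primrec.fst) Primrec.snd)).comp pl pD
  have h3 : PrimrecPred fun x : List RatCode × ℕ × ℕ => ∀ e ∈ x.1, |e.1| < (x.2.2 : ℤ) + 1 :=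
    (PrimrecRel.forall_mem_list (R := fun (e : RatCode) (H : ℕ) => |e.1| < (H : ℤ) + 1)
      (Primrec.int_lt.comp (Primrec.int_abs.comp (Primrec.fst.comp Primrec.fst))
        (Primrec.int_add.comp (Primrec.nat_cast_int.comp Primrec.snd) (Primrec.const 1)))).comp pl pH
  have pE : Primrec fun x : List RatCode × ℕ × ℕ => (x.2.1 + 1) ^ x.1.length :=
    primrec_nat_pow.comp (Primrec.succ.comp pD) pn
  have pB : Primrec fun x : List RatCode × ℕ × ℕ => (2 * (x.2.2 + 1)) ^ x.1.length :=
    primrec_nat_pow.comp (Primrec.nat_double.comp (Primrec.succ.comp pH)) pn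
  have pc : Primrec fun x : List RatCode × ℕ × ℕ => factorCandidates x.1 x.2.1 x.2.2 :=
    primrec_tuples.comp (primrec_boundedRats.comp (Primrec.nat_sub.comp pE (Primrec.const 1))
      (Primrec.nat_mul.comp pE pB)) pl
  have h4 : PrimrecRel fun (h : List RatCode) (y : List RatCode × List RatCode) =>
      ¬ polyOfCode (polyMul y.1 h) = polyOfCode (monicCode y.2) :=
    (primrecRel_polyOfCode_eq.comp (primrec_polyMul.comp (Primrec.fst.comp Primrec.snd) Primrec.fst)
      (primrec_monicCode.comp (Primrec.snd.comp Primrec.snd))).not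
  have h5 : PrimrecRel fun (g : List RatCode) (x : List RatCode × List (List RatCode)) =>
      ∀ h ∈ x.2, ¬ polyOfCode (polyMul g h) = polyOfCode (monicCode x.1) :=
    h4.forall_mem_list.comp (Primrec.snd.comp Primrec.snd)
      (Primrec.pair Primrec.fst (Primrec.fst.comp Primrec.snd))
  have h6 : PrimrecPred fun x : List RatCode × ℕ × ℕ => ∀ g ∈ factorCandidates x.1 x.2.1 x.2.2,
      ∀ h ∈ factorCandidates x.1 x.2.1 x.2.2,
        ¬ polyOfCode (polyMul g h) = polyOfCode (monicCode x.1) :=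
    h5.forall_mem_list.comp pc (Primrec.pair pl pc)
  exact h1.and (h2.and (h3.and h6))

end Irreducible

/-! ### Certified codes of algebraic numbers -/

section Certified

open Polynomial

/-- If `m` is monic and `|m(c)| < r ^ deg m`, then `m` has a root at distance less than `r` from
`c`, because `|m(c)|` is the product of the distances of `c` from the roots. -/
theorem exists_root_norm_sub_lt {m : ℂ[X]} (hm : m.Monic) {c : ℂ} {r : ℝ} (hr : 0 < r)
    (h : ‖m.eval c‖ < r ^ m.natDegree) : ∃ β, m.eval β = 0 ∧ ‖β - c‖ < r := by
  have hs : m.Splits := IsAlgClosed.splits m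
  by_contra! hcon
  have h1 : ∀ β ∈ m.roots, r ≤ ‖c - β‖ := fun β hβ => by
    rw [norm_sub_rev]
    exact hcon β (mem_roots'.1 hβ).2
  have h2 := Multiset.prod_map_le_prod_map₀ (fun _ : ℂ => r) (fun β => ‖c - β‖)
    (fun _ _ => hr.le) h1
  have h3 : ‖m.eval c‖ = (m.roots.map fun β => ‖c - β‖).prod := by
    rw [hs.eval_eq_prod_roots_of_monic hm, ← coe_nnnorm]
    have := (Multiset.prod_hom (m.roots.map fun β => c - β) (nnnormHom : ℂ →*₀ NNReal)).symm
    rw [show ‖(m.roots.map fun β => c - β).prod‖₊ = nnnormHom (m.roots.map fun β => c - β).prod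
      from rfl, this, Multiset.map_map]
    rw [← NNReal.coe_toRealHom, map_multiset_prod, Multiset.map_map]
    rfl
  simp only [Multiset.map_const', Multiset.prod_replicate] at h2
  rw [← hs.natDegree_eq_card_roots, ← h3] at h2
  exact absurd h (not_lt.2 h2)

/-- The power `r ^ l.length`. -/
def powLength (r : RatCode) (l : List RatCode) : RatCode :=
  l.foldr (fun _ acc => RatCode.mul r acc) (1, 0)

theorem val_powLength (r : RatCode) (l : List RatCode) :
    (powLength r l).val = r.val ^ l.length := by
  induction l with
  | nil => simp [powLength, RatCode.val_one]
  | cons a l ih =>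
    have h : powLength r (a :: l) = RatCode.mul r (powLength r l) := rfl
    rw [h, RatCode.val_mul, ih, List.length_cons, pow_succ']

theorem primrec_powLength : Primrec₂ powLength := by
  have h : Primrec₂ fun (p : RatCode × List RatCode) (z : RatCode × RatCode) =>
      RatCode.mul p.1 z.2 :=
    RatCode.primrec_mul.comp₂ (Primrec.fst.comp₂ Primrec₂.left) (Primrec.snd.comp₂ Primrec₂.right)
  exact Primrec.list_foldr Primrec.snd (Primrec.const _) h

/-- A test guaranteeing that the disc contains a root of the monic polynomial with lower
coefficients `l`. -/
def RootCheck (l : List RatCode) (d : Disc) : Prop :=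
  0 < d.radius ∧ ‖aeval d.center (polyOfCode (monicCode l))‖ < d.radius ^ l.length

theorem RootCheck.exists_root {l : List RatCode} {d : Disc} (h : RootCheck l d) :
    ∃ β, aeval β (polyOfCode (monicCode l)) = 0 ∧ ‖β - d.center‖ < d.radius := by
  have hm := (monic_polyOfCode_monicCode l).map (algebraMap ℚ ℂ)
  obtain ⟨β, h1, h2⟩ := exists_root_norm_sub_lt hm h.1 (c := d.center)
    (by rw [natDegree_map, natDegree_polyOfCode_monicCode, eval_map_algebraMap]; exact h.2)
  exact ⟨β, by rwa [eval_map_algebraMap] at h1, h2⟩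

theorem primrecPred_rootCheck :
    PrimrecPred fun x : List RatCode × Disc => RootCheck x.1 x.2 := by
  have pr : Primrec fun x : List RatCode × Disc => x.2.2.2 :=
    Primrec.snd.comp (Primrec.snd.comp Primrec.snd)
  have h1 : PrimrecPred fun x : List RatCode × Disc => (RatCode.val (0, 0)) < x.2.2.2.val :=
    RatCode.primrecRel_val_lt.comp (Primrec.const (0, 0)) pr
  have h2 := Disc.primrecRel_norm_center_lt.comp
    (f := fun x : List RatCode × Disc => Disc.horner (monicCode x.1) x.2)
    (g := fun x : List RatCode × Disc => powLength x.2.2.2 x.1)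
    (Disc.primrec_horner.comp (primrec_monicCode.comp Primrec.fst) Primrec.snd)
    (primrec_powLength.comp pr Primrec.fst)
  refine (h1.and h2).of_eq fun x => ?_
  rw [RootCheck, Disc.center_horner, val_powLength, RatCode.val_zero, ← Rat.cast_lt (K := ℝ),
    Rat.cast_pow, Rat.cast_zero]
  rfl

/-- A certified code: the polynomial is monic and passes the irreducibility test, the disc passes
the test for containing a root, and the difference quotients of the polynomial do not vanish on the
disc, so that there is at most one root in it. -/
def Certified (w : AlgCode) : Prop :=
  ∃ x : List RatCode × ℕ × ℕ, w.1 = monicCode x.1 ∧ IrreducibleCheck x.1 x.2.1 x.2.2 ∧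
    RootCheck x.1 w.2 ∧
    (RatCode.mul (Disc.slope w.1 w.2).2.2 (Disc.slope w.1 w.2).2.2).val <
      (Disc.normSq (Disc.slope w.1 w.2)).val

/-- Two roots in the disc are equal, since their difference quotient lies in a disc that excludes
zero. -/
theorem Certified.eq_of_root {w : AlgCode} (h : Certified w) {α β : ℂ}
    (hα : aeval α (polyOfCode w.1) = 0) (hαw : ‖α - AlgCode.center w‖ < AlgCode.radius w)
    (hβ : aeval β (polyOfCode w.1) = 0) (hβw : ‖β - AlgCode.center w‖ < AlgCode.radius w) :
    β = α := by
  obtain ⟨x, -, -, -, h4⟩ := h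
  obtain ⟨δ, hδ, hd⟩ := Disc.contains_slope w.1 (d := w.2) (u := β) (v := α) hβw.le hαw.le
  rw [hα, hβ, sub_zero] at hd
  rcases mul_eq_zero.1 hd.symm with h0 | rfl
  · exact sub_eq_zero.1 h0
  · exfalso
    rw [RatCode.val_mul, ← Rat.cast_lt (K := ℝ), Disc.val_normSq, Rat.cast_mul, ← sq] at h4
    rw [Disc.Contains, zero_sub, norm_neg] at hδ
    have := pow_le_pow_left₀ (norm_nonneg _) hδ 2
    exact absurd h4 (not_lt.2 this)

theorem Certified.represents_of_root {w : AlgCode} (h : Certified w) {α : ℂ}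
    (hα : aeval α (polyOfCode w.1) = 0) (hαw : ‖α - AlgCode.center w‖ < AlgCode.radius w) :
    w.Represents α := by
  have heq := fun {β} => h.eq_of_root hα hαw (β := β)
  obtain ⟨x, h1, h2, -, -⟩ := h
  have hm : (polyOfCode w.1).Monic := h1 ▸ monic_polyOfCode_monicCode _
  refine ⟨⟨_, hm.ne_zero, hα⟩, ?_, hαw, fun β => heq⟩
  exact minpoly.eq_of_irreducible_of_monic (h1 ▸ h2.irreducible) hα hm

theorem Certified.exists_represents {w : AlgCode} (h : Certified w) : ∃ α, w.Represents α := by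
  obtain ⟨x, h1, -, h3, -⟩ := id h
  obtain ⟨β, hβ, hβw⟩ := h3.exists_root
  exact ⟨β, h.represents_of_root (h1 ▸ hβ) hβw⟩

/-- Every algebraic number has a certified code: the disc may be taken so small that the difference
quotients on it are close to the derivative of the minimal polynomial, which does not vanish, and its
centre so close to the number that the test for roots succeeds. -/
theorem exists_certified {α : ℂ} (hα : IsAlgebraic ℚ α) :
    ∃ w, Certified w ∧ w.Represents α := by
  have hint := hα.isIntegral
  obtain ⟨l, D, H, hl, hi⟩ := exists_irreducibleCheck (minpoly.monic hint) (minpoly.irreducible hint)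
  have hroot : aeval α (polyOfCode (monicCode l)) = 0 := by rw [hl]; exact minpoly.aeval _ _
  have hder : aeval α (derivative (polyOfCode (monicCode l))) ≠ 0 := by
    rw [hl]
    exact (minpoly.irreducible hint).separable.aeval_derivative_ne_zero (minpoly.aeval _ _)
  have ht := Disc.tendsto_slope (monicCode l) α
  have hev : ∀ᶠ d in Disc.shrink α, (Disc.slope (monicCode l) d).radius ^ 2 <
      ‖(Disc.slope (monicCode l) d).center‖ ^ 2 := by
    have h1 := ((Disc.tendsto_radius _).comp ht).pow 2
    have h2 := ((Disc.tendsto_center _).comp ht).norm.pow 2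
    refine h1.eventually_lt h2 ?_
    rw [zero_pow two_ne_zero]
    positivity
  obtain ⟨d, hd, hr, hc, hαd⟩ := Disc.exists_mem_shrink hev
    (F := fun z => aeval z (polyOfCode (monicCode l))) (by fun_prop) hroot l.length
  have hcert : Certified (monicCode l, d) := by
    refine ⟨(l, D, H), rfl, hi, ⟨hr, hc⟩, ?_⟩
    rw [RatCode.val_mul, ← Rat.cast_lt (K := ℝ), Disc.val_normSq, Rat.cast_mul, ← sq]
    exact hd
  exact ⟨_, hcert, hcert.represents_of_root hroot hαd⟩

theorem semiDec_certified : SemiDec Certified := by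
  refine SemiDec.exists_ (p := fun z : AlgCode × List RatCode × ℕ × ℕ =>
    z.1.1 = monicCode z.2.1 ∧ IrreducibleCheck z.2.1 z.2.2.1 z.2.2.2 ∧ RootCheck z.2.1 z.1.2 ∧
    (RatCode.mul (Disc.slope z.1.1 z.1.2).2.2 (Disc.slope z.1.1 z.1.2).2.2).val <
      (Disc.normSq (Disc.slope z.1.1 z.1.2)).val) (SemiDec.of_primrec ?_)
  have pw : Primrec fun z : AlgCode × List RatCode × ℕ × ℕ => z.1.1 := Primrec.fst.comp Primrec.fst
  have pd : Primrec fun z : AlgCode × List RatCode × ℕ × ℕ => z.1.2 := Primrec.snd.comp Primrec.fst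
  have pl : Primrec fun z : AlgCode × List RatCode × ℕ × ℕ => z.2.1 := Primrec.fst.comp Primrec.snd
  have ps : Primrec fun z : AlgCode × List RatCode × ℕ × ℕ => Disc.slope z.1.1 z.1.2 :=
    Disc.primrec_slope.comp pw pd
  have pr : Primrec fun z : AlgCode × List RatCode × ℕ × ℕ => (Disc.slope z.1.1 z.1.2).2.2 :=
    Primrec.snd.comp (Primrec.snd.comp ps)
  exact (Primrec.eq.comp pw (primrec_monicCode.comp pl)).and
    ((primrecPred_irreducibleCheck.comp Primrec.snd).and
    ((primrecPred_rootCheck.comp (pl.pair pd)).and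
    (RatCode.primrecRel_val_lt.comp (RatCode.primrec_mul.comp pr pr)
      (Disc.primrec_normSq.comp ps))))

theorem AlgCode.Represents.unique {w : AlgCode} {α β : ℂ} (hα : w.Represents α)
    (hβ : w.Represents β) : α = β := by
  refine hβ.2.2.2 α ?_ hα.2.2.1
  rw [hα.2.1]
  exact minpoly.aeval _ _

end Certified

/-! ### Verifying sums of products of algebraic numbers -/

section DotEq

open Polynomial Filter

/-- The code represents some number. -/
def AlgCode.Valid (w : AlgCode) : Prop := ∃ α, w.Represents α

open Classical in
/-- The number represented by a code (zero, if there is none). -/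
noncomputable def AlgCode.value (w : AlgCode) : ℂ := if h : w.Valid then h.choose else 0

theorem AlgCode.Valid.represents {w : AlgCode} (h : w.Valid) : w.Represents w.value := by
  rw [AlgCode.value, dif_pos h]
  exact h.choose_spec

theorem AlgCode.Represents.valid {w : AlgCode} {α : ℂ} (h : w.Represents α) : w.Valid := ⟨α, h⟩

theorem AlgCode.Represents.value_eq {w : AlgCode} {α : ℂ} (h : w.Represents α) : w.value = α :=
  h.valid.represents.unique h

namespace Disc

/-- The closed disc `d` lies inside the open disc `e`, by the triangle inequality. -/
def Inside (d e : Disc) : Prop := ‖d.center - e.center‖ + d.radius < e.radius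

theorem primrecRel_inside : PrimrecRel Inside := by
  have h1 : Primrec fun p : Disc × Disc => Disc.add p.1
      (RatCode.neg p.2.1, RatCode.neg p.2.2.1, (0, 0)) :=
    primrec_add.comp Primrec.fst ((RatCode.primrec_neg.comp (Primrec.fst.comp Primrec.snd)).pair
      ((RatCode.primrec_neg.comp (Primrec.fst.comp (Primrec.snd.comp Primrec.snd))).pair
        (Primrec.const (0, 0))))
  have h2 : Primrec fun p : Disc × Disc => RatCode.add p.2.2.2 (RatCode.neg p.1.2.2) :=
    RatCode.primrec_add.comp (Primrec.snd.comp (Primrec.snd.comp Primrec.snd))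
      (RatCode.primrec_neg.comp (Primrec.snd.comp (Primrec.snd.comp Primrec.fst)))
  refine (primrecRel_norm_center_lt.comp h1 h2).of_eq fun p => ?_
  have h3 : Disc.center (RatCode.neg p.2.1, RatCode.neg p.2.2.1, (0, 0)) = -p.2.center := by
    apply Complex.ext <;> simp [center, RatCode.val_neg]
  rw [center_add, h3, ← sub_eq_add_neg, RatCode.val_add, RatCode.val_neg, Inside]
  push_cast
  rw [← sub_eq_add_neg, lt_sub_iff_add_lt]
  rfl

end Disc

/-- A link of a code to the number field generated by a root of the polynomial with lower
coefficients `l` in the disc `d`: the number represented by the code is the value of the polynomial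
`a.2` at that root. -/
def Linked (l : List RatCode) (d : Disc) (a : AlgCode × List RatCode) : Prop :=
  polyOfCode (monicCode l) ∣ polyOfCode (polyComp a.1.1 a.2) ∧ (Disc.horner a.2 d).Inside a.1.2

theorem Linked.aeval_eq {l : List RatCode} {d : Disc} {a : AlgCode × List RatCode}
    (h : Linked l d a) (ha : a.1.Valid) {θ : ℂ} (hθ : aeval θ (polyOfCode (monicCode l)) = 0)
    (hd : d.Contains θ) : aeval θ (polyOfCode a.2) = a.1.value := by
  refine ha.represents.2.2.2 _ ?_ ?_
  · rw [← aeval_comp, ← polyOfCode_comp]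
    exact aeval_eq_zero_of_dvd_aeval_eq_zero h.1 hθ
  · have h1 : ‖aeval θ (polyOfCode a.2) - (Disc.horner a.2 d).center‖ ≤ _ :=
      Disc.contains_horner a.2 hd
    have h2 := norm_add_le (aeval θ (polyOfCode a.2) - (Disc.horner a.2 d).center)
      ((Disc.horner a.2 d).center - Disc.center a.1.2)
    rw [sub_add_sub_cancel] at h2
    have h3 : _ < _ := h.2
    change ‖_ - Disc.center a.1.2‖ < Disc.radius a.1.2
    linarith

theorem semiDec_linked : SemiDec fun x : (List RatCode × Disc) × AlgCode × List RatCode =>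
    Linked x.1.1 x.1.2 x.2 := by
  have pa : Primrec fun x : (List RatCode × Disc) × AlgCode × List RatCode => x.2.1 :=
    Primrec.fst.comp Primrec.snd
  have pp : Primrec fun x : (List RatCode × Disc) × AlgCode × List RatCode => x.2.2 :=
    Primrec.snd.comp Primrec.snd
  exact (semiDec_polyOfCode_dvd.comp ((primrec_monicCode.comp (Primrec.fst.comp Primrec.fst)).pair
    (primrec_polyComp.comp (Primrec.fst.comp pa) pp))).and
    (SemiDec.of_primrec (Disc.primrecRel_inside.comp
      (Disc.primrec_horner.comp pp (Primrec.snd.comp Primrec.fst)) (Primrec.snd.comp pa)))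

/-- A pair of codes, each with a polynomial expressing the number in terms of a generator. -/
abbrev LinkedPair := (AlgCode × List RatCode) × AlgCode × List RatCode

local instance LinkedPair.primcodable : Primcodable LinkedPair := Primcodable.prod

/-- The polynomial expressing the sum of the products of the pairs. -/
def polyDot (L : List LinkedPair) : List RatCode :=
  L.foldr (fun a acc => polyAdd (polyMul a.1.2 a.2.2) acc) []

theorem polyOfCode_polyDot (L : List LinkedPair) : polyOfCode (polyDot L) =
    (L.map fun a => polyOfCode a.1.2 * polyOfCode a.2.2).sum := by
  induction L with
  | nil => exact polyOfCode_nil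
  | cons a L ih =>
    have h : polyDot (a :: L) = polyAdd (polyMul a.1.2 a.2.2) (polyDot L) := rfl
    rw [h, polyOfCode_add, polyOfCode_mul, ih, List.map_cons, List.sum_cons]

theorem primrec_polyDot : Primrec polyDot := by
  have h : Primrec₂ fun (_ : List LinkedPair) (z : LinkedPair × List RatCode) =>
      polyAdd (polyMul z.1.1.2 z.1.2.2) z.2 :=
    primrec_polyAdd.comp
      (primrec_polyMul.comp (Primrec.snd.comp (Primrec.fst.comp (Primrec.fst.comp Primrec.snd)))
        (Primrec.snd.comp (Primrec.snd.comp (Primrec.fst.comp Primrec.snd))))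
      (Primrec.snd.comp Primrec.snd)
  exact Primrec.list_foldr Primrec.id (Primrec.const []) h

/-- The pairs of codes, without the polynomials. -/
def stripLinks (L : List LinkedPair) : List (AlgCode × AlgCode) := L.map fun a => (a.1.1, a.2.1)

theorem primrec_stripLinks : Primrec stripLinks :=
  Primrec.list_map Primrec.id ((Primrec.fst.comp (Primrec.fst.comp Primrec.snd)).pair
    (Primrec.fst.comp (Primrec.snd.comp Primrec.snd)))

/-- The sum of the products of pairs of represented numbers. -/
noncomputable def dotValue (l : List (AlgCode × AlgCode)) : ℂ :=
  (l.map fun p => p.1.value * p.2.value).sum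

/-- The verifiable form of `dotValue l₁ = dotValue l₂`: all numbers are expressed as polynomials in
one algebraic number, and the difference of the two sides is divisible by a polynomial vanishing
there. -/
def DotEq (l₁ l₂ : List (AlgCode × AlgCode)) : Prop :=
  ∃ F : (List RatCode × Disc) × List LinkedPair × List LinkedPair,
    RootCheck F.1.1 F.1.2 ∧ stripLinks F.2.1 = l₁ ∧ stripLinks F.2.2 = l₂ ∧
    (∀ a ∈ F.2.1 ++ F.2.2, Linked F.1.1 F.1.2 a.1 ∧ Linked F.1.1 F.1.2 a.2) ∧
    polyOfCode (monicCode F.1.1) ∣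
      polyOfCode (polyAdd (polyDot F.2.1) (polyMul [(-1, 0)] (polyDot F.2.2)))

theorem semiDec_forall_linked : SemiDec fun x : (List RatCode × Disc) × List LinkedPair =>
    ∀ a ∈ x.2, Linked x.1.1 x.1.2 a.1 ∧ Linked x.1.1 x.1.2 a.2 := by
  have pF : Primrec fun y : ((List RatCode × Disc) × List LinkedPair) × LinkedPair => y.1.1 :=
    Primrec.fst.comp Primrec.fst
  have p1 : Primrec fun y : ((List RatCode × Disc) × List LinkedPair) × LinkedPair => y.2.1 :=
    Primrec.fst.comp Primrec.snd
  have p2 : Primrec fun y : ((List RatCode × Disc) × List LinkedPair) × LinkedPair => y.2.2 :=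
    Primrec.snd.comp Primrec.snd
  have h1 := semiDec_linked.comp (pF.pair p1)
  have h2 := semiDec_linked.comp (pF.pair p2)
  exact (h1.and h2).forall_mem Primrec.snd

theorem semiDec_dvd_polyDot : SemiDec fun x : List RatCode × List LinkedPair × List LinkedPair =>
    polyOfCode (monicCode x.1) ∣
      polyOfCode (polyAdd (polyDot x.2.1) (polyMul [(-1, 0)] (polyDot x.2.2))) := by
  have h : Primrec fun x : List RatCode × List LinkedPair × List LinkedPair =>
      polyAdd (polyDot x.2.1) (polyMul [(-1, 0)] (polyDot x.2.2)) :=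
    primrec_polyAdd.comp (primrec_polyDot.comp (Primrec.fst.comp Primrec.snd))
      (primrec_polyMul.comp (Primrec.const [(-1, 0)])
        (primrec_polyDot.comp (Primrec.snd.comp Primrec.snd)))
  exact semiDec_polyOfCode_dvd.comp ((primrec_monicCode.comp Primrec.fst).pair h)

theorem semiDec_dotEq :
    SemiDec fun x : List (AlgCode × AlgCode) × List (AlgCode × AlgCode) => DotEq x.1 x.2 := by
  refine SemiDec.exists_ (p := fun z : (List (AlgCode × AlgCode) × List (AlgCode × AlgCode)) ×
    (List RatCode × Disc) × List LinkedPair × List LinkedPair =>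
    RootCheck z.2.1.1 z.2.1.2 ∧ stripLinks z.2.2.1 = z.1.1 ∧ stripLinks z.2.2.2 = z.1.2 ∧
    (∀ a ∈ z.2.2.1 ++ z.2.2.2, Linked z.2.1.1 z.2.1.2 a.1 ∧ Linked z.2.1.1 z.2.1.2 a.2) ∧
    polyOfCode (monicCode z.2.1.1) ∣
      polyOfCode (polyAdd (polyDot z.2.2.1) (polyMul [(-1, 0)] (polyDot z.2.2.2)))) ?_
  have pF : Primrec fun z : (List (AlgCode × AlgCode) × List (AlgCode × AlgCode)) ×
    (List RatCode × Disc) × List LinkedPair × List LinkedPair => z.2.1 :=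
    Primrec.fst.comp Primrec.snd
  have p1 : Primrec fun z : (List (AlgCode × AlgCode) × List (AlgCode × AlgCode)) ×
    (List RatCode × Disc) × List LinkedPair × List LinkedPair => z.2.2.1 :=
    Primrec.fst.comp (Primrec.snd.comp Primrec.snd)
  have p2 : Primrec fun z : (List (AlgCode × AlgCode) × List (AlgCode × AlgCode)) ×
    (List RatCode × Disc) × List LinkedPair × List LinkedPair => z.2.2.2 :=
    Primrec.snd.comp (Primrec.snd.comp Primrec.snd)
  have h1 := SemiDec.of_primrec (primrecPred_rootCheck.comp pF)
  have h2 := SemiDec.of_primrec (Primrec.eq.comp (primrec_stripLinks.comp p1)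
    (Primrec.fst.comp Primrec.fst))
  have h3 := SemiDec.of_primrec (Primrec.eq.comp (primrec_stripLinks.comp p2)
    (Primrec.snd.comp Primrec.fst))
  have h4 := semiDec_forall_linked.comp (pF.pair (Primrec.list_append.comp p1 p2))
  have h5 := semiDec_dvd_polyDot.comp ((Primrec.fst.comp pF).pair (p1.pair p2))
  exact h1.and (h2.and (h3.and (h4.and h5)))

theorem DotEq.dotValue_eq {l₁ l₂ : List (AlgCode × AlgCode)} (h : DotEq l₁ l₂)
    (h₁ : ∀ p ∈ l₁, p.1.Valid ∧ p.2.Valid) (h₂ : ∀ p ∈ l₂, p.1.Valid ∧ p.2.Valid) :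
    dotValue l₁ = dotValue l₂ := by
  obtain ⟨⟨⟨l, d⟩, L₁, L₂⟩, hroot, rfl, rfl, hlink, hdvd⟩ := h
  obtain ⟨θ, hθ, hθd⟩ := hroot.exists_root
  have key : ∀ L : List LinkedPair, (∀ a ∈ L, Linked l d a.1 ∧ Linked l d a.2) →
      (∀ p ∈ stripLinks L, p.1.Valid ∧ p.2.Valid) →
      aeval θ (polyOfCode (polyDot L)) = dotValue (stripLinks L) := by
    intro L hL hV
    rw [polyOfCode_polyDot, map_list_sum, List.map_map, dotValue, stripLinks, List.map_map]
    congr 1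
    refine List.map_congr_left fun a ha => ?_
    have hv := hV (a.1.1, a.2.1) (List.mem_map.2 ⟨a, ha, rfl⟩)
    simp only [Function.comp_apply, map_mul]
    rw [(hL a ha).1.aeval_eq hv.1 hθ hθd.le, (hL a ha).2.aeval_eq hv.2 hθ hθd.le]
  have h0 := aeval_eq_zero_of_dvd_aeval_eq_zero hdvd hθ
  have hneg : polyOfCode [(-1, 0)] = -1 := by
    simp [polyOfCode_cons, polyOfCode_nil, RatCode.val]
  rw [polyOfCode_add, polyOfCode_mul, hneg, map_add, map_mul, map_neg, map_one,
    key L₁ (fun a ha => hlink a (List.mem_append_left _ ha)) h₁,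
    key L₂ (fun a ha => hlink a (List.mem_append_right _ ha)) h₂] at h0
  linear_combination h0

/-- Finitely many algebraic numbers are polynomials in a single one. -/
theorem exists_generator {S : Set ℂ} (hS : S.Finite) (h : ∀ x ∈ S, IsAlgebraic ℚ x) :
    ∃ θ : ℂ, IsIntegral ℚ θ ∧ ∀ x ∈ S, ∃ p : ℚ[X], aeval θ p = x := by
  have : Finite S := hS
  have : FiniteDimensional ℚ (IntermediateField.adjoin ℚ S) :=
    IntermediateField.finiteDimensional_adjoin fun x hx => (h x hx).isIntegral
  let pb := Field.powerBasisOfFiniteOfSeparable ℚ (IntermediateField.adjoin ℚ S)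
  refine ⟨pb.gen, ?_, fun x hx => ?_⟩
  · exact (Algebra.IsIntegral.isIntegral (R := ℚ) pb.gen).map
      (IntermediateField.val (IntermediateField.adjoin ℚ S))
  · obtain ⟨f, hf⟩ := pb.exists_eq_aeval' ⟨x, IntermediateField.subset_adjoin ℚ S hx⟩
    refine ⟨f, ?_⟩
    have := congrArg (IntermediateField.val (IntermediateField.adjoin ℚ S)) hf
    rw [← aeval_algHom_apply] at this
    exact this.symm

/-- Completeness of the verification of identities: the certificate uses the minimal polynomial of a
primitive element `θ` and a disc around `θ` so small that the values of all the polynomials on it stay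
within the discs of the codes. -/
theorem dotEq_of_dotValue_eq {l₁ l₂ : List (AlgCode × AlgCode)}
    (h₁ : ∀ p ∈ l₁, p.1.Valid ∧ p.2.Valid) (h₂ : ∀ p ∈ l₂, p.1.Valid ∧ p.2.Valid)
    (h : dotValue l₁ = dotValue l₂) : DotEq l₁ l₂ := by
  let W : Set AlgCode := {w | ∃ p ∈ l₁ ++ l₂, w = p.1 ∨ w = p.2}
  have hW : W.Finite := by
    have hfin := (l₁ ++ l₂).finite_toSet
    refine ((hfin.image Prod.fst).union (hfin.image Prod.snd)).subset ?_
    rintro w ⟨p, hp, rfl | rfl⟩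
    · exact Or.inl ⟨p, hp, rfl⟩
    · exact Or.inr ⟨p, hp, rfl⟩
  have hWV : ∀ w ∈ W, w.Valid := by
    rintro w ⟨p, hp, hw⟩
    have hv : p.1.Valid ∧ p.2.Valid := (List.mem_append.1 hp).elim (h₁ p) (h₂ p)
    rcases hw with rfl | rfl
    exacts [hv.1, hv.2]
  obtain ⟨θ, hθ, hgen⟩ := exists_generator (hW.image AlgCode.value) (by
    rintro _ ⟨w, hw, rfl⟩
    exact (hWV w hw).represents.1)
  have hP : ∀ w, ∃ c : List RatCode, w ∈ W → aeval θ (polyOfCode c) = w.value := by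
    intro w
    by_cases hw : w ∈ W
    · obtain ⟨p, hp⟩ := hgen _ ⟨w, hw, rfl⟩
      obtain ⟨c, rfl⟩ := exists_polyOfCode_eq p
      exact ⟨c, fun _ => hp⟩
    · exact ⟨[], fun h => absurd h hw⟩
  choose P hP using hP
  obtain ⟨l, -, -, hl, -⟩ := exists_irreducibleCheck (minpoly.monic hθ) (minpoly.irreducible hθ)
  have hroot : aeval θ (polyOfCode (monicCode l)) = 0 := by rw [hl]; exact minpoly.aeval _ _
  have hdvd : ∀ q : ℚ[X], aeval θ q = 0 → polyOfCode (monicCode l) ∣ q := fun q hq => by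
    rw [hl]; exact minpoly.dvd _ _ hq
  have hev : ∀ᶠ d in Disc.shrink θ, ∀ w ∈ W, (Disc.horner (P w) d).Inside w.2 := by
    rw [Filter.eventually_all_finite hW]
    intro w hw
    have ht := Disc.tendsto_horner (P w) θ
    rw [hP w hw] at ht
    have h1 := (((Disc.tendsto_center _).comp ht).sub_const (Disc.center w.2)).norm.add
      ((Disc.tendsto_radius _).comp ht)
    rw [add_zero] at h1
    exact h1.eventually_lt_const (hWV w hw).represents.2.2.1
  obtain ⟨d, hd, hr, hc, -⟩ := Disc.exists_mem_shrink hev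
    (F := fun z => aeval z (polyOfCode (monicCode l))) (by fun_prop) hroot l.length
  have hlink : ∀ w ∈ W, Linked l d (w, P w) := by
    intro w hw
    refine ⟨hdvd _ ?_, hd w hw⟩
    rw [polyOfCode_comp, aeval_comp, hP w hw, (hWV w hw).represents.2.1]
    exact minpoly.aeval _ _
  let link : AlgCode × AlgCode → LinkedPair := fun p => ((p.1, P p.1), (p.2, P p.2))
  have hstrip : ∀ m, stripLinks (m.map link) = m := by
    intro m
    rw [stripLinks, List.map_map]
    exact List.map_id m
  have hdot : ∀ m : List (AlgCode × AlgCode), (∀ p ∈ m, p ∈ l₁ ++ l₂) →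
      aeval θ (polyOfCode (polyDot (m.map link))) = dotValue m := by
    intro m hm
    rw [polyOfCode_polyDot, map_list_sum, List.map_map, List.map_map, dotValue]
    congr 1
    refine List.map_congr_left fun p hp => ?_
    simp only [Function.comp_apply, map_mul, link]
    rw [hP p.1 ⟨p, hm p hp, Or.inl rfl⟩, hP p.2 ⟨p, hm p hp, Or.inr rfl⟩]
  refine ⟨((l, d), l₁.map link, l₂.map link), ⟨hr, hc⟩, hstrip _, hstrip _, ?_, hdvd _ ?_⟩
  · intro a ha
    simp only [← List.map_append] at ha
    obtain ⟨p, hp, rfl⟩ := List.mem_map.1 ha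
    exact ⟨hlink _ ⟨p, hp, Or.inl rfl⟩, hlink _ ⟨p, hp, Or.inr rfl⟩⟩
  · have hneg : polyOfCode [(-1, 0)] = -1 := by
      simp [polyOfCode_cons, polyOfCode_nil, RatCode.val]
    simp only
    rw [polyOfCode_add, polyOfCode_mul, hneg, map_add, map_mul, map_neg, map_one,
      hdot l₁ fun p hp => List.mem_append_left _ hp,
      hdot l₂ fun p hp => List.mem_append_right _ hp, h]
    ring

end DotEq

/-! ### Verifying matrix identities -/

/-- Codes of matrices: lists of rows. -/
abbrev MatCode := List (List AlgCode)

local instance MatCode.primcodable : Primcodable MatCode := Primcodable.list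

open Classical in
/-- A certified code for every algebraic number. -/
noncomputable def codeOf (α : ℂ) : AlgCode :=
  if h : IsAlgebraic ℚ α then (exists_certified h).choose else ([], (0, 0), (0, 0), (0, 0))

theorem certified_codeOf {α : ℂ} (h : IsAlgebraic ℚ α) : Certified (codeOf α) := by
  rw [codeOf, dif_pos h]
  exact (exists_certified h).choose_spec.1

theorem represents_codeOf {α : ℂ} (h : IsAlgebraic ℚ α) : (codeOf α).Represents α := by
  rw [codeOf, dif_pos h]
  exact (exists_certified h).choose_spec.2

theorem value_codeOf {α : ℂ} (h : IsAlgebraic ℚ α) : (codeOf α).value = α :=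
  (represents_codeOf h).value_eq

theorem isAlgebraic_I : IsAlgebraic ℚ Complex.I :=
  IsAlgebraic.of_pow two_pos (by rw [Complex.I_sq]; exact isAlgebraic_one.neg)

theorem Certified.valid {w : AlgCode} (h : Certified w) : w.Valid := h.exists_represents

/-- The entries of a coded vector; zero outside of its range. -/
noncomputable def coord (l : List AlgCode) (i : ℕ) : AlgCode := l.getD i (codeOf 0)

/-- The entries of a coded matrix; zero outside of its range. -/
noncomputable def entry (X : MatCode) (i j : ℕ) : AlgCode := coord (X.getD i []) j

theorem primrec_coord : Primrec₂ coord := Primrec.list_getD _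

theorem primrec_entry : Primrec fun x : MatCode × ℕ × ℕ => entry x.1 x.2.1 x.2.2 :=
  primrec_coord.comp ((Primrec.list_getD []).comp Primrec.fst (Primrec.fst.comp Primrec.snd))
    (Primrec.snd.comp Primrec.snd)

/-- The `n × n` matrix denoted by a code. -/
noncomputable def matValue (n : ℕ) (X : MatCode) : Matrix (Fin n) (Fin n) ℂ :=
  Matrix.of fun i j => (entry X i j).value

/-- All entries of the leading `n × n` block represent numbers. -/
def MatValid (n : ℕ) (X : MatCode) : Prop := ∀ i < n, ∀ j < n, (entry X i j).Valid

/-- All entries of the leading `n × n` block are certified. -/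
def MatCertified (n : ℕ) (X : MatCode) : Prop :=
  ∀ i ∈ List.range n, ∀ j ∈ List.range n, Certified (entry X i j)

theorem MatCertified.valid {n : ℕ} {X : MatCode} (h : MatCertified n X) : MatValid n X :=
  fun i hi j hj => (h i (List.mem_range.2 hi) j (List.mem_range.2 hj)).valid

theorem MatValid.isAlgebraic {n : ℕ} {X : MatCode} (h : MatValid n X) (i j : Fin n) :
    IsAlgebraic ℚ (matValue n X i j) :=
  (h i i.2 j j.2).represents.1

theorem semiDec_matCertified : SemiDec fun x : ℕ × MatCode => MatCertified x.1 x.2 := by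
  have h1 : Primrec fun y : ((ℕ × MatCode) × ℕ) × ℕ => entry y.1.1.2 y.1.2 y.2 :=
    primrec_entry.comp ((Primrec.snd.comp (Primrec.fst.comp Primrec.fst)).pair
      ((Primrec.snd.comp Primrec.fst).pair Primrec.snd))
  have h2 := (semiDec_certified.comp h1).forall_mem
    (Primrec.list_range.comp (Primrec.fst.comp Primrec.fst))
  exact h2.forall_mem (Primrec.list_range.comp Primrec.fst)

/-- A certified code of a matrix of algebraic numbers. -/
noncomputable def matCode {n : ℕ} (A : Matrix (Fin n) (Fin n) ℂ) : MatCode :=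
  List.ofFn fun i => List.ofFn fun j => codeOf (A i j)

theorem entry_matCode {n : ℕ} (A : Matrix (Fin n) (Fin n) ℂ) (i j : Fin n) :
    entry (matCode A) i j = codeOf (A i j) := by
  simp [entry, coord, matCode, List.getD]

theorem matCertified_matCode {n : ℕ} {A : Matrix (Fin n) (Fin n) ℂ}
    (h : ∀ i j, IsAlgebraic ℚ (A i j)) : MatCertified n (matCode A) := by
  intro i hi j hj
  have := entry_matCode A ⟨i, List.mem_range.1 hi⟩ ⟨j, List.mem_range.1 hj⟩
  simp only at this
  rw [this]
  exact certified_codeOf (h _ _)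

theorem matValue_matCode {n : ℕ} {A : Matrix (Fin n) (Fin n) ℂ}
    (h : ∀ i j, IsAlgebraic ℚ (A i j)) : matValue n (matCode A) = A := by
  ext i j
  rw [matValue, Matrix.of_apply, entry_matCode, value_codeOf (h i j)]

/-- The code of a diagonal matrix. -/
noncomputable def diagCode (n : ℕ) (l : List AlgCode) : MatCode :=
  (List.range n).map fun i => (List.range n).map fun j => if i = j then coord l i else codeOf 0

theorem entry_diagCode (l : List AlgCode) {n i j : ℕ} (hi : i < n) (hj : j < n) :
    entry (diagCode n l) i j = if i = j then coord l i else codeOf 0 := by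
  simp [entry, coord, diagCode, List.getD, hi, hj]

theorem primrec_diagCode : Primrec₂ diagCode := by
  have h1 : Primrec fun x : ((ℕ × List AlgCode) × ℕ) × ℕ =>
      if x.1.2 = x.2 then coord x.1.1.2 x.1.2 else codeOf 0 :=
    Primrec.ite (Primrec.eq.comp (Primrec.snd.comp Primrec.fst) Primrec.snd)
      (primrec_coord.comp (Primrec.snd.comp (Primrec.fst.comp Primrec.fst))
        (Primrec.snd.comp Primrec.fst)) (Primrec.const _)
  have h2 : Primrec₂ fun (x : ℕ × List AlgCode) (i : ℕ) =>
      (List.range x.1).map fun j => if i = j then coord x.2 i else codeOf 0 :=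
    Primrec.list_map (Primrec.list_range.comp (Primrec.fst.comp Primrec.fst)) h1
  exact Primrec.list_map (Primrec.list_range.comp Primrec.fst) h2

theorem isAlgebraic_zero_complex : IsAlgebraic ℚ (0 : ℂ) := isAlgebraic_zero

theorem matValue_diagCode (n : ℕ) (l : List AlgCode) :
    matValue n (diagCode n l) = Matrix.diagonal fun i : Fin n => (coord l i).value := by
  ext i j
  rw [matValue, Matrix.of_apply, entry_diagCode l i.2 j.2, Matrix.diagonal_apply]
  by_cases h : i = j
  · simp [h]
  · rw [if_neg h, if_neg (fun h' => h (Fin.ext h')), value_codeOf isAlgebraic_zero_complex]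

/-- The first `n` entries are certified. -/
def VecCertified (n : ℕ) (l : List AlgCode) : Prop := ∀ i ∈ List.range n, Certified (coord l i)

theorem semiDec_vecCertified : SemiDec fun x : ℕ × List AlgCode => VecCertified x.1 x.2 := by
  have h1 : Primrec fun y : (ℕ × List AlgCode) × ℕ => coord y.1.2 y.2 :=
    primrec_coord.comp (Primrec.snd.comp Primrec.fst) Primrec.snd
  exact (semiDec_certified.comp h1).forall_mem (Primrec.list_range.comp Primrec.fst)

theorem VecCertified.matCertified {n : ℕ} {l : List AlgCode} (h : VecCertified n l) :
    MatCertified n (diagCode n l) := by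
  intro i hi j hj
  rw [entry_diagCode l (List.mem_range.1 hi) (List.mem_range.1 hj)]
  split_ifs
  · exact h i hi
  · exact certified_codeOf isAlgebraic_zero_complex

/-- The code of the scalar matrix with the given diagonal entry. -/
noncomputable def scalarCode (n : ℕ) (a : AlgCode) : MatCode :=
  diagCode n ((List.range n).map fun _ => a)

theorem coord_const {n i : ℕ} (a : AlgCode) (hi : i < n) :
    coord ((List.range n).map fun _ => a) i = a := by
  simp [coord, List.getD, hi]

theorem matValue_scalarCode (n : ℕ) (a : AlgCode) :
    matValue n (scalarCode n a) = a.value • 1 := by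
  rw [scalarCode, matValue_diagCode, Matrix.smul_one_eq_diagonal]
  congr 1
  funext i
  rw [coord_const a i.2]

theorem matCertified_scalarCode (n : ℕ) {a : AlgCode} (ha : Certified a) :
    MatCertified n (scalarCode n a) :=
  VecCertified.matCertified fun i hi => by rwa [coord_const a (List.mem_range.1 hi)]

theorem primrec_scalarCode : Primrec₂ scalarCode :=
  primrec_diagCode.comp Primrec.fst
    (Primrec.list_map (Primrec.list_range.comp Primrec.fst) (Primrec.snd.comp Primrec.fst))

/-- The code of the identity matrix. -/
noncomputable def oneCode (n : ℕ) : MatCode := scalarCode n (codeOf 1)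

theorem matValue_oneCode (n : ℕ) : matValue n (oneCode n) = 1 := by
  rw [oneCode, matValue_scalarCode, value_codeOf isAlgebraic_one, one_smul]

theorem matValid_oneCode (n : ℕ) : MatValid n (oneCode n) :=
  (matCertified_scalarCode n (certified_codeOf isAlgebraic_one)).valid

theorem primrec_oneCode : Primrec oneCode :=
  primrec_scalarCode.comp Primrec.id (Primrec.const _)

/-- The products of entries that add up to the entry `(i, j)` of the sum of the products of the
pairs of matrices in the list. -/
noncomputable def rowCol (n i j : ℕ) (L : List (MatCode × MatCode)) : List (AlgCode × AlgCode) :=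
  L.flatMap fun p => (List.range n).map fun s => (entry p.1 i s, entry p.2 s j)

theorem primrec_rowCol : Primrec fun x : (ℕ × ℕ × ℕ) × List (MatCode × MatCode) =>
    rowCol x.1.1 x.1.2.1 x.1.2.2 x.2 := by
  have pi : Primrec fun y : (((ℕ × ℕ × ℕ) × List (MatCode × MatCode)) × MatCode × MatCode) × ℕ =>
      y.1.1.1.2.1 :=
    Primrec.fst.comp (Primrec.snd.comp (Primrec.fst.comp (Primrec.fst.comp Primrec.fst)))
  have pj : Primrec fun y : (((ℕ × ℕ × ℕ) × List (MatCode × MatCode)) × MatCode × MatCode) × ℕ =>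
      y.1.1.1.2.2 :=
    Primrec.snd.comp (Primrec.snd.comp (Primrec.fst.comp (Primrec.fst.comp Primrec.fst)))
  have pX : Primrec fun y : (((ℕ × ℕ × ℕ) × List (MatCode × MatCode)) × MatCode × MatCode) × ℕ =>
      y.1.2.1 :=
    Primrec.fst.comp (Primrec.snd.comp Primrec.fst)
  have pY : Primrec fun y : (((ℕ × ℕ × ℕ) × List (MatCode × MatCode)) × MatCode × MatCode) × ℕ =>
      y.1.2.2 :=
    Primrec.snd.comp (Primrec.snd.comp Primrec.fst)
  have h1 := (primrec_entry.comp (pX.pair (pi.pair Primrec.snd))).pair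
    (primrec_entry.comp (pY.pair (Primrec.pair Primrec.snd pj)))
  have pn : Primrec fun y : ((ℕ × ℕ × ℕ) × List (MatCode × MatCode)) × MatCode × MatCode =>
      List.range y.1.1.1 :=
    Primrec.list_range.comp (Primrec.fst.comp (Primrec.fst.comp Primrec.fst))
  have h2 : Primrec fun y : ((ℕ × ℕ × ℕ) × List (MatCode × MatCode)) × MatCode × MatCode =>
      (List.range y.1.1.1).map fun s => (entry y.2.1 y.1.1.2.1 s, entry y.2.2 s y.1.1.2.2) :=
    Primrec.list_map pn h1
  exact Primrec.list_flatMap Primrec.snd h2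

/-- The sum of the products of the pairs of matrices in the list. -/
noncomputable def prodSum (n : ℕ) (L : List (MatCode × MatCode)) : Matrix (Fin n) (Fin n) ℂ :=
  (L.map fun p => matValue n p.1 * matValue n p.2).sum

theorem list_sum_range_map (n : ℕ) (f : ℕ → ℂ) : ((List.range n).map f).sum = ∑ s : Fin n, f s :=
  Finset.sum_range f

theorem prodSum_apply (n : ℕ) (L : List (MatCode × MatCode)) (i j : Fin n) :
    prodSum n L i j = dotValue (rowCol n i j L) := by
  induction L with
  | nil => simp [prodSum, dotValue, rowCol]
  | cons p L ih =>
    have h : dotValue (rowCol n i j (p :: L)) =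
        ((List.range n).map fun s => (entry p.1 i s).value * (entry p.2 s j).value).sum +
          dotValue (rowCol n i j L) := by
      simp only [dotValue, rowCol, List.flatMap_cons, List.map_append, List.sum_append,
        List.map_map]
      rfl
    rw [h, ← ih, list_sum_range_map]
    simp only [prodSum, List.map_cons, List.sum_cons, Matrix.add_apply, Matrix.mul_apply]
    rfl

/-- The verifiable form of `prodSum n L₁ = prodSum n L₂`. -/
def MatDotEq (n : ℕ) (L₁ L₂ : List (MatCode × MatCode)) : Prop :=
  ∀ i ∈ List.range n, ∀ j ∈ List.range n, DotEq (rowCol n i j L₁) (rowCol n i j L₂)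

theorem semiDec_matDotEq :
    SemiDec fun x : ℕ × List (MatCode × MatCode) × List (MatCode × MatCode) =>
      MatDotEq x.1 x.2.1 x.2.2 := by
  have pn : Primrec fun y : ((ℕ × List (MatCode × MatCode) × List (MatCode × MatCode)) × ℕ) × ℕ =>
      (y.1.1.1, y.1.2, y.2) :=
    (Primrec.fst.comp (Primrec.fst.comp Primrec.fst)).pair
      ((Primrec.snd.comp Primrec.fst).pair Primrec.snd)
  have p1 : Primrec fun y : ((ℕ × List (MatCode × MatCode) × List (MatCode × MatCode)) × ℕ) × ℕ =>
      y.1.1.2.1 := Primrec.fst.comp (Primrec.snd.comp (Primrec.fst.comp Primrec.fst))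
  have p2 : Primrec fun y : ((ℕ × List (MatCode × MatCode) × List (MatCode × MatCode)) × ℕ) × ℕ =>
      y.1.1.2.2 := Primrec.snd.comp (Primrec.snd.comp (Primrec.fst.comp Primrec.fst))
  have h1 := semiDec_dotEq.comp
    ((primrec_rowCol.comp (pn.pair p1)).pair (primrec_rowCol.comp (pn.pair p2)))
  have h2 := h1.forall_mem (Primrec.list_range.comp (Primrec.fst.comp Primrec.fst))
  exact h2.forall_mem (Primrec.list_range.comp Primrec.fst)

theorem valid_of_mem_rowCol {n i j : ℕ} (hi : i < n) (hj : j < n) {L : List (MatCode × MatCode)}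
    (h : ∀ p ∈ L, MatValid n p.1 ∧ MatValid n p.2) :
    ∀ q ∈ rowCol n i j L, q.1.Valid ∧ q.2.Valid := by
  intro q hq
  obtain ⟨p, hp, hq⟩ := List.mem_flatMap.1 hq
  obtain ⟨s, hs, rfl⟩ := List.mem_map.1 hq
  have hs := List.mem_range.1 hs
  exact ⟨(h p hp).1 i hi s hs, (h p hp).2 s hs j hj⟩

theorem matDotEq_iff {n : ℕ} {L₁ L₂ : List (MatCode × MatCode)}
    (h₁ : ∀ p ∈ L₁, MatValid n p.1 ∧ MatValid n p.2)
    (h₂ : ∀ p ∈ L₂, MatValid n p.1 ∧ MatValid n p.2) :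
    MatDotEq n L₁ L₂ ↔ prodSum n L₁ = prodSum n L₂ := by
  constructor
  · intro h
    ext i j
    rw [prodSum_apply, prodSum_apply]
    exact (h i (List.mem_range.2 i.2) j (List.mem_range.2 j.2)).dotValue_eq
      (valid_of_mem_rowCol i.2 j.2 h₁) (valid_of_mem_rowCol i.2 j.2 h₂)
  · intro h i hi j hj
    have hi := List.mem_range.1 hi
    have hj := List.mem_range.1 hj
    refine dotEq_of_dotValue_eq (valid_of_mem_rowCol hi hj h₁) (valid_of_mem_rowCol hi hj h₂) ?_
    have := congrFun (congrFun h ⟨i, hi⟩) ⟨j, hj⟩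
    rwa [prodSum_apply, prodSum_apply] at this

/-! ### Exponentials of nilpotent elements -/

section Nilpotent

theorem IsNilpotent.exp_eq_one_add {A : Type*} [Ring A] [Module ℚ A] [SMulCommClass ℚ A A]
    [IsScalarTower ℚ A A] {a : A} (ha : IsNilpotent a) :
    ∃ s, Commute a s ∧ IsNilpotent.exp a = 1 + a + a ^ 2 * s := by
  obtain ⟨k, hk⟩ := ha
  refine ⟨∑ i ∈ Finset.range k, ((i + 2).factorial : ℚ)⁻¹ • a ^ i, ?_, ?_⟩
  · exact Commute.sum_right _ _ _ fun i _ => ((Commute.refl a).pow_right i).smul_right _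
  · rw [IsNilpotent.exp_eq_sum (k := k + 2) (by rw [pow_add, hk, zero_mul]),
      Finset.sum_range_succ', Finset.sum_range_succ', Finset.mul_sum]
    simp only [mul_smul_comm, ← pow_add]
    have h : ∀ i, 2 + i = i + 1 + 1 := fun i => by omega
    simp [h]
    abel

/-- A nilpotent element with exponential `1` is zero, as `exp a - 1` is `a` times a unit. -/
theorem IsNilpotent.eq_zero_of_exp_eq_one {A : Type*} [Ring A] [Module ℚ A] [SMulCommClass ℚ A A]
    [IsScalarTower ℚ A A] {a : A} (ha : IsNilpotent a) (h : IsNilpotent.exp a = 1) : a = 0 := by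
  obtain ⟨s, hs, he⟩ := ha.exp_eq_one_add
  have hu : IsUnit (1 + a * s) := (hs.isNilpotent_mul_right ha).isUnit_one_add
  have h0 : a * (1 + a * s) = 0 := by
    rw [h, add_assoc, left_eq_add] at he
    rw [mul_add, mul_one, ← mul_assoc, ← sq, he]
  exact hu.mul_left_eq_zero.1 h0

/-- In a commutative ring every unipotent element `1 + x` is an exponential: successively, the
quotient of `1 + x` by an exponential becomes congruent to `1` modulo higher powers of `x`. -/
theorem exists_exp_eq_one_add_of_comm {R : Type*} [CommRing R] [Algebra ℚ R] {x : R}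
    (hx : IsNilpotent x) : ∃ l, IsNilpotent l ∧ IsNilpotent.exp l = 1 + x := by
  have key : ∀ r : ℕ, ∃ l, x ∣ l ∧ x ^ (r + 1) ∣ IsNilpotent.exp (-l) * (1 + x) - 1 := by
    intro r
    induction r with
    | zero => exact ⟨0, dvd_zero _, by simp⟩
    | succ r ih =>
      obtain ⟨l, hl, y, hy⟩ := ih
      have hzx : x ∣ x ^ (r + 1) * y := (dvd_pow_self x r.succ_ne_zero).mul_right y
      have hln : IsNilpotent l := by
        obtain ⟨c, rfl⟩ := hl
        exact (Commute.all _ _).isNilpotent_mul_right hx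
      have hzn : IsNilpotent (x ^ (r + 1) * y) := by
        obtain ⟨c, hc⟩ := hzx
        exact hc ▸ (Commute.all _ _).isNilpotent_mul_right hx
      refine ⟨l + x ^ (r + 1) * y, dvd_add hl hzx, ?_⟩
      obtain ⟨s, -, hs⟩ := hzn.neg.exp_eq_one_add
      rw [neg_add, IsNilpotent.exp_add_of_commute (Commute.all _ _) hln.neg hzn.neg, hs]
      have h1 : IsNilpotent.exp (-l) * (1 + x) = 1 + x ^ (r + 1) * y := by rw [← hy]; ring
      refine ⟨x ^ r * (y ^ 2 * (-1 + s * (1 + x ^ (r + 1) * y))), ?_⟩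
      linear_combination (1 + -(x ^ (r + 1) * y) + (-(x ^ (r + 1) * y)) ^ 2 * s) * h1
  obtain ⟨k, hk⟩ := hx
  obtain ⟨l, ⟨c, rfl⟩, hl⟩ := key k
  have hln : IsNilpotent (x * c) := (Commute.all _ _).isNilpotent_mul_right ⟨k, hk⟩
  refine ⟨_, hln, ?_⟩
  rw [pow_succ, hk, zero_mul, zero_dvd_iff, sub_eq_zero] at hl
  calc IsNilpotent.exp (x * c)
      = IsNilpotent.exp (x * c) * (IsNilpotent.exp (-(x * c)) * (1 + x)) := by rw [hl, mul_one]
    _ = 1 + x := by rw [← mul_assoc, IsNilpotent.exp_mul_exp_neg_self hln, one_mul]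

/-- Every unipotent element `1 + m` is the exponential of a nilpotent element that commutes with
everything that commutes with `m`. -/
theorem exists_exp_eq_one_add {R : Type*} [Ring R] [Algebra ℚ R] {m : R} (hm : IsNilpotent m) :
    ∃ l, IsNilpotent l ∧ IsNilpotent.exp l = 1 + m ∧ ∀ x, Commute x m → Commute x l := by
  have : IsMulCommutative (Algebra.adjoin ℚ {m}) :=
    Algebra.isMulCommutative_adjoin ℚ (by simp)
  obtain ⟨l, hl, hle⟩ := exists_exp_eq_one_add_of_comm
    (x := (⟨m, Algebra.self_mem_adjoin_singleton ℚ m⟩ : Algebra.adjoin ℚ {m})) (by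
      obtain ⟨k, hk⟩ := hm
      exact ⟨k, Subtype.ext (by simpa using hk)⟩)
  refine ⟨l, hl.map (Algebra.adjoin ℚ {m}).val, ?_, fun x hx => ?_⟩
  · have h := congrArg (Algebra.adjoin ℚ {m}).val hle
    rw [IsNilpotent.map_exp hl] at h
    simpa using h
  · exact Algebra.commute_of_mem_adjoin_singleton_of_commute l.2 hx

end Nilpotent

/-! ### Solving the matrix equation in a basis of joint eigenvectors -/

section Solve

variable {n : ℕ}

theorem Matrix.exp_eq_of_isNilpotent {X : Matrix (Fin n) (Fin n) ℂ} (hX : IsNilpotent X) :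
    NormedSpace.exp X = IsNilpotent.exp X := by
  obtain ⟨k, hk⟩ := hX
  rw [IsNilpotent.exp_eq_sum hk, NormedSpace.exp_eq_tsum ℚ]
  refine tsum_eq_sum fun i hi => ?_
  rw [pow_eq_zero_of_le (not_lt.1 fun h => hi (Finset.mem_range.2 h)) hk, smul_zero]

theorem Matrix.prod_map_exp (l : List (Matrix (Fin n) (Fin n) ℂ))
    (hl : ∀ X ∈ l, ∀ Y ∈ l, Commute X Y) :
    (l.map NormedSpace.exp).prod = NormedSpace.exp l.sum := by
  induction l with
  | nil => simp
  | cons X l ih =>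
    rw [List.map_cons, List.prod_cons, List.sum_cons, Matrix.exp_add_of_commute, ih]
    · exact fun Y hY Z hZ => hl Y (List.mem_cons_of_mem _ hY) Z (List.mem_cons_of_mem _ hZ)
    · exact Commute.list_sum_right _ _ fun Y hY =>
        hl X List.mem_cons_self Y (List.mem_cons_of_mem _ hY)

/-- A nilpotent diagonal matrix is zero. -/
theorem Matrix.eq_of_isNilpotent_diagonal_sub {v w : Fin n → ℂ}
    (h : IsNilpotent (Matrix.diagonal v - Matrix.diagonal w)) : v = w := by
  obtain ⟨k, hk⟩ := h
  rw [Matrix.diagonal_sub, Matrix.diagonal_pow] at hk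
  funext j
  have := congrFun (Matrix.diagonal_eq_zero.1 hk) j
  exact sub_eq_zero.1 (eq_zero_of_pow_eq_zero this)

/-- Uniqueness of the multiplicative Jordan decomposition, in a basis where the semisimple parts
are diagonal. -/
theorem Matrix.diagonal_mul_exp_eq_iff {v c : Fin n → ℂ} {N L : Matrix (Fin n) (Fin n) ℂ}
    (hN : IsNilpotent N) (hL : IsNilpotent L) (hNL : Commute N L)
    (hv : ∀ j, v j ≠ 0) (hcN : Commute (Matrix.diagonal c) N) (hcL : Commute (Matrix.diagonal c) L) :
    Matrix.diagonal v * IsNilpotent.exp N = Matrix.diagonal c * IsNilpotent.exp L ↔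
      v = c ∧ N = L := by
  constructor
  · intro h
    have hZ : IsNilpotent (L + -N) := hNL.symm.neg_right.isNilpotent_add hL hN.neg
    have h1 : Matrix.diagonal v = Matrix.diagonal c * IsNilpotent.exp (L + -N) := by
      rw [IsNilpotent.exp_add_of_commute hNL.symm.neg_right hL hN.neg, ← mul_assoc, ← h, mul_assoc,
        IsNilpotent.exp_mul_exp_neg_self hN, mul_one]
    have hcZ : Commute (Matrix.diagonal c) (IsNilpotent.exp (L + -N) - 1) := by
      refine Commute.sub_right ?_ (Commute.one_right _)
      obtain ⟨k, hk⟩ := hZ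
      rw [IsNilpotent.exp_eq_sum hk]
      exact Commute.sum_right _ _ _ fun i _ => ((hcL.add_right hcN.neg_right).pow_right i).smul_right _
    have h2 : Matrix.diagonal v - Matrix.diagonal c =
        Matrix.diagonal c * (IsNilpotent.exp (L + -N) - 1) := by rw [h1, mul_sub, mul_one]
    have hvc : v = c := Matrix.eq_of_isNilpotent_diagonal_sub
      (h2 ▸ hcZ.isNilpotent_mul_left (IsNilpotent.isNilpotent_exp_sub_one hZ))
    refine ⟨hvc, ?_⟩
    subst hvc
    have hu : IsUnit (Matrix.diagonal v) := by
      rw [Matrix.isUnit_diagonal, Pi.isUnit_iff]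
      exact fun j => (hv j).isUnit
    rw [sub_self] at h2
    have h3 := sub_eq_zero.1 (hu.mul_right_eq_zero.1 h2.symm)
    have h4 := hZ.eq_zero_of_exp_eq_one h3
    exact (eq_of_sub_eq_zero (by rw [sub_eq_add_neg]; exact h4)).symm
  · rintro ⟨rfl, rfl⟩
    rfl

/-- The matrix equation, when the matrices are brought by `P` to the form "diagonal plus commuting
nilpotent", and `C` to the form "diagonal times exponential of commuting nilpotent". -/
theorem Matrix.prod_exp_eq_iff {k : ℕ} {A N : Fin k → Matrix (Fin n) (Fin n) ℂ}
    {d : Fin k → Fin n → ℂ} {P Q C L : Matrix (Fin n) (Fin n) ℂ} {c : Fin n → ℂ} (hQP : Q * P = 1)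
    (hA : ∀ i, A i * P = P * Matrix.diagonal (d i) + P * N i)
    (hC : C * P = P * (Matrix.diagonal c * IsNilpotent.exp L))
    (hdN : ∀ i l, Commute (Matrix.diagonal (d i)) (N l)) (hNN : ∀ i l, Commute (N i) (N l))
    (hNL : ∀ i, Commute (N i) L) (hcN : ∀ i, Commute (Matrix.diagonal c) (N i))
    (hcL : Commute (Matrix.diagonal c) L) (hN : ∀ i, IsNilpotent (N i)) (hL : IsNilpotent L)
    (t : Fin k → ℂ) :
    (List.ofFn fun i => NormedSpace.exp (t i • A i)).prod = C ↔
      (∀ j, Complex.exp (∑ i, d i j * t i) = c j) ∧ ∑ i, t i • N i = L := by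
  have hPQ : P * Q = 1 := mul_eq_one_comm.1 hQP
  have hPu : IsUnit P := IsUnit.of_mul_eq_one Q hPQ
  have hPinv : P⁻¹ = Q := Matrix.inv_eq_left_inv hQP
  have hA' : ∀ i, A i = P * (Matrix.diagonal (d i) + N i) * Q := fun i => by
    rw [mul_add, ← hA, mul_assoc, hPQ, mul_one]
  have hC' : C = P * (Matrix.diagonal c * IsNilpotent.exp L) * Q := by
    rw [← hC, mul_assoc, hPQ, mul_one]
  have hB : ∀ i l, Commute (Matrix.diagonal (d i) + N i) (Matrix.diagonal (d l) + N l) := fun i l =>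
    ((Matrix.commute_diagonal _ _).add_right (hdN i l)).add_left
      ((hdN l i).symm.add_right (hNN i l))
  have hconj : ∀ X Y : Matrix (Fin n) (Fin n) ℂ, P * X * Q * (P * Y * Q) = P * (X * Y) * Q :=
    fun X Y => by
      calc P * X * Q * (P * Y * Q) = P * X * (Q * P) * Y * Q := by simp only [mul_assoc]
        _ = P * (X * Y) * Q := by rw [hQP, mul_one]; simp only [mul_assoc]
  have hAcomm : ∀ i l, Commute (A i) (A l) := fun i l => by
    rw [commute_iff_eq, hA', hA', hconj, hconj, (hB i l).eq]
  have hprod : (List.ofFn fun i => NormedSpace.exp (t i • A i)).prod =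
      NormedSpace.exp (∑ i, t i • A i) := by
    have h1 : (List.ofFn fun i => NormedSpace.exp (t i • A i)) =
        (List.ofFn fun i => t i • A i).map NormedSpace.exp := by
      rw [List.map_ofFn]; rfl
    rw [h1, Matrix.prod_map_exp, List.sum_ofFn]
    intro X hX Y hY
    obtain ⟨i, rfl⟩ := (List.mem_ofFn' _ _).1 hX
    obtain ⟨l, rfl⟩ := (List.mem_ofFn' _ _).1 hY
    exact ((hAcomm i l).smul_left _).smul_right _
  have hd : Matrix.diagonal (fun j => ∑ i, d i j * t i) =
      ∑ i, t i • (Matrix.diagonal (d i) : Matrix (Fin n) (Fin n) ℂ) := by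
    ext a b
    rw [Matrix.sum_apply]
    by_cases hab : a = b
    · subst hab
      simp [mul_comm]
    · simp [hab]
  have hsum : ∑ i, t i • A i =
      P * (Matrix.diagonal (fun j => ∑ i, d i j * t i) + ∑ i, t i • N i) * P⁻¹ := by
    rw [hPinv, hd, ← Finset.sum_add_distrib, Finset.mul_sum, Finset.sum_mul]
    refine Finset.sum_congr rfl fun i _ => ?_
    rw [hA', ← smul_add, mul_smul_comm, smul_mul_assoc]
  have hNnil : IsNilpotent (∑ i, t i • N i) := by
    refine Commute.isNilpotent_sum (fun i _ => (hN i).smul _) fun i l _ _ => ?_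
    exact ((hNN i l).smul_left _).smul_right _
  have hdNc : Commute (Matrix.diagonal fun j => ∑ i, d i j * t i) (∑ i, t i • N i) := by
    rw [hd]
    exact Commute.sum_left _ _ _ fun i _ => Commute.sum_right _ _ _ fun l _ =>
      ((hdN i l).smul_left _).smul_right _
  have hexp : NormedSpace.exp (∑ i, t i • A i) =
      P * (Matrix.diagonal (fun j => Complex.exp (∑ i, d i j * t i)) *
        IsNilpotent.exp (∑ i, t i • N i)) * Q := by
    rw [hsum, Matrix.exp_conj P _ hPu, hPinv, Matrix.exp_add_of_commute _ _ hdNc,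
      Matrix.exp_eq_of_isNilpotent hNnil, Matrix.exp_diagonal]
    congr 4
    funext j
    rw [Pi.coe_exp, Complex.exp_eq_exp_ℂ]
  have hcancel : ∀ X Y : Matrix (Fin n) (Fin n) ℂ, P * X * Q = P * Y * Q ↔ X = Y := by
    intro X Y
    refine ⟨fun h => ?_, fun h => by rw [h]⟩
    have h1 : ∀ Z : Matrix (Fin n) (Fin n) ℂ, Q * (P * Z * Q) * P = Z := fun Z => by
      calc Q * (P * Z * Q) * P = (Q * P) * Z * (Q * P) := by simp only [mul_assoc]
        _ = Z := by rw [hQP, one_mul, mul_one]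
    rw [← h1 X, h, h1 Y]
  rw [hprod, hexp, hC', hcancel, Matrix.diagonal_mul_exp_eq_iff hNnil hL
    (Commute.sum_left _ _ _ fun i _ => (hNL i).smul_left _) (fun j => Complex.exp_ne_zero _)
    (Commute.sum_right _ _ _ fun i _ => (hcN i).smul_right _) hcL, funext_iff]

end Solve

/-! ### Simultaneous Jordan decomposition of commuting matrices -/

section Jordan

variable {K : Type*} [Field K] [IsAlgClosed K] {n : ℕ}

open Module in
/-- Commuting semisimple endomorphisms have a basis of joint eigenvectors. -/
theorem exists_basis_joint_eigenvectors {ι : Type*} (s : ι → End K (Fin n → K))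
    (hs : ∀ i, (s i).IsSemisimple) (hcomm : ∀ i l, Commute (s i) (s l)) :
    ∃ (b : Basis (Fin n) K (Fin n → K)) (d : ι → Fin n → K), ∀ i j, s i (b j) = d i j • b j := by
  have htop := End.iSup_iInf_maxGenEigenspace_eq_top_of_iSup_maxGenEigenspace_eq_top_of_commute s
    (fun i l _ => hcomm i l) (fun i => End.iSup_maxGenEigenspace_eq_top (s i))
  let S : Set (Fin n → K) := {v | ∃ χ : ι → K, ∀ i, s i v = χ i • v}
  have hspan : ⊤ ≤ Submodule.span K S := by
    rw [← htop]
    refine iSup_le fun χ v hv => Submodule.subset_span ⟨χ, fun i => ?_⟩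
    have h1 := (Submodule.mem_iInf _).1 hv i
    rw [(hs i).isFinitelySemisimple.maxGenEigenspace_eq_eigenspace] at h1
    exact End.mem_eigenspace_iff.1 h1
  let b₀ := Basis.ofSpan hspan
  have : Fintype (Set.range b₀) := by
    have : Finite (Set.range b₀) := Module.Finite.finite_basis b₀.reindexRange
    exact Fintype.ofFinite _
  let b := b₀.reindexRange.reindex (Fintype.equivFinOfCardEq (n := n) (by
    rw [← Module.finrank_eq_card_basis b₀.reindexRange, Module.finrank_fin_fun]))
  have hb : ∀ j, ∃ χ : ι → K, ∀ i, s i (b j) = χ i • b j := by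
    intro j
    have h1 : b j ∈ S := by
      apply Basis.ofSpan_subset hspan
      simp only [b, Basis.reindex_apply, Basis.reindexRange_apply]
      exact Subtype.coe_prop _
    exact h1
  choose χ hχ using hb
  exact ⟨b, fun i j => χ j i, fun i j => hχ j i⟩

variable [CharZero K]

/-- Commuting matrices over an algebraically closed field can be brought simultaneously to the form
"diagonal plus nilpotent", where all the diagonal and nilpotent matrices commute. -/
theorem exists_simultaneous_jordan {ι : Type*} (A : ι → Matrix (Fin n) (Fin n) K)
    (hcomm : ∀ i l, Commute (A i) (A l)) :
    ∃ (P Q : Matrix (Fin n) (Fin n) K) (d : ι → Fin n → K) (N : ι → Matrix (Fin n) (Fin n) K),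
      Q * P = 1 ∧ (∀ i, A i * P = P * Matrix.diagonal (d i) + P * N i) ∧
      (∀ i, IsNilpotent (N i)) ∧ (∀ i l, Commute (Matrix.diagonal (d i)) (N l)) ∧
      ∀ i l, Commute (N i) (N l) := by
  let f : ι → Module.End K (Fin n → K) := fun i => Matrix.toLinAlgEquiv' (A i)
  have hf : ∀ i l, Commute (f i) (f l) := fun i l => (hcomm i l).map Matrix.toLinAlgEquiv'
  have hJ := fun i => (f i).exists_isNilpotent_isSemisimple
  choose ν hν s hs hνnil hss hfs using hJ
  have hadj : ∀ i l, ∀ x ∈ Algebra.adjoin K {f i}, ∀ y ∈ Algebra.adjoin K {f l}, Commute x y := by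
    intro i l x hx y hy
    exact Algebra.commute_of_mem_adjoin_singleton_of_commute hy
      (Algebra.commute_of_mem_adjoin_singleton_of_commute hx (hf l i)).symm
  obtain ⟨b, d, hd⟩ := exists_basis_joint_eigenvectors s hss
    (fun i l => hadj i l _ (hs i) _ (hs l))
  let e : Module.End K (Fin n → K) ≃ₐ[K] Matrix (Fin n) (Fin n) K := Matrix.toLinAlgEquiv'.symm
  have he : ∀ i, A i = e (s i) + e (ν i) := fun i => by
    rw [← map_add, add_comm, ← hfs]
    exact (Matrix.toLinAlgEquiv'.symm_apply_apply (A i)).symm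
  let P : Matrix (Fin n) (Fin n) K := (Pi.basisFun K (Fin n)).toMatrix b
  let Q : Matrix (Fin n) (Fin n) K := b.toMatrix (Pi.basisFun K (Fin n))
  have hQP : Q * P = 1 := Module.Basis.toMatrix_mul_toMatrix_flip _ _
  have hPQ : P * Q = 1 := mul_eq_one_comm.1 hQP
  have hsP : ∀ i, e (s i) * P = P * Matrix.diagonal (d i) := by
    intro i
    ext a j
    have h1 : (e (s i)).mulVec (b j) = d i j • b j := by
      rw [← hd, ← Matrix.toLinAlgEquiv'_apply]
      exact congrArg (fun g : Module.End K (Fin n → K) => g (b j))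
        (Matrix.toLinAlgEquiv'.apply_symm_apply (s i))
    have h2 := congrFun h1 a
    rw [Matrix.mul_diagonal]
    simp only [Matrix.mulVec, dotProduct, Pi.smul_apply, smul_eq_mul] at h2
    simp only [P, Matrix.mul_apply, Module.Basis.toMatrix_apply, Pi.basisFun_repr]
    rw [h2, mul_comm]
  have hdQ : ∀ i, Matrix.diagonal (d i) = Q * e (s i) * P := fun i => by
    rw [mul_assoc, hsP, ← mul_assoc, hQP, one_mul]
  have hconj : ∀ X Y : Matrix (Fin n) (Fin n) K, Q * X * P * (Q * Y * P) = Q * (X * Y) * P :=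
    fun X Y => by
      calc Q * X * P * (Q * Y * P) = Q * X * (P * Q) * Y * P := by simp only [mul_assoc]
        _ = Q * (X * Y) * P := by rw [hPQ, mul_one]; simp only [mul_assoc]
  have hcj : ∀ X Y : Matrix (Fin n) (Fin n) K, Commute X Y → Commute (Q * X * P) (Q * Y * P) :=
    fun X Y h => by rw [commute_iff_eq, hconj, hconj, h.eq]
  have hnc : ∀ X : Matrix (Fin n) (Fin n) K, IsNilpotent X → IsNilpotent (Q * X * P) := by
    rintro X ⟨k, hk⟩
    have hp : ∀ m, (Q * X * P) ^ m = Q * X ^ m * P := by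
      intro m
      induction m with
      | zero => rw [pow_zero, pow_zero, mul_one, hQP]
      | succ m ih => rw [pow_succ, ih, hconj, pow_succ]
    exact ⟨k, by rw [hp, hk, mul_zero, zero_mul]⟩
  refine ⟨P, Q, d, fun i => Q * e (ν i) * P, hQP, fun i => ?_, fun i => ?_, fun i l => ?_,
    fun i l => ?_⟩
  · rw [he, add_mul, hsP, ← mul_assoc, ← mul_assoc, hPQ, one_mul]
  · exact hnc _ ((hνnil i).map e)
  · rw [hdQ]
    exact hcj _ _ ((hadj i l _ (hs i) _ (hν l)).map e)
  · exact hcj _ _ ((hadj i l _ (hν i) _ (hν l)).map e)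

/-- The normal form of commuting matrices `A i` together with an invertible matrix `C` that commutes
with them: the Jordan decomposition of `C` is multiplicative. -/
theorem exists_normal_form {ι : Type*} (A : ι → Matrix (Fin n) (Fin n) K)
    (C : Matrix (Fin n) (Fin n) K) (hcomm : ∀ i l, Commute (A i) (A l))
    (hC : ∀ i, Commute (A i) C) (hCu : IsUnit C) :
    ∃ (P Q : Matrix (Fin n) (Fin n) K) (d : ι → Fin n → K) (c : Fin n → K)
      (N : ι → Matrix (Fin n) (Fin n) K) (L : Matrix (Fin n) (Fin n) K),
      Q * P = 1 ∧ (∀ i, A i * P = P * Matrix.diagonal (d i) + P * N i) ∧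
      C * P = P * (Matrix.diagonal c * IsNilpotent.exp L) ∧
      (∀ i, IsNilpotent (N i)) ∧ IsNilpotent L ∧ (∀ i l, Commute (Matrix.diagonal (d i)) (N l)) ∧
      (∀ i l, Commute (N i) (N l)) ∧ (∀ i, Commute (Matrix.diagonal (d i)) L) ∧
      (∀ i, Commute (N i) L) ∧ (∀ i, Commute (Matrix.diagonal c) (N i)) ∧
      Commute (Matrix.diagonal c) L := by
  obtain ⟨P, Q, d, N, hQP, hA, hN, hdN, hNN⟩ := exists_simultaneous_jordan
    (fun o : Option ι => o.elim C A) (by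
      rintro (_ | i) (_ | l)
      exacts [Commute.refl _, (hC l).symm, hC i, hcomm i l])
  have hPQ : P * Q = 1 := mul_eq_one_comm.1 hQP
  have hCP : C * P = P * (Matrix.diagonal (d none) + N none) := by rw [mul_add]; exact hA none
  -- the diagonal part of `C` is invertible, as it differs from `Q C P` by a commuting nilpotent
  have hu : IsUnit (Matrix.diagonal (d none)) := by
    have h1 : IsUnit (Matrix.diagonal (d none) + N none) := by
      have h2 : Matrix.diagonal (d none) + N none = Q * C * P := by
        rw [mul_assoc, hCP, ← mul_assoc, hQP, one_mul]
      rw [h2]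
      exact ((IsUnit.of_mul_eq_one P hQP).mul hCu).mul (IsUnit.of_mul_eq_one Q hPQ)
    have h4 : Commute (-N none) (Matrix.diagonal (d none) + N none) :=
      ((hdN none none).symm.add_right (Commute.refl _)).neg_left
    have h5 := (hN none).neg.isUnit_add_left_of_commute h1 h4
    simpa using h5
  obtain ⟨u, hu'⟩ := hu
  let M := (↑u⁻¹ : Matrix (Fin n) (Fin n) K) * N none
  have huM : ∀ X, Commute X (Matrix.diagonal (d none)) → Commute X (N none) → Commute X M :=
    fun X h1 h2 => by
      rw [← hu'] at h1
      exact h1.units_inv_right.mul_right h2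
  have hM : IsNilpotent M := by
    have h1 : Commute (u : Matrix (Fin n) (Fin n) K) (N none) := hu' ▸ hdN none none
    exact h1.units_inv_left.isNilpotent_mul_left (hN none)
  obtain ⟨L, hL, hexp, hcL⟩ := exists_exp_eq_one_add hM
  refine ⟨P, Q, fun i => d (some i), d none, fun i => N (some i), L, hQP, fun i => hA (some i), ?_,
    fun i => hN _, hL, fun i l => hdN _ _, fun i l => hNN _ _, fun i => ?_, fun i => ?_,
    fun i => hdN _ _, ?_⟩
  · rw [hCP, hexp, mul_add (Matrix.diagonal _), mul_one, ← hu', Units.mul_inv_cancel_left]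
  · exact hcL _ (huM _ (Matrix.commute_diagonal _ _) (hdN _ _))
  · exact hcL _ (huM _ (hdN _ _).symm (hNN _ _))
  · exact hcL _ (huM _ (Commute.refl _) (hdN _ _))

end Jordan

/-! ### Verifying exponentials of nilpotent matrices -/

theorem prodSum_nil (n : ℕ) : prodSum n [] = 0 := rfl

theorem prodSum_cons (n : ℕ) (p : MatCode × MatCode) (L : List (MatCode × MatCode)) :
    prodSum n (p :: L) = matValue n p.1 * matValue n p.2 + prodSum n L := rfl

theorem prodSum_singleton (n : ℕ) (X Y : MatCode) :
    prodSum n [(X, Y)] = matValue n X * matValue n Y := by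
  rw [prodSum_cons, prodSum_nil, add_zero]

theorem prodSum_pair (n : ℕ) (X Y Z W : MatCode) :
    prodSum n [(X, Y), (Z, W)] = matValue n X * matValue n Y + matValue n Z * matValue n W := by
  rw [prodSum_cons, prodSum_singleton]

theorem prodSum_map_range (n m : ℕ) (F : ℕ → MatCode) :
    prodSum n ((List.range m).map fun s => (F s, oneCode n)) =
      ∑ s ∈ Finset.range m, matValue n (F s) := by
  induction m with
  | zero => rfl
  | succ m ih =>
    rw [Finset.sum_range_succ, ← ih]
    simp [prodSum, List.range_succ, matValue_oneCode]

section Primrec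

variable {α : Type*} [Primcodable α]

theorem SemiDec.matDotEq {n : α → ℕ} {L₁ L₂ : α → List (MatCode × MatCode)} (hn : Primrec n)
    (h₁ : Primrec L₁) (h₂ : Primrec L₂) : SemiDec fun x => MatDotEq (n x) (L₁ x) (L₂ x) :=
  semiDec_matDotEq.comp (hn.pair (h₁.pair h₂))

theorem SemiDec.matCertified {n : α → ℕ} {X : α → MatCode} (hn : Primrec n) (hX : Primrec X) :
    SemiDec fun x => MatCertified (n x) (X x) :=
  semiDec_matCertified.comp (hn.pair hX)

theorem Primrec.matPair {X Y : α → MatCode} (hX : Primrec X) (hY : Primrec Y) :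
    Primrec fun x => [(X x, Y x)] :=
  Primrec.list_cons.comp (hX.pair hY) (Primrec.const [])

theorem Primrec.matPair₂ {X Y Z W : α → MatCode} (hX : Primrec X) (hY : Primrec Y)
    (hZ : Primrec Z) (hW : Primrec W) : Primrec fun x => [(X x, Y x), (Z x, W x)] :=
  Primrec.list_cons.comp (hX.pair hY) (Primrec.matPair hZ hW)

end Primrec

/-- The list `T` consists of the terms `X ^ s / s!` of the exponential series of a matrix with
`X ^ N = 0`, and `E` is their sum. -/
def ExpSeries (n : ℕ) (X E : MatCode) (N : ℕ) (T : List MatCode) : Prop :=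
  (∀ s ∈ List.range (N + 1), MatCertified n (T.getD s [])) ∧
  MatDotEq n [(T.getD 0 [], oneCode n)] [(oneCode n, oneCode n)] ∧
  (∀ s ∈ List.range N, MatDotEq n
    ((List.range (s + 1)).map fun _ => (T.getD (s + 1) [], oneCode n)) [(T.getD s [], X)]) ∧
  MatDotEq n [(T.getD N [], oneCode n)] [] ∧
  MatDotEq n [(E, oneCode n)] ((List.range (N + 1)).map fun s => (T.getD s [], oneCode n))

/-- The verifiable form of "`X` is nilpotent with exponential `E`". -/
def ExpCheck (n : ℕ) (X E : MatCode) : Prop := ∃ T : ℕ × List MatCode, ExpSeries n X E T.1 T.2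

theorem semiDec_expSeries : SemiDec fun x : (ℕ × MatCode × MatCode) × ℕ × List MatCode =>
    ExpSeries x.1.1 x.1.2.1 x.1.2.2 x.2.1 x.2.2 := by
  have pn : Primrec fun x : (ℕ × MatCode × MatCode) × ℕ × List MatCode => x.1.1 :=
    Primrec.fst.comp Primrec.fst
  have pX : Primrec fun x : (ℕ × MatCode × MatCode) × ℕ × List MatCode => x.1.2.1 :=
    Primrec.fst.comp (Primrec.snd.comp Primrec.fst)
  have pE : Primrec fun x : (ℕ × MatCode × MatCode) × ℕ × List MatCode => x.1.2.2 :=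
    Primrec.snd.comp (Primrec.snd.comp Primrec.fst)
  have pN : Primrec fun x : (ℕ × MatCode × MatCode) × ℕ × List MatCode => x.2.1 :=
    Primrec.fst.comp Primrec.snd
  have pT : Primrec fun x : (ℕ × MatCode × MatCode) × ℕ × List MatCode => x.2.2 :=
    Primrec.snd.comp Primrec.snd
  have pI := primrec_oneCode.comp pn
  have hget : Primrec₂ fun (T : List MatCode) (s : ℕ) => T.getD s [] := Primrec.list_getD []
  have pTs : Primrec fun y : ((ℕ × MatCode × MatCode) × ℕ × List MatCode) × ℕ =>
      y.1.2.2.getD y.2 [] := hget.comp (pT.comp Primrec.fst) Primrec.snd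
  have pTs' : Primrec fun y : ((ℕ × MatCode × MatCode) × ℕ × List MatCode) × ℕ =>
      y.1.2.2.getD (y.2 + 1) [] :=
    hget.comp (pT.comp Primrec.fst) (Primrec.succ.comp Primrec.snd)
  have h1 := (SemiDec.matCertified (pn.comp Primrec.fst) pTs).forall_mem
    (Primrec.list_range.comp (Primrec.succ.comp pN))
  have h2 := SemiDec.matDotEq pn (Primrec.matPair (hget.comp pT (Primrec.const 0)) pI)
    (Primrec.matPair pI pI)
  have p3 : Primrec fun y : ((ℕ × MatCode × MatCode) × ℕ × List MatCode) × ℕ =>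
      (List.range (y.2 + 1)).map fun _ => (y.1.2.2.getD (y.2 + 1) [], oneCode y.1.1.1) :=
    Primrec.list_map (Primrec.list_range.comp (Primrec.succ.comp Primrec.snd))
      ((pTs'.pair (pI.comp Primrec.fst)).comp Primrec.fst)
  have h3 := (SemiDec.matDotEq (pn.comp Primrec.fst) p3
    (Primrec.matPair pTs (pX.comp Primrec.fst))).forall_mem (Primrec.list_range.comp pN)
  have h4 := SemiDec.matDotEq pn (Primrec.matPair (hget.comp pT pN) pI) (Primrec.const [])
  have p5 : Primrec fun x : (ℕ × MatCode × MatCode) × ℕ × List MatCode =>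
      (List.range (x.2.1 + 1)).map fun s => (x.2.2.getD s [], oneCode x.1.1) :=
    Primrec.list_map (Primrec.list_range.comp (Primrec.succ.comp pN))
      (pTs.pair (pI.comp Primrec.fst))
  have h5 := SemiDec.matDotEq pn (Primrec.matPair pE pI) p5
  exact h1.and (h2.and (h3.and (h4.and h5)))

theorem semiDec_expCheck :
    SemiDec fun x : ℕ × MatCode × MatCode => ExpCheck x.1 x.2.1 x.2.2 :=
  semiDec_expSeries.exists_

theorem expCheck_iff {n : ℕ} {X E : MatCode} (hX : MatValid n X) (hE : MatValid n E) :
    ExpCheck n X E ↔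
      IsNilpotent (matValue n X) ∧ matValue n E = IsNilpotent.exp (matValue n X) := by
  have hI := matValid_oneCode n
  have hv : ∀ {A B : MatCode}, MatValid n A → MatValid n B →
      ∀ p ∈ [(A, B)], MatValid n p.1 ∧ MatValid n p.2 := fun hA hB p hp => by
    rw [List.mem_singleton.1 hp]; exact ⟨hA, hB⟩
  have hr : ∀ {F : ℕ → MatCode} {m : ℕ}, (∀ s < m, MatValid n (F s)) →
      ∀ p ∈ (List.range m).map fun s => (F s, oneCode n), MatValid n p.1 ∧ MatValid n p.2 := by
    intro F m hF p hp
    obtain ⟨s, hs, rfl⟩ := List.mem_map.1 hp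
    exact ⟨hF s (List.mem_range.1 hs), hI⟩
  have hnil : ∀ p ∈ ([] : List (MatCode × MatCode)), MatValid n p.1 ∧ MatValid n p.2 :=
    fun p hp => absurd hp List.not_mem_nil
  constructor
  · rintro ⟨⟨N, T⟩, hT, h0, hs, hN, hsum⟩
    dsimp only at hT h0 hs hN hsum
    have hT' : ∀ s < N + 1, MatValid n (T.getD s []) := fun s h => (hT s (List.mem_range.2 h)).valid
    rw [matDotEq_iff (hv (hT' 0 N.succ_pos) hI) (hv hI hI), prodSum_singleton, prodSum_singleton,
      matValue_oneCode, mul_one, mul_one] at h0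
    rw [matDotEq_iff (hv (hT' N N.lt_succ_self) hI) hnil, prodSum_singleton, prodSum_nil,
      matValue_oneCode, mul_one] at hN
    rw [matDotEq_iff (hv hE hI) (hr hT'), prodSum_singleton, prodSum_map_range, matValue_oneCode,
      mul_one] at hsum
    have hstep : ∀ s < N, (s + 1) • matValue n (T.getD (s + 1) []) =
        matValue n (T.getD s []) * matValue n X := by
      intro s h
      have h1 := hs s (List.mem_range.2 h)
      rwa [matDotEq_iff (hr fun _ _ => hT' _ (by omega)) (hv (hT' s (by omega)) hX),
        prodSum_singleton, prodSum_map_range, Finset.sum_const, Finset.card_range] at h1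
    have hpow : ∀ s < N + 1, s.factorial • matValue n (T.getD s []) = matValue n X ^ s := by
      intro s
      induction s with
      | zero => intro _; rw [h0, Nat.factorial_zero, one_smul, pow_zero]
      | succ s ih =>
        intro h
        rw [Nat.factorial_succ, mul_comm, mul_smul, hstep s (by omega), ← smul_mul_assoc,
          ih (by omega), pow_succ]
    have hX0 : matValue n X ^ N = 0 := by rw [← hpow N N.lt_succ_self, hN, smul_zero]
    refine ⟨⟨N, hX0⟩, ?_⟩
    rw [hsum, IsNilpotent.exp_eq_sum (k := N + 1) (by rw [pow_succ, hX0, zero_mul])]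
    refine Finset.sum_congr rfl fun s h => ?_
    rw [← hpow s (Finset.mem_range.1 h), ← Nat.cast_smul_eq_nsmul ℚ, smul_smul,
      inv_mul_cancel₀ (by exact_mod_cast s.factorial_ne_zero), one_smul]
  · rintro ⟨⟨N, hN⟩, hexp⟩
    have halg : ∀ s : ℕ, ∀ i j, IsAlgebraic ℚ ((((s.factorial : ℚ)⁻¹ • matValue n X ^ s :
        Matrix (Fin n) (Fin n) ℂ)) i j) := by
      have hp : ∀ s : ℕ, ∀ i j, IsAlgebraic ℚ ((matValue n X ^ s) i j) := by
        intro s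
        induction s with
        | zero =>
          intro i j
          rw [pow_zero, Matrix.one_apply]
          split_ifs
          · exact isAlgebraic_one
          · exact isAlgebraic_zero
        | succ s ih =>
          intro i j
          rw [pow_succ, Matrix.mul_apply]
          exact isAlgebraic_iff_isIntegral.2 (IsIntegral.sum _ fun l _ =>
            isAlgebraic_iff_isIntegral.1 ((ih i l).mul (hX.isAlgebraic l j)))
      intro s i j
      exact (hp s i j).smul _
    let F : ℕ → MatCode := fun s => matCode ((s.factorial : ℚ)⁻¹ • matValue n X ^ s)
    have hF : ∀ s, MatCertified n (F s) := fun s => matCertified_matCode (halg s)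
    have hFv : ∀ s, matValue n (F s) = (s.factorial : ℚ)⁻¹ • matValue n X ^ s :=
      fun s => matValue_matCode (halg s)
    have hget : ∀ s < N + 1, ((List.range (N + 1)).map F).getD s [] = F s := by
      intro s hs
      simp [List.getD, hs]
    refine ⟨(N, (List.range (N + 1)).map F), fun s hs => ?_, ?_, fun s hs => ?_, ?_, ?_⟩
    · rw [hget s (List.mem_range.1 hs)]
      exact hF s
    · dsimp only
      rw [hget 0 N.succ_pos, matDotEq_iff (hv (hF 0).valid hI) (hv hI hI), prodSum_singleton,
        prodSum_singleton, hFv]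
      simp [matValue_oneCode]
    · have hs := List.mem_range.1 hs
      dsimp only at hs ⊢
      rw [hget s (by omega), hget (s + 1) (by omega),
        matDotEq_iff (hr fun _ _ => (hF _).valid) (hv (hF s).valid hX), prodSum_singleton,
        prodSum_map_range, Finset.sum_const, Finset.card_range, hFv, hFv, smul_mul_assoc,
        ← pow_succ, ← Nat.cast_smul_eq_nsmul ℚ, smul_smul]
      congr 1
      rw [Nat.factorial_succ]
      push_cast
      have : (s.factorial : ℚ) ≠ 0 := by exact_mod_cast s.factorial_ne_zero
      have : (s : ℚ) + 1 ≠ 0 := by positivity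
      field_simp
    · dsimp only
      rw [hget N N.lt_succ_self, matDotEq_iff (hv (hF N).valid hI) hnil, prodSum_singleton, hFv,
        hN, smul_zero, zero_mul, prodSum_nil]
    · have hc : ((List.range (N + 1)).map fun s =>
          (((List.range (N + 1)).map F).getD s [], oneCode n)) =
          (List.range (N + 1)).map fun s => (F s, oneCode n) :=
        List.map_congr_left fun s hs => by rw [hget s (List.mem_range.1 hs)]
      dsimp only
      rw [hc, matDotEq_iff (hv hE hI) (hr fun s _ => (hF s).valid), prodSum_singleton,
        prodSum_map_range, matValue_oneCode, mul_one, hexp,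
        IsNilpotent.exp_eq_sum (k := N + 1) (by rw [pow_succ, hN, zero_mul])]
      exact Finset.sum_congr rfl fun s _ => (hFv s).symm

/-- The verifiable form of "`Z` is nonzero": some entry has an inverse. -/
def NonzeroCheck (n : ℕ) (Z : MatCode) : Prop :=
  ∃ y : (ℕ × ℕ) × AlgCode, y.1.1 < n ∧ y.1.2 < n ∧ Certified y.2 ∧
    DotEq [(entry Z y.1.1 y.1.2, y.2)] [(codeOf 1, codeOf 1)]

theorem semiDec_nonzeroCheck : SemiDec fun x : ℕ × MatCode => NonzeroCheck x.1 x.2 := by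
  have pn : Primrec fun x : (ℕ × MatCode) × (ℕ × ℕ) × AlgCode => x.1.1 :=
    Primrec.fst.comp Primrec.fst
  have pi : Primrec fun x : (ℕ × MatCode) × (ℕ × ℕ) × AlgCode => x.2.1.1 :=
    Primrec.fst.comp (Primrec.fst.comp Primrec.snd)
  have pj : Primrec fun x : (ℕ × MatCode) × (ℕ × ℕ) × AlgCode => x.2.1.2 :=
    Primrec.snd.comp (Primrec.fst.comp Primrec.snd)
  have py : Primrec fun x : (ℕ × MatCode) × (ℕ × ℕ) × AlgCode => x.2.2 :=
    Primrec.snd.comp Primrec.snd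
  have pz : Primrec fun x : (ℕ × MatCode) × (ℕ × ℕ) × AlgCode => entry x.1.2 x.2.1.1 x.2.1.2 :=
    primrec_entry.comp ((Primrec.snd.comp Primrec.fst).pair (pi.pair pj))
  have h3 := semiDec_certified.comp py
  have p4 : Primrec fun x : (ℕ × MatCode) × (ℕ × ℕ) × AlgCode =>
      [(entry x.1.2 x.2.1.1 x.2.1.2, x.2.2)] :=
    Primrec.list_cons.comp (pz.pair py) (Primrec.const [])
  have h4 := semiDec_dotEq.comp (p4.pair (Primrec.const [(codeOf 1, codeOf 1)]))
  have h1 := SemiDec.of_primrec (Primrec.nat_lt.comp pi pn)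
  have h2 := SemiDec.of_primrec (Primrec.nat_lt.comp pj pn)
  exact (h1.and (h2.and (h3.and h4))).exists_

theorem nonzeroCheck_iff {n : ℕ} {Z : MatCode} (hZ : MatValid n Z) :
    NonzeroCheck n Z ↔ matValue n Z ≠ 0 := by
  have h1 : (codeOf 1).Valid := (certified_codeOf isAlgebraic_one).valid
  have hv : ∀ {a b : AlgCode}, a.Valid → b.Valid → ∀ q ∈ [(a, b)], q.1.Valid ∧ q.2.Valid :=
    fun ha hb q hq => by rw [List.mem_singleton.1 hq]; exact ⟨ha, hb⟩
  have hdot : ∀ a b : AlgCode, dotValue [(a, b)] = a.value * b.value := fun a b => by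
    simp [dotValue]
  constructor
  · rintro ⟨⟨⟨i, j⟩, y⟩, hi, hj, hy, hd⟩ h0
    have h2 := hd.dotValue_eq (hv (hZ i hi j hj) hy.valid) (hv h1 h1)
    have h3 : (entry Z i j).value = 0 := congrFun (congrFun h0 ⟨i, hi⟩) ⟨j, hj⟩
    rw [hdot, hdot, h3, zero_mul, value_codeOf isAlgebraic_one, one_mul] at h2
    exact zero_ne_one h2
  · intro h
    obtain ⟨i, j, hij⟩ : ∃ i j, matValue n Z i j ≠ 0 := by
      by_contra! h'
      exact h (Matrix.ext h')
    have ha := (hZ.isAlgebraic i j).inv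
    refine ⟨((i, j), codeOf (matValue n Z i j)⁻¹), i.2, j.2, certified_codeOf ha, ?_⟩
    refine dotEq_of_dotValue_eq (hv (hZ i i.2 j j.2) (certified_codeOf ha).valid) (hv h1 h1) ?_
    rw [hdot, hdot, value_codeOf ha, value_codeOf isAlgebraic_one, one_mul]
    exact mul_inv_cancel₀ hij

/-! ### Reading and writing instances -/

theorem List.forall₂_ofFn_iff {α β : Type*} {R : α → β → Prop} {w : List α} {n : ℕ} {v : Fin n → β}
    (d : α) : List.Forall₂ R w (List.ofFn v) ↔ w.length = n ∧ ∀ i : Fin n, R (w.getD i d) (v i) := by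
  rw [List.forall₂_iff_get]
  constructor
  · rintro ⟨hw, h⟩
    rw [List.length_ofFn] at hw
    refine ⟨hw, fun i => ?_⟩
    have h₁ : (i : ℕ) < w.length := hw ▸ i.2
    simpa [List.getD, h₁] using h i h₁ (by simp)
  · rintro ⟨hw, h⟩
    refine ⟨by rw [List.length_ofFn, hw], fun i h₁ h₂ => ?_⟩
    simpa [List.getD, h₁] using h ⟨i, hw ▸ h₁⟩

theorem representsVec_iff {n : ℕ} {w : List AlgCode} {v : Fin n → ℂ} :
    RepresentsVec w v ↔ w.length = n ∧ ∀ i : Fin n, (coord w i).Represents (v i) :=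
  List.forall₂_ofFn_iff (codeOf 0)

theorem representsMat_iff {m n : ℕ} {w : MatCode} {A : Matrix (Fin m) (Fin n) ℂ} :
    RepresentsMat w A ↔ w.length = m ∧ ∀ i : Fin m, RepresentsVec (w.getD i []) (A i) :=
  List.forall₂_ofFn_iff []

theorem RepresentsMat.matValid {n : ℕ} {w : MatCode} {A : Matrix (Fin n) (Fin n) ℂ}
    (h : RepresentsMat w A) : MatValid n w := fun i hi j hj =>
  ((representsVec_iff.1 ((representsMat_iff.1 h).2 ⟨i, hi⟩)).2 ⟨j, hj⟩).valid

theorem RepresentsMat.matValue_eq {n : ℕ} {w : MatCode} {A : Matrix (Fin n) (Fin n) ℂ}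
    (h : RepresentsMat w A) : matValue n w = A := by
  ext i j
  exact ((representsVec_iff.1 ((representsMat_iff.1 h).2 i)).2 j).value_eq

/-- Codes of equations `exp (∑ i, λ i * t i) = c * exp d`: the coefficients `λ`, and `c` and `d`. -/
abbrev EquationCode := List AlgCode × AlgCode × AlgCode

local instance EquationCode.primcodable : Primcodable EquationCode := Primcodable.prod

/-- The code of the instance of the Linear-Exponential Problem with the given equations. -/
def lepOfEquations (k : ℕ) (rows : List EquationCode) (Pc : PolyhedronCode) : LEPCode :=
  (k, rows.map fun r => r.1, rows.map fun r => r.2.1, rows.map fun r => r.2.2, Pc)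

theorem primrec_lepOfEquations : Primrec fun x : ℕ × List EquationCode × PolyhedronCode =>
    lepOfEquations x.1 x.2.1 x.2.2 := by
  have pr : Primrec fun x : ℕ × List EquationCode × PolyhedronCode => x.2.1 :=
    Primrec.fst.comp Primrec.snd
  have p1 : Primrec fun x : ℕ × List EquationCode × PolyhedronCode => x.2.1.map fun r => r.1 :=
    Primrec.list_map pr (Primrec.fst.comp Primrec.snd)
  have p2 : Primrec fun x : ℕ × List EquationCode × PolyhedronCode => x.2.1.map fun r => r.2.1 :=
    Primrec.list_map pr (Primrec.fst.comp (Primrec.snd.comp Primrec.snd))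
  have p3 : Primrec fun x : ℕ × List EquationCode × PolyhedronCode => x.2.1.map fun r => r.2.2 :=
    Primrec.list_map pr (Primrec.snd.comp (Primrec.snd.comp Primrec.snd))
  exact Primrec.fst.pair (p1.pair (p2.pair (p3.pair (Primrec.snd.comp Primrec.snd))))

/-- The numbers `t` satisfy the coded equation. -/
def EquationCode.Holds {k : ℕ} (r : EquationCode) (t : Fin k → ℂ) : Prop :=
  Complex.exp (∑ i : Fin k, (coord r.1 i).value * t i) = r.2.1.value * Complex.exp r.2.2.value

/-- All the codes in the equation represent numbers. -/
def EquationCode.Valid (k : ℕ) (r : EquationCode) : Prop :=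
  r.1.length = k ∧ (∀ i < k, (coord r.1 i).Valid) ∧ r.2.1.Valid ∧ r.2.2.Valid

theorem exists_represents_lepOfEquations {k : ℕ} {P : AlgPolyhedron (k + k)} {Pc : PolyhedronCode}
    (hP : PolyhedronCode.Represents Pc P) {rows : List EquationCode} (h : ∀ r ∈ rows, r.Valid k) :
    ∃ L : LEP, LEPCode.Represents (lepOfEquations k rows Pc) L ∧ (L.Solvable ↔
      ∃ t : Fin k → ℂ, (∀ r ∈ rows, r.Holds t) ∧ reIm t ∈ P.carrier) := by
  have hg : ∀ j : Fin rows.length, (rows.get j).Valid k := fun j => h _ (List.get_mem _ _)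
  refine ⟨⟨k, rows.length, Matrix.of fun j i => (coord (rows.get j).1 i).value,
    fun j => (rows.get j).2.1.value, fun j => (rows.get j).2.2.value, P,
    fun j i => ((hg j).2.1 i i.2).represents.1, fun j => (hg j).2.2.1.represents.1,
    fun j => (hg j).2.2.2.represents.1⟩, ⟨rfl, ?_, ?_, ?_, hP⟩, ?_⟩
  · refine representsMat_iff.2 ⟨by simp [lepOfEquations], fun j => representsVec_iff.2 ?_⟩
    have hj : (lepOfEquations k rows Pc).2.1.getD j [] = (rows.get j).1 := by
      simp [lepOfEquations, List.getD]
    rw [hj]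
    exact ⟨(hg j).1, fun i => ((hg j).2.1 i i.2).represents⟩
  · refine representsVec_iff.2 ⟨by simp [lepOfEquations], fun j => ?_⟩
    have hj : coord (lepOfEquations k rows Pc).2.2.1 j = (rows.get j).2.1 := by
      simp [lepOfEquations, coord, List.getD]
    rw [hj]
    exact (hg j).2.2.1.represents
  · refine representsVec_iff.2 ⟨by simp [lepOfEquations], fun j => ?_⟩
    have hj : coord (lepOfEquations k rows Pc).2.2.2.1 j = (rows.get j).2.2 := by
      simp [lepOfEquations, coord, List.getD]
    rw [hj]
    exact (hg j).2.2.2.represents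
  · refine exists_congr fun t => and_congr_left fun _ => ⟨fun h' r hr => ?_, fun h' j => ?_⟩
    · obtain ⟨j, hj, rfl⟩ := List.getElem_of_mem hr
      exact h' ⟨j, hj⟩
    · exact h' _ (List.get_mem rows j)

/-! ### Certificates for instances with invertible, commuting target matrix -/

/-- Codes of Jordan decompositions: a matrix `X`, and `D`, `N`, `i N` such that the diagonal matrix
with entries `D` and the nilpotent matrix `N` are the parts of `X` in a certain basis. -/
abbrev JordanCode := MatCode × List AlgCode × MatCode × MatCode

local instance JordanCode.primcodable : Primcodable JordanCode := Primcodable.prod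

/-- `D` and `N` are coded by certified codes, `N` is nilpotent, and `i N` is what it should be. -/
def JordanCheck (n : ℕ) (τ : JordanCode) : Prop :=
  VecCertified n τ.2.1 ∧ MatCertified n τ.2.2.1 ∧ MatCertified n τ.2.2.2 ∧
  MatDotEq n [(τ.2.2.2, oneCode n)] [(scalarCode n (codeOf Complex.I), τ.2.2.1)] ∧
  ∃ E, MatCertified n E ∧ ExpCheck n τ.2.2.1 E

theorem semiDec_jordanCheck : SemiDec fun x : ℕ × JordanCode => JordanCheck x.1 x.2 := by
  have pn : Primrec fun x : ℕ × JordanCode => x.1 := Primrec.fst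
  have pD : Primrec fun x : ℕ × JordanCode => x.2.2.1 :=
    Primrec.fst.comp (Primrec.snd.comp Primrec.snd)
  have pN : Primrec fun x : ℕ × JordanCode => x.2.2.2.1 :=
    Primrec.fst.comp (Primrec.snd.comp (Primrec.snd.comp Primrec.snd))
  have pi : Primrec fun x : ℕ × JordanCode => x.2.2.2.2 :=
    Primrec.snd.comp (Primrec.snd.comp (Primrec.snd.comp Primrec.snd))
  have h1 := semiDec_vecCertified.comp (pn.pair pD)
  have h4 := SemiDec.matDotEq pn (Primrec.matPair pi (primrec_oneCode.comp pn))
    (Primrec.matPair (primrec_scalarCode.comp pn (Primrec.const (codeOf Complex.I))) pN)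
  have pE : Primrec fun y : (ℕ × JordanCode) × MatCode => y.2 := Primrec.snd
  have h5 := ((SemiDec.matCertified (pn.comp Primrec.fst) pE).and
    (semiDec_expCheck.comp ((pn.comp Primrec.fst).pair ((pN.comp Primrec.fst).pair pE)))).exists_
  exact h1.and ((SemiDec.matCertified pn pN).and ((SemiDec.matCertified pn pi).and (h4.and h5)))

/-- `X P = P (D + N)`. -/
def AddCheck (n : ℕ) (P : MatCode) (τ : JordanCode) : Prop :=
  MatDotEq n [(τ.1, P)] [(P, diagCode n τ.2.1), (P, τ.2.2.1)]

theorem semiDec_addCheck :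
    SemiDec fun x : ℕ × MatCode × JordanCode => AddCheck x.1 x.2.1 x.2.2 := by
  have pn : Primrec fun x : ℕ × MatCode × JordanCode => x.1 := Primrec.fst
  have pP : Primrec fun x : ℕ × MatCode × JordanCode => x.2.1 := Primrec.fst.comp Primrec.snd
  have pX : Primrec fun x : ℕ × MatCode × JordanCode => x.2.2.1 :=
    Primrec.fst.comp (Primrec.snd.comp Primrec.snd)
  have pD : Primrec fun x : ℕ × MatCode × JordanCode => x.2.2.2.1 :=
    Primrec.fst.comp (Primrec.snd.comp (Primrec.snd.comp Primrec.snd))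
  have pN : Primrec fun x : ℕ × MatCode × JordanCode => x.2.2.2.2.1 :=
    Primrec.fst.comp (Primrec.snd.comp (Primrec.snd.comp (Primrec.snd.comp Primrec.snd)))
  exact SemiDec.matDotEq pn (Primrec.matPair pX pP)
    (Primrec.matPair₂ pP (primrec_diagCode.comp pn pD) pP pN)

/-- `X P = P D exp N`. -/
def MulCheck (n : ℕ) (P : MatCode) (τ : JordanCode) : Prop :=
  ∃ y : MatCode × MatCode, MatCertified n y.1 ∧ MatCertified n y.2 ∧ ExpCheck n τ.2.2.1 y.1 ∧
    MatDotEq n [(τ.1, P)] [(P, y.2)] ∧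
    MatDotEq n [(y.2, oneCode n)] [(diagCode n τ.2.1, y.1)]

theorem semiDec_mulCheck :
    SemiDec fun x : ℕ × MatCode × JordanCode => MulCheck x.1 x.2.1 x.2.2 := by
  have pn : Primrec fun x : (ℕ × MatCode × JordanCode) × MatCode × MatCode => x.1.1 :=
    Primrec.fst.comp Primrec.fst
  have pP : Primrec fun x : (ℕ × MatCode × JordanCode) × MatCode × MatCode => x.1.2.1 :=
    Primrec.fst.comp (Primrec.snd.comp Primrec.fst)
  have pτ : Primrec fun x : (ℕ × MatCode × JordanCode) × MatCode × MatCode => x.1.2.2 :=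
    Primrec.snd.comp (Primrec.snd.comp Primrec.fst)
  have pX : Primrec fun x : (ℕ × MatCode × JordanCode) × MatCode × MatCode => x.1.2.2.1 :=
    Primrec.fst.comp pτ
  have pD : Primrec fun x : (ℕ × MatCode × JordanCode) × MatCode × MatCode => x.1.2.2.2.1 :=
    Primrec.fst.comp (Primrec.snd.comp pτ)
  have pN : Primrec fun x : (ℕ × MatCode × JordanCode) × MatCode × MatCode => x.1.2.2.2.2.1 :=
    Primrec.fst.comp (Primrec.snd.comp (Primrec.snd.comp pτ))
  have pE : Primrec fun x : (ℕ × MatCode × JordanCode) × MatCode × MatCode => x.2.1 :=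
    Primrec.fst.comp Primrec.snd
  have pF : Primrec fun x : (ℕ × MatCode × JordanCode) × MatCode × MatCode => x.2.2 :=
    Primrec.snd.comp Primrec.snd
  have h3 := semiDec_expCheck.comp (pn.pair (pN.pair pE))
  have h4 := SemiDec.matDotEq pn (Primrec.matPair pX pP) (Primrec.matPair pP pF)
  have h5 := SemiDec.matDotEq pn (Primrec.matPair pF (primrec_oneCode.comp pn))
    (Primrec.matPair (primrec_diagCode.comp pn pD) pE)
  exact ((SemiDec.matCertified pn pE).and ((SemiDec.matCertified pn pF).and
    (h3.and (h4.and h5)))).exists_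

/-- The matrices in the list commute. -/
def CommuteCheck (n : ℕ) (l : List MatCode) : Prop :=
  ∀ X ∈ l, ∀ Y ∈ l, MatDotEq n [(X, Y)] [(Y, X)]

theorem semiDec_commuteCheck : SemiDec fun x : ℕ × List MatCode => CommuteCheck x.1 x.2 := by
  have pn : Primrec fun y : ((ℕ × List MatCode) × MatCode) × MatCode => y.1.1.1 :=
    Primrec.fst.comp (Primrec.fst.comp Primrec.fst)
  have pX : Primrec fun y : ((ℕ × List MatCode) × MatCode) × MatCode => y.1.2 :=
    Primrec.snd.comp Primrec.fst
  have pY : Primrec fun y : ((ℕ × List MatCode) × MatCode) × MatCode => y.2 := Primrec.snd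
  have h := SemiDec.matDotEq pn (Primrec.matPair pX pY) (Primrec.matPair pY pX)
  exact (h.forall_mem (Primrec.snd.comp Primrec.fst)).forall_mem Primrec.snd

/-- The diagonal and nilpotent parts of all the decompositions. -/
noncomputable def jordanParts (n : ℕ) (l : List JordanCode) : List MatCode :=
  (l.map fun τ => diagCode n τ.2.1) ++ l.map fun τ => τ.2.2.1

theorem primrec_jordanParts : Primrec₂ jordanParts := by
  have pD : Primrec fun y : (ℕ × List JordanCode) × JordanCode => diagCode y.1.1 y.2.2.1 :=
    primrec_diagCode.comp (Primrec.fst.comp Primrec.fst)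
      (Primrec.fst.comp (Primrec.snd.comp Primrec.snd))
  have pN : Primrec fun y : (ℕ × List JordanCode) × JordanCode => y.2.2.2.1 :=
    Primrec.fst.comp (Primrec.snd.comp (Primrec.snd.comp Primrec.snd))
  have p1 : Primrec fun x : ℕ × List JordanCode => x.2.map fun τ => diagCode x.1 τ.2.1 :=
    Primrec.list_map Primrec.snd pD
  have p2 : Primrec fun x : ℕ × List JordanCode => x.2.map fun τ => τ.2.2.1 :=
    Primrec.list_map Primrec.snd pN
  exact Primrec.list_append.comp p1 p2

/-- Codes of normal forms: a matrix and its inverse, the decomposition of the target matrix, and the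
decompositions of the given matrices. -/
abbrev NormalFormCode := (MatCode × MatCode) × JordanCode × List JordanCode

local instance NormalFormCode.primcodable : Primcodable NormalFormCode := Primcodable.prod

/-- The verifiable form of "the columns of `P` bring the given matrices to the form diagonal plus
nilpotent, and the target matrix to the form diagonal times unipotent, with commuting parts". -/
def NormalFormCheck (n : ℕ) (z : NormalFormCode) : Prop :=
  (MatCertified n z.1.1 ∧ MatCertified n z.1.2 ∧
    MatDotEq n [(z.1.2, z.1.1)] [(oneCode n, oneCode n)]) ∧
  (∀ τ ∈ z.2.1 :: z.2.2, JordanCheck n τ) ∧ CommuteCheck n (jordanParts n (z.2.1 :: z.2.2)) ∧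
  (∀ τ ∈ z.2.2, AddCheck n z.1.1 τ) ∧ MulCheck n z.1.1 z.2.1

theorem semiDec_normalFormCheck :
    SemiDec fun x : ℕ × NormalFormCode => NormalFormCheck x.1 x.2 := by
  have pn : Primrec fun x : ℕ × NormalFormCode => x.1 := Primrec.fst
  have pP : Primrec fun x : ℕ × NormalFormCode => x.2.1.1 :=
    Primrec.fst.comp (Primrec.fst.comp Primrec.snd)
  have pQ : Primrec fun x : ℕ × NormalFormCode => x.2.1.2 :=
    Primrec.snd.comp (Primrec.fst.comp Primrec.snd)
  have pσ : Primrec fun x : ℕ × NormalFormCode => x.2.2.1 :=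
    Primrec.fst.comp (Primrec.snd.comp Primrec.snd)
  have pT : Primrec fun x : ℕ × NormalFormCode => x.2.2.2 :=
    Primrec.snd.comp (Primrec.snd.comp Primrec.snd)
  have pl : Primrec fun x : ℕ × NormalFormCode => x.2.2.1 :: x.2.2.2 := Primrec.list_cons.comp pσ pT
  have pI := primrec_oneCode.comp pn
  have h1 := (SemiDec.matCertified pn pP).and ((SemiDec.matCertified pn pQ).and
    (SemiDec.matDotEq pn (Primrec.matPair pQ pP) (Primrec.matPair pI pI)))
  have pτ : Primrec fun y : (ℕ × NormalFormCode) × JordanCode => y.2 := Primrec.snd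
  have h2 := (semiDec_jordanCheck.comp ((pn.comp Primrec.fst).pair pτ)).forall_mem pl
  have h3 := semiDec_commuteCheck.comp (pn.pair (primrec_jordanParts.comp pn pl))
  have h4 := (semiDec_addCheck.comp ((pn.comp Primrec.fst).pair
    ((pP.comp Primrec.fst).pair pτ))).forall_mem pT
  have h5 := semiDec_mulCheck.comp (pn.pair (pP.pair pσ))
  exact h1.and (h2.and (h3.and (h4.and h5)))

/-! ### The equations of a normal form -/

/-- The entry `(a, b)` of the equation between the sums of the nilpotent parts. -/
noncomputable def entryEquation (σ : MatCode) (T : List MatCode) (a b : ℕ) : EquationCode :=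
  (T.map fun X => entry X a b, codeOf 1, entry σ a b)

/-- The equation between the products of the eigenvalues of the diagonal parts. -/
noncomputable def diagEquation (z : NormalFormCode) (j : ℕ) : EquationCode :=
  (z.2.2.map fun τ => coord τ.2.1 j, coord z.2.1.2.1 j, codeOf 0)

/-- The two equations that force an entry of the nilpotent parts. -/
noncomputable def nilEquations (z : NormalFormCode) (a b : ℕ) : List EquationCode :=
  [entryEquation z.2.1.2.2.1 (z.2.2.map fun τ => τ.2.2.1) a b,
    entryEquation z.2.1.2.2.2 (z.2.2.map fun τ => τ.2.2.2) a b]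

/-- All the equations that belong to a normal form of size `n`. -/
noncomputable def equations (n : ℕ) (z : NormalFormCode) : List EquationCode :=
  ((List.range n).map fun j => diagEquation z j) ++
    (List.range n).flatMap fun a => (List.range n).flatMap fun b => nilEquations z a b

theorem primrec_entryEquation : Primrec fun x : (MatCode × List MatCode) × ℕ × ℕ =>
    entryEquation x.1.1 x.1.2 x.2.1 x.2.2 := by
  have p1 : Primrec fun y : ((MatCode × List MatCode) × ℕ × ℕ) × MatCode =>
      entry y.2 y.1.2.1 y.1.2.2 :=
    primrec_entry.comp (Primrec.snd.pair (Primrec.snd.comp Primrec.fst))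
  have p2 : Primrec fun x : (MatCode × List MatCode) × ℕ × ℕ =>
      x.1.2.map fun X => entry X x.2.1 x.2.2 :=
    Primrec.list_map (Primrec.snd.comp Primrec.fst) p1
  have p3 : Primrec fun x : (MatCode × List MatCode) × ℕ × ℕ => entry x.1.1 x.2.1 x.2.2 :=
    primrec_entry.comp ((Primrec.fst.comp Primrec.fst).pair Primrec.snd)
  exact p2.pair ((Primrec.const _).pair p3)

theorem primrec_diagEquation : Primrec₂ diagEquation := by
  have p1 : Primrec fun y : (NormalFormCode × ℕ) × JordanCode => coord y.2.2.1 y.1.2 :=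
    primrec_coord.comp (Primrec.fst.comp (Primrec.snd.comp Primrec.snd))
      (Primrec.snd.comp Primrec.fst)
  have p2 : Primrec fun x : NormalFormCode × ℕ => x.1.2.2.map fun τ => coord τ.2.1 x.2 :=
    Primrec.list_map (Primrec.snd.comp (Primrec.snd.comp Primrec.fst)) p1
  have p3 : Primrec fun x : NormalFormCode × ℕ => coord x.1.2.1.2.1 x.2 :=
    primrec_coord.comp (Primrec.fst.comp (Primrec.snd.comp (Primrec.fst.comp
      (Primrec.snd.comp Primrec.fst)))) Primrec.snd
  exact p2.pair (p3.pair (Primrec.const _))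

theorem primrec_nilEquations :
    Primrec fun x : NormalFormCode × ℕ × ℕ => nilEquations x.1 x.2.1 x.2.2 := by
  have pN : Primrec fun τ : JordanCode => τ.2.2.1 :=
    Primrec.fst.comp (Primrec.snd.comp Primrec.snd)
  have pM : Primrec fun τ : JordanCode => τ.2.2.2 :=
    Primrec.snd.comp (Primrec.snd.comp Primrec.snd)
  have pσ : Primrec fun x : NormalFormCode × ℕ × ℕ => x.1.2.1 :=
    Primrec.fst.comp (Primrec.snd.comp Primrec.fst)
  have pT : Primrec fun x : NormalFormCode × ℕ × ℕ => x.1.2.2 :=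
    Primrec.snd.comp (Primrec.snd.comp Primrec.fst)
  have p1 : Primrec fun x : NormalFormCode × ℕ × ℕ => x.1.2.2.map fun τ => τ.2.2.1 :=
    Primrec.list_map pT (pN.comp Primrec.snd)
  have p2 : Primrec fun x : NormalFormCode × ℕ × ℕ => x.1.2.2.map fun τ => τ.2.2.2 :=
    Primrec.list_map pT (pM.comp Primrec.snd)
  have pσN : Primrec fun x : NormalFormCode × ℕ × ℕ => x.1.2.1.2.2.1 := pN.comp pσ
  have pσM : Primrec fun x : NormalFormCode × ℕ × ℕ => x.1.2.1.2.2.2 := pM.comp pσ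
  have pab : Primrec fun x : NormalFormCode × ℕ × ℕ => x.2 := Primrec.snd
  have q1 : Primrec fun x : NormalFormCode × ℕ × ℕ =>
      entryEquation x.1.2.1.2.2.1 (x.1.2.2.map fun τ => τ.2.2.1) x.2.1 x.2.2 :=
    primrec_entryEquation.comp ((pσN.pair p1).pair pab)
  have q2 : Primrec fun x : NormalFormCode × ℕ × ℕ =>
      entryEquation x.1.2.1.2.2.2 (x.1.2.2.map fun τ => τ.2.2.2) x.2.1 x.2.2 :=
    primrec_entryEquation.comp ((pσM.pair p2).pair pab)
  have q3 := Primrec.list_cons.comp q2 (Primrec.const ([] : List EquationCode))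
  exact Primrec.list_cons.comp q1 q3

theorem primrec_equations : Primrec₂ equations := by
  have pr : Primrec fun x : ℕ × NormalFormCode => List.range x.1 :=
    Primrec.list_range.comp Primrec.fst
  have p1 : Primrec fun x : ℕ × NormalFormCode =>
      (List.range x.1).map fun j => diagEquation x.2 j :=
    Primrec.list_map pr (primrec_diagEquation.comp (Primrec.snd.comp Primrec.fst) Primrec.snd)
  have p2 : Primrec fun y : ((ℕ × NormalFormCode) × ℕ) × ℕ => nilEquations y.1.1.2 y.1.2 y.2 := by
    have h1 : Primrec fun y : ((ℕ × NormalFormCode) × ℕ) × ℕ => y.1.1.2 :=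
      Primrec.snd.comp (Primrec.fst.comp Primrec.fst)
    have h2 : Primrec fun y : ((ℕ × NormalFormCode) × ℕ) × ℕ => (y.1.2, y.2) :=
      (Primrec.snd.comp Primrec.fst).pair Primrec.snd
    have h3 := primrec_nilEquations.comp (h1.pair h2)
    exact h3
  have p3 : Primrec fun y : (ℕ × NormalFormCode) × ℕ =>
      (List.range y.1.1).flatMap fun b => nilEquations y.1.2 y.2 b :=
    Primrec.list_flatMap (pr.comp Primrec.fst) p2
  have p4 : Primrec fun x : ℕ × NormalFormCode =>
      (List.range x.1).flatMap fun a => (List.range x.1).flatMap fun b => nilEquations x.2 a b :=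
    Primrec.list_flatMap pr p3
  exact Primrec.list_append.comp p1 p4

theorem forall_mem_equations {n : ℕ} {z : NormalFormCode} {p : EquationCode → Prop} :
    (∀ r ∈ equations n z, p r) ↔ (∀ j < n, p (diagEquation z j)) ∧ ∀ a < n, ∀ b < n,
      p (entryEquation z.2.1.2.2.1 (z.2.2.map fun τ => τ.2.2.1) a b) ∧
      p (entryEquation z.2.1.2.2.2 (z.2.2.map fun τ => τ.2.2.2) a b) := by
  simp only [equations, nilEquations, List.forall_mem_append, List.forall_mem_map,
    List.forall_mem_flatMap, List.mem_range, List.forall_mem_cons, List.not_mem_nil,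
    IsEmpty.forall_iff, implies_true, and_true]

/-- The exponential is injective on multiples of `1` and of `i` jointly, as its periods are
multiples of `2 π i`. -/
theorem Complex.eq_of_exp_eq_of_exp_I_mul_eq {z w : ℂ} (h₁ : Complex.exp z = Complex.exp w)
    (h₂ : Complex.exp (Complex.I * z) = Complex.exp (Complex.I * w)) : z = w := by
  obtain ⟨m, hm⟩ := Complex.exp_eq_exp_iff_exists_int.1 h₁
  obtain ⟨l, hl⟩ := Complex.exp_eq_exp_iff_exists_int.1 h₂
  have h3 : Complex.I * (m * (2 * Real.pi * Complex.I)) = l * (2 * Real.pi * Complex.I) := by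
    rw [hm, mul_add] at hl
    exact add_left_cancel hl
  have h4 := congrArg Complex.re h3
  have h5 : (m : ℝ) * (2 * Real.pi) = 0 := by simpa using h4
  have h6 : (m : ℝ) = 0 := (mul_eq_zero.1 h5).resolve_right (by positivity)
  have h7 : m = 0 := by exact_mod_cast h6
  simpa [h7] using hm

theorem coord_map_jordan {T : List JordanCode} (f : JordanCode → AlgCode) {i : ℕ}
    (hi : i < T.length) (τ₀ : JordanCode) : coord (T.map f) i = f (T.getD i τ₀) := by
  simp [coord, List.getD, hi]

theorem JordanCheck.matValid {n : ℕ} {τ : JordanCode} (h : JordanCheck n τ) :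
    MatValid n (diagCode n τ.2.1) ∧ MatValid n τ.2.2.1 ∧ MatValid n τ.2.2.2 :=
  ⟨h.1.matCertified.valid, h.2.1.valid, h.2.2.1.valid⟩

theorem JordanCheck.isNilpotent {n : ℕ} {τ : JordanCode} (h : JordanCheck n τ) :
    IsNilpotent (matValue n τ.2.2.1) := by
  obtain ⟨-, hN, -, -, E, hE, h⟩ := h
  exact ((expCheck_iff hN.valid hE.valid).1 h).1

theorem matDotEq_singleton_iff {n : ℕ} {X Y Z W : MatCode} (hX : MatValid n X) (hY : MatValid n Y)
    (hZ : MatValid n Z) (hW : MatValid n W) : MatDotEq n [(X, Y)] [(Z, W)] ↔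
      matValue n X * matValue n Y = matValue n Z * matValue n W := by
  rw [matDotEq_iff (by simp [hX, hY]) (by simp [hZ, hW]), prodSum_singleton, prodSum_singleton]

theorem matDotEq_singleton_pair_iff {n : ℕ} {X Y Z W U V : MatCode} (hX : MatValid n X)
    (hY : MatValid n Y) (hZ : MatValid n Z) (hW : MatValid n W) (hU : MatValid n U)
    (hV : MatValid n V) : MatDotEq n [(X, Y)] [(Z, W), (U, V)] ↔
      matValue n X * matValue n Y = matValue n Z * matValue n W + matValue n U * matValue n V := by
  rw [matDotEq_iff (by simp [hX, hY]) (by simp [hZ, hW, hU, hV]), prodSum_singleton, prodSum_pair]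

theorem matValid_scalarCode_I (n : ℕ) : MatValid n (scalarCode n (codeOf Complex.I)) :=
  (matCertified_scalarCode n (certified_codeOf isAlgebraic_I)).valid

theorem JordanCheck.matValue_I {n : ℕ} {τ : JordanCode} (h : JordanCheck n τ) :
    matValue n τ.2.2.2 = Complex.I • matValue n τ.2.2.1 := by
  obtain ⟨-, hN, hM, h, -⟩ := h
  rw [matDotEq_singleton_iff hM.valid (matValid_oneCode n) (matValid_scalarCode_I n) hN.valid,
    matValue_oneCode, mul_one, matValue_scalarCode, value_codeOf isAlgebraic_I, smul_mul_assoc,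
    one_mul] at h
  exact h

theorem NormalFormCheck.valid_of_mem_equations {n : ℕ} {z : NormalFormCode}
    (h : NormalFormCheck n z) : ∀ r ∈ equations n z, r.Valid z.2.2.length := by
  obtain ⟨-, hJ, -⟩ := h
  have hσ := hJ _ List.mem_cons_self
  have hτ : ∀ i < z.2.2.length, JordanCheck n (z.2.2.getD i z.2.1) := fun i hi => by
    rw [List.getD_eq_getElem _ _ hi]
    exact hJ _ (List.mem_cons_of_mem _ (List.getElem_mem hi))
  have h0 : (codeOf 0).Valid := (certified_codeOf isAlgebraic_zero).valid
  have h1 : (codeOf 1).Valid := (certified_codeOf isAlgebraic_one).valid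
  refine forall_mem_equations.2 ⟨fun j hj => ⟨by simp [diagEquation], fun i hi => ?_, ?_, h0⟩,
    fun a ha b hb => ⟨⟨by simp [entryEquation], fun i hi => ?_, h1, hσ.matValid.2.1 a ha b hb⟩,
      ⟨by simp [entryEquation], fun i hi => ?_, h1, hσ.matValid.2.2 a ha b hb⟩⟩⟩
  · rw [diagEquation, coord_map_jordan _ hi z.2.1]
    exact ((hτ i hi).1 j (List.mem_range.2 hj)).valid
  · exact (hσ.1 j (List.mem_range.2 hj)).valid
  · rw [entryEquation, List.map_map, coord_map_jordan _ hi z.2.1]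
    exact (hτ i hi).matValid.2.1 a ha b hb
  · rw [entryEquation, List.map_map, coord_map_jordan _ hi z.2.1]
    exact (hτ i hi).matValid.2.2 a ha b hb

/-- A checked normal form turns the matrix equation into its equations. -/
theorem NormalFormCheck.forall_holds_iff {n k : ℕ} {z : NormalFormCode} (h : NormalFormCheck n z)
    {A : Fin k → Matrix (Fin n) (Fin n) ℂ} {C : Matrix (Fin n) (Fin n) ℂ}
    (hk : z.2.2.length = k) (hA : ∀ i : Fin k, MatValid n (z.2.2.getD i z.2.1).1 ∧
      matValue n (z.2.2.getD i z.2.1).1 = A i)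
    (hC : MatValid n z.2.1.1 ∧ matValue n z.2.1.1 = C) (t : Fin k → ℂ) :
    (∀ r ∈ equations n z, r.Holds t) ↔
      (List.ofFn fun i => NormedSpace.exp (t i • A i)).prod = C := by
  have hvalid := h.valid_of_mem_equations
  obtain ⟨⟨hP, hQ, hQP⟩, hJ, hcomm, hadd, hmul⟩ := h
  have hI := matValid_oneCode n
  have hσ := hJ _ List.mem_cons_self
  have hmem : ∀ i : Fin k, z.2.2.getD i z.2.1 ∈ z.2.2 := fun i => by
    rw [List.getD_eq_getElem _ _ (hk ▸ i.2)]
    exact List.getElem_mem _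
  have hτ : ∀ i : Fin k, JordanCheck n (z.2.2.getD i z.2.1) :=
    fun i => hJ _ (List.mem_cons_of_mem _ (hmem i))
  -- the parts of all decompositions commute
  have hvp : ∀ X ∈ jordanParts n (z.2.1 :: z.2.2), MatValid n X := by
    intro X hX
    rcases List.mem_append.1 hX with hX | hX
    · obtain ⟨τ, hτ, rfl⟩ := List.mem_map.1 hX
      exact (hJ τ hτ).matValid.1
    · obtain ⟨τ, hτ, rfl⟩ := List.mem_map.1 hX
      exact (hJ τ hτ).matValid.2.1
  have hc : ∀ X ∈ jordanParts n (z.2.1 :: z.2.2), ∀ Y ∈ jordanParts n (z.2.1 :: z.2.2),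
      Commute (matValue n X) (matValue n Y) := fun X hX Y hY =>
    (matDotEq_singleton_iff (hvp X hX) (hvp Y hY) (hvp Y hY) (hvp X hX)).1 (hcomm X hX Y hY)
  have hdp : ∀ τ ∈ z.2.1 :: z.2.2, diagCode n τ.2.1 ∈ jordanParts n (z.2.1 :: z.2.2) := fun τ hτ =>
    List.mem_append_left _ (List.mem_map_of_mem (f := fun τ : JordanCode => diagCode n τ.2.1) hτ)
  have hnp : ∀ τ ∈ z.2.1 :: z.2.2, τ.2.2.1 ∈ jordanParts n (z.2.1 :: z.2.2) := fun τ hτ =>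
    List.mem_append_right _ (List.mem_map_of_mem (f := fun τ : JordanCode => τ.2.2.1) hτ)
  have hmem' : ∀ i : Fin k, z.2.2.getD i z.2.1 ∈ z.2.1 :: z.2.2 :=
    fun i => List.mem_cons_of_mem _ (hmem i)
  have hσm : z.2.1 ∈ z.2.1 :: z.2.2 := List.mem_cons_self
  have hQP' : matValue n z.1.2 * matValue n z.1.1 = 1 := by
    rw [matDotEq_singleton_iff hQ.valid hP.valid hI hI, matValue_oneCode, one_mul] at hQP
    exact hQP
  have hA' : ∀ i : Fin k, A i * matValue n z.1.1 = matValue n z.1.1 *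
      Matrix.diagonal (fun j : Fin n => (coord (z.2.2.getD i z.2.1).2.1 j).value) +
      matValue n z.1.1 * matValue n (z.2.2.getD i z.2.1).2.2.1 := by
    intro i
    have h1 := hadd _ (hmem i)
    rw [AddCheck, matDotEq_singleton_pair_iff (hA i).1 hP.valid hP.valid (hτ i).matValid.1 hP.valid
      (hτ i).matValid.2.1, (hA i).2, matValue_diagCode] at h1
    exact h1
  have hC' : C * matValue n z.1.1 = matValue n z.1.1 *
      (Matrix.diagonal (fun j : Fin n => (coord z.2.1.2.1 j).value) *
        IsNilpotent.exp (matValue n z.2.1.2.2.1)) := by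
    obtain ⟨⟨E, F⟩, hE, hF, h1, h2, h3⟩ := hmul
    rw [matDotEq_singleton_iff hC.1 hP.valid hP.valid hF.valid, hC.2] at h2
    rw [matDotEq_singleton_iff hF.valid hI hσ.matValid.1 hE.valid, matValue_oneCode, mul_one,
      matValue_diagCode] at h3
    rw [h2, h3, ((expCheck_iff hσ.matValid.2.1 hE.valid).1 h1).2]
  rw [Matrix.prod_exp_eq_iff hQP' hA' hC'
    (fun i l => by
      have := hc _ (hdp _ (hmem' i)) _ (hnp _ (hmem' l))
      rwa [matValue_diagCode] at this)
    (fun i l => hc _ (hnp _ (hmem' i)) _ (hnp _ (hmem' l)))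
    (fun i => hc _ (hnp _ (hmem' i)) _ (hnp _ hσm))
    (fun i => by
      have := hc _ (hdp _ hσm) _ (hnp _ (hmem' i))
      rwa [matValue_diagCode] at this)
    (by
      have := hc _ (hdp _ hσm) _ (hnp _ hσm)
      rwa [matValue_diagCode] at this)
    (fun i => (hτ i).isNilpotent) hσ.isNilpotent, forall_mem_equations]
  have hco : ∀ (f : JordanCode → AlgCode) (i : Fin k),
      coord (z.2.2.map f) i = f (z.2.2.getD i z.2.1) :=
    fun f i => coord_map_jordan f (hk ▸ i.2) _
  refine and_congr ⟨fun h j => ?_, fun h j hj => ?_⟩ ⟨fun h => ?_, fun h a ha b hb => ?_⟩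
  · have h1 := h j j.2
    simp only [EquationCode.Holds, diagEquation, hco, value_codeOf isAlgebraic_zero_complex,
      Complex.exp_zero, mul_one] at h1
    exact h1
  · have h1 := h ⟨j, hj⟩
    simp only [EquationCode.Holds, diagEquation, hco, value_codeOf isAlgebraic_zero_complex,
      Complex.exp_zero, mul_one]
    exact h1
  · ext a b
    obtain ⟨h1, h2⟩ := h a a.2 b b.2
    simp only [EquationCode.Holds, entryEquation, List.map_map, hco, Function.comp_apply,
      value_codeOf isAlgebraic_one, one_mul] at h1 h2
    have h3 : ∀ τ, JordanCheck n τ → (entry τ.2.2.2 a b).value =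
        Complex.I * (entry τ.2.2.1 a b).value :=
      fun τ hτ => congrFun (congrFun hτ.matValue_I a) b
    simp only [h3 _ hσ, h3 _ (hτ _), mul_assoc, ← Finset.mul_sum] at h2
    rw [Matrix.sum_apply]
    refine Eq.trans (Finset.sum_congr rfl fun i _ => ?_)
      (Complex.eq_of_exp_eq_of_exp_I_mul_eq h1 h2)
    exact mul_comm _ _
  · have h1 : ∑ i : Fin k, (entry (z.2.2.getD i z.2.1).2.2.1 a b).value * t i =
        (entry z.2.1.2.2.1 a b).value := by
      have h2 := congrFun (congrFun h ⟨a, ha⟩) ⟨b, hb⟩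
      rw [Matrix.sum_apply] at h2
      refine Eq.trans (Finset.sum_congr rfl fun i _ => ?_) h2
      exact mul_comm _ _
    have h3 : ∀ τ, JordanCheck n τ → (entry τ.2.2.2 a b).value =
        Complex.I * (entry τ.2.2.1 a b).value :=
      fun τ hτ => congrFun (congrFun hτ.matValue_I ⟨a, ha⟩) ⟨b, hb⟩
    simp only [EquationCode.Holds, entryEquation, List.map_map, hco, Function.comp_apply,
      value_codeOf isAlgebraic_one, one_mul, h1, h3 _ hσ, h3 _ (hτ _), mul_assoc, ← Finset.mul_sum,
      and_self]

/-! ### Certificates for unsolvable instances -/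

/-- The verifiable form of "`C` does not commute with one of the matrices in the list": the
commutator `Z` is nonzero. -/
def CommutatorCheck (n : ℕ) (l : List MatCode) (C : MatCode) : Prop :=
  ∃ y : ℕ × MatCode, y.1 < l.length ∧ MatCertified n y.2 ∧ NonzeroCheck n y.2 ∧
    MatDotEq n [(C, l.getD y.1 [])] [(l.getD y.1 [], C), (y.2, oneCode n)]

/-- The verifiable form of "`C` is a zero divisor". -/
def ZeroDivisorCheck (n : ℕ) (C : MatCode) : Prop :=
  ∃ Z, MatCertified n Z ∧ NonzeroCheck n Z ∧ MatDotEq n [(C, Z)] []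

theorem semiDec_commutatorCheck :
    SemiDec fun x : ℕ × List MatCode × MatCode => CommutatorCheck x.1 x.2.1 x.2.2 := by
  have pn : Primrec fun x : (ℕ × List MatCode × MatCode) × ℕ × MatCode => x.1.1 :=
    Primrec.fst.comp Primrec.fst
  have pl : Primrec fun x : (ℕ × List MatCode × MatCode) × ℕ × MatCode => x.1.2.1 :=
    Primrec.fst.comp (Primrec.snd.comp Primrec.fst)
  have pC : Primrec fun x : (ℕ × List MatCode × MatCode) × ℕ × MatCode => x.1.2.2 :=
    Primrec.snd.comp (Primrec.snd.comp Primrec.fst)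
  have pi : Primrec fun x : (ℕ × List MatCode × MatCode) × ℕ × MatCode => x.2.1 :=
    Primrec.fst.comp Primrec.snd
  have pZ : Primrec fun x : (ℕ × List MatCode × MatCode) × ℕ × MatCode => x.2.2 :=
    Primrec.snd.comp Primrec.snd
  have pA : Primrec fun x : (ℕ × List MatCode × MatCode) × ℕ × MatCode => x.1.2.1.getD x.2.1 [] :=
    (Primrec.list_getD []).comp pl pi
  have h1 := SemiDec.of_primrec (Primrec.nat_lt.comp pi (Primrec.list_length.comp pl))
  have h3 := semiDec_nonzeroCheck.comp (pn.pair pZ)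
  have h4 := SemiDec.matDotEq pn (Primrec.matPair pC pA)
    (Primrec.matPair₂ pA pC pZ (primrec_oneCode.comp pn))
  exact (h1.and ((SemiDec.matCertified pn pZ).and (h3.and h4))).exists_

theorem semiDec_zeroDivisorCheck : SemiDec fun x : ℕ × MatCode => ZeroDivisorCheck x.1 x.2 := by
  have pn : Primrec fun x : (ℕ × MatCode) × MatCode => x.1.1 := Primrec.fst.comp Primrec.fst
  have pC : Primrec fun x : (ℕ × MatCode) × MatCode => x.1.2 := Primrec.snd.comp Primrec.fst
  have pZ : Primrec fun x : (ℕ × MatCode) × MatCode => x.2 := Primrec.snd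
  have h2 := semiDec_nonzeroCheck.comp (pn.pair pZ)
  have h3 := SemiDec.matDotEq pn (Primrec.matPair pC pZ) (Primrec.const [])
  exact ((SemiDec.matCertified pn pZ).and (h2.and h3)).exists_

theorem commutatorCheck_iff {n : ℕ} {l : List MatCode} {C : MatCode} (hC : MatValid n C)
    (hl : ∀ i < l.length, MatValid n (l.getD i [])) : CommutatorCheck n l C ↔
      ∃ i < l.length, ¬ Commute (matValue n (l.getD i [])) (matValue n C) := by
  have hI := matValid_oneCode n
  constructor
  · rintro ⟨⟨i, Z⟩, hi, hZ, h0, h⟩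
    rw [nonzeroCheck_iff hZ.valid] at h0
    rw [matDotEq_singleton_pair_iff hC (hl i hi) (hl i hi) hC hZ.valid hI, matValue_oneCode,
      mul_one] at h
    exact ⟨i, hi, fun hc => h0 (left_eq_add.1 (hc.eq.trans h))⟩
  · rintro ⟨i, hi, h⟩
    have halg : ∀ a b, IsAlgebraic ℚ ((matValue n C * matValue n (l.getD i []) -
        matValue n (l.getD i []) * matValue n C) a b) := by
      intro a b
      rw [Matrix.sub_apply, Matrix.mul_apply, Matrix.mul_apply]
      refine IsAlgebraic.sub ?_ ?_ <;>
      refine isAlgebraic_iff_isIntegral.2 (IsIntegral.sum _ fun s _ =>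
        isAlgebraic_iff_isIntegral.1 ?_)
      · exact (hC.isAlgebraic a s).mul ((hl i hi).isAlgebraic s b)
      · exact ((hl i hi).isAlgebraic a s).mul (hC.isAlgebraic s b)
    have hZ := matCertified_matCode halg
    refine ⟨(i, matCode _), hi, hZ, ?_, ?_⟩
    · rw [nonzeroCheck_iff hZ.valid, matValue_matCode halg]
      exact fun h' => h (sub_eq_zero.1 h').symm
    · rw [matDotEq_singleton_pair_iff hC (hl i hi) (hl i hi) hC hZ.valid hI, matValue_oneCode,
        mul_one, matValue_matCode halg, add_sub_cancel]

theorem ZeroDivisorCheck.not_isUnit {n : ℕ} {C : MatCode} (h : ZeroDivisorCheck n C)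
    (hC : MatValid n C) : ¬ IsUnit (matValue n C) := by
  obtain ⟨Z, hZ, h0, h⟩ := h
  rw [nonzeroCheck_iff hZ.valid] at h0
  rw [matDotEq_iff (by simp [hC, hZ.valid]) (by simp), prodSum_singleton, prodSum_nil] at h
  exact fun hu => h0 (hu.mul_right_eq_zero.1 h)

/-- An equation without solutions, `exp 0 = 0`. -/
noncomputable def falseEquation (k : ℕ) : EquationCode :=
  ((List.range k).map fun _ => codeOf 0, codeOf 0, codeOf 0)

theorem primrec_falseEquation : Primrec falseEquation := by
  have h : Primrec fun k : ℕ => (List.range k).map fun _ => codeOf 0 :=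
    Primrec.list_map Primrec.list_range (Primrec.const _)
  exact h.pair ((Primrec.const _).pair (Primrec.const _))

theorem valid_falseEquation (k : ℕ) : (falseEquation k).Valid k := by
  have h0 : (codeOf 0).Valid := (certified_codeOf isAlgebraic_zero).valid
  exact ⟨by simp [falseEquation], fun i hi => by rw [falseEquation, coord_const _ hi]; exact h0,
    h0, h0⟩

theorem not_holds_falseEquation {k : ℕ} (t : Fin k → ℂ) : ¬ (falseEquation k).Holds t := by
  intro h
  simp only [EquationCode.Holds, falseEquation, value_codeOf isAlgebraic_zero_complex,
    zero_mul] at h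
  exact Complex.exp_ne_zero _ h

/-- A product of exponentials of commuting matrices is invertible and commutes with them. -/
theorem Matrix.isUnit_and_commute_prod_exp {n k : ℕ} {A : Fin k → Matrix (Fin n) (Fin n) ℂ}
    (hA : ∀ i j, Commute (A i) (A j)) (t : Fin k → ℂ) :
    IsUnit (List.ofFn fun i => NormedSpace.exp (t i • A i)).prod ∧
      ∀ j, Commute (A j) (List.ofFn fun i => NormedSpace.exp (t i • A i)).prod := by
  refine ⟨?_, fun j => ?_⟩
  · refine List.prod_induction IsUnit ?_ isUnit_one ?_
    · exact fun _ _ h1 h2 => h1.mul h2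
    · intro X hX
      obtain ⟨i, rfl⟩ := (List.mem_ofFn' _ _).1 hX
      exact Matrix.isUnit_exp _
  · refine Commute.list_prod_right _ _ fun X hX => ?_
    obtain ⟨i, rfl⟩ := (List.mem_ofFn' _ _).1 hX
    have h1 : Commute (A j) (t i • A i) := (hA j i).smul_right _
    open scoped Matrix.Norms.Operator in
    exact h1.exp_right

/-! ### Existence of certificates -/

section Existence

/-- The field of algebraic numbers. -/
local notation "𝔸" => algebraicClosure ℚ ℂ

/-- A matrix of algebraic numbers, regarded as a complex matrix. -/
local notation "toC" => RingHom.mapMatrix (algebraMap (algebraicClosure ℚ ℂ) ℂ)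

theorem isAlgClosed_algebraicClosure : IsAlgClosed 𝔸 :=
  (algebraicClosure.isAlgClosure ℚ ℂ).isAlgClosed

theorem isAlgebraic_coe (x : 𝔸) : IsAlgebraic ℚ (algebraMap 𝔸 ℂ x) :=
  mem_algebraicClosure_iff.1 x.2

variable {n : ℕ}

theorem isAlgebraic_mapMatrix (X : Matrix (Fin n) (Fin n) 𝔸) (i j : Fin n) :
    IsAlgebraic ℚ (toC X i j) :=
  isAlgebraic_coe (X i j)

theorem exists_mapMatrix_eq {X : Matrix (Fin n) (Fin n) ℂ} (h : ∀ i j, IsAlgebraic ℚ (X i j)) :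
    ∃ Y : Matrix (Fin n) (Fin n) 𝔸, toC Y = X :=
  ⟨Matrix.of fun i j => ⟨X i j, mem_algebraicClosure_iff.2 (h i j)⟩, rfl⟩

theorem mapMatrix_injective :
    Function.Injective (toC : Matrix (Fin n) (Fin n) 𝔸 → Matrix (Fin n) (Fin n) ℂ) :=
  Matrix.map_injective (algebraMap 𝔸 ℂ).injective

/-- A singular matrix of algebraic numbers annihilates a nonzero matrix of algebraic numbers, each of
whose columns is the same vector of the kernel. -/
theorem exists_zeroDivisorCheck {C : MatCode} (hC : MatValid n C)
    (h : ¬ IsUnit (matValue n C)) : ZeroDivisorCheck n C := by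
  obtain ⟨Y, hY⟩ := exists_mapMatrix_eq hC.isAlgebraic
  have hdet : Y.det = 0 := by
    by_contra h'
    refine h ?_
    rw [← hY]
    exact ((Matrix.isUnit_iff_isUnit_det _).2 (isUnit_iff_ne_zero.2 h')).map _
  obtain ⟨v, hv, hYv⟩ := Matrix.exists_mulVec_eq_zero_iff.2 hdet
  obtain ⟨i, hi⟩ := Function.ne_iff.1 hv
  have halg := isAlgebraic_mapMatrix (Matrix.of fun i _ : Fin n => v i)
  have hZ := matCertified_matCode halg
  refine ⟨matCode _, hZ, ?_, ?_⟩
  · rw [nonzeroCheck_iff hZ.valid, matValue_matCode halg]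
    intro h0
    rw [← map_zero toC] at h0
    exact hi (congrFun (congrFun (mapMatrix_injective h0) i) i)
  · have hYZ : Y * (Matrix.of fun i _ : Fin n => v i) = 0 := by
      ext1 a b
      exact congrFun hYv a
    have hv : ∀ p ∈ [(C, matCode (toC (Matrix.of fun i _ : Fin n => v i)))],
        MatValid n p.1 ∧ MatValid n p.2 := by
      intro p hp
      rw [List.mem_singleton.1 hp]
      exact ⟨hC, hZ.valid⟩
    rw [matDotEq_iff hv (by simp), prodSum_singleton, prodSum_nil, matValue_matCode halg, ← hY,
      ← map_mul, hYZ, map_zero]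

/-- The code of a vector. -/
noncomputable def vecCode (v : Fin n → ℂ) : List AlgCode := List.ofFn fun j => codeOf (v j)

theorem coord_vecCode (v : Fin n → ℂ) (j : Fin n) : coord (vecCode v) j = codeOf (v j) := by
  simp [coord, vecCode, List.getD]

/-- The code of a Jordan decomposition over the algebraic numbers. -/
noncomputable def jordanCode (X : MatCode) (d : Fin n → 𝔸) (N : Matrix (Fin n) (Fin n) 𝔸) :
    JordanCode :=
  (X, vecCode fun j => algebraMap 𝔸 ℂ (d j), matCode (toC N), matCode (Complex.I • toC N))

theorem matCertified_matCode_mapMatrix (X : Matrix (Fin n) (Fin n) 𝔸) :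
    MatCertified n (matCode (toC X)) :=
  matCertified_matCode (isAlgebraic_mapMatrix X)

theorem matValue_matCode_mapMatrix (X : Matrix (Fin n) (Fin n) 𝔸) :
    matValue n (matCode (toC X)) = toC X :=
  matValue_matCode (isAlgebraic_mapMatrix X)

theorem vecCertified_vecCode (d : Fin n → 𝔸) :
    VecCertified n (vecCode fun j => algebraMap 𝔸 ℂ (d j)) := by
  intro j hj
  have := coord_vecCode (fun j => algebraMap 𝔸 ℂ (d j)) ⟨j, List.mem_range.1 hj⟩
  rw [this]
  exact certified_codeOf (isAlgebraic_coe _)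

theorem matValue_diagCode_vecCode (d : Fin n → 𝔸) :
    matValue n (diagCode n (vecCode fun j => algebraMap 𝔸 ℂ (d j))) = toC (Matrix.diagonal d) := by
  rw [matValue_diagCode, RingHom.mapMatrix_apply, Matrix.diagonal_map (map_zero _)]
  congr 1
  funext j
  rw [coord_vecCode, value_codeOf (isAlgebraic_coe _)]

theorem expCheck_matCode {N : Matrix (Fin n) (Fin n) 𝔸} (hN : IsNilpotent N) :
    ExpCheck n (matCode (toC N)) (matCode (toC (IsNilpotent.exp N))) := by
  rw [expCheck_iff (matCertified_matCode_mapMatrix _).valid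
    (matCertified_matCode_mapMatrix _).valid, matValue_matCode_mapMatrix,
    matValue_matCode_mapMatrix]
  exact ⟨hN.map _, hN.map_exp _⟩

theorem jordanCheck_jordanCode (X : MatCode) (d : Fin n → 𝔸) {N : Matrix (Fin n) (Fin n) 𝔸}
    (hN : IsNilpotent N) : JordanCheck n (jordanCode X d N) := by
  have halg : ∀ i j, IsAlgebraic ℚ ((Complex.I • toC N) i j) := fun i j =>
    isAlgebraic_I.mul (isAlgebraic_mapMatrix N i j)
  have hM := matCertified_matCode halg
  have hN' := matCertified_matCode_mapMatrix N
  refine ⟨vecCertified_vecCode d, hN', hM, ?_, _, matCertified_matCode_mapMatrix _,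
    expCheck_matCode hN⟩
  exact (matDotEq_singleton_iff hM.valid (matValid_oneCode n) (matValid_scalarCode_I n)
    hN'.valid).2 (by
      rw [matValue_matCode halg, matValue_oneCode, mul_one, matValue_scalarCode,
        value_codeOf isAlgebraic_I, matValue_matCode_mapMatrix, smul_mul_assoc, one_mul])

/-- Commuting matrices together with an invertible matrix that commutes with them have a normal form
that can be checked. -/
theorem exists_normalFormCheck {l : List MatCode} {C : MatCode} (hC : MatValid n C)
    (hl : ∀ i < l.length, MatValid n (l.getD i []))
    (hcomm : ∀ i < l.length, ∀ j < l.length,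
      Commute (matValue n (l.getD i [])) (matValue n (l.getD j [])))
    (hlC : ∀ i < l.length, Commute (matValue n (l.getD i [])) (matValue n C))
    (hu : IsUnit (matValue n C)) :
    ∃ z : NormalFormCode, NormalFormCheck n z ∧ z.2.1.1 = C ∧ z.2.2.map (fun τ => τ.1) = l := by
  have := isAlgClosed_algebraicClosure
  obtain ⟨Y, hY⟩ := exists_mapMatrix_eq hC.isAlgebraic
  choose A hA using fun i : Fin l.length => exists_mapMatrix_eq (hl i i.2).isAlgebraic
  have hback : ∀ {X Z : Matrix (Fin n) (Fin n) 𝔸}, Commute (toC X) (toC Z) → Commute X Z := by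
    intro X Z h
    refine mapMatrix_injective ?_
    rw [map_mul, map_mul]
    exact h
  have hYu : IsUnit Y := by
    rw [Matrix.isUnit_iff_isUnit_det, isUnit_iff_ne_zero]
    intro h0
    rw [← hY, Matrix.isUnit_iff_isUnit_det, ← RingHom.map_det, h0, map_zero] at hu
    exact not_isUnit_zero hu
  obtain ⟨P, Q, d, c, N, L, hQP, hAP, hCP, hN, hL, hdN, hNN, hdL, hNL, hcN, hcL⟩ :=
    exists_normal_form A Y
      (fun i j => hback (by rw [hA, hA]; exact hcomm i i.2 j j.2))
      (fun i => hback (by rw [hA, hY]; exact hlC i i.2)) hYu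
  -- the decomposition of the target matrix is treated together with the others
  let d' : Option (Fin l.length) → Fin n → 𝔸 := fun o => o.elim c d
  let N' : Option (Fin l.length) → Matrix (Fin n) (Fin n) 𝔸 := fun o => o.elim L N
  have hN' : ∀ o, IsNilpotent (N' o) := by rintro (_ | i); exacts [hL, hN i]
  have hNN' : ∀ o p, Commute (N' o) (N' p) := by
    rintro (_ | i) (_ | j)
    exacts [Commute.refl _, (hNL j).symm, hNL i, hNN i j]
  have hdN' : ∀ o p, Commute (Matrix.diagonal (d' o)) (N' p) := by
    rintro (_ | i) (_ | j)
    exacts [hcL, hcN j, hdL i, hdN i j]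
  let σ : JordanCode := jordanCode C c L
  let T : List JordanCode := List.ofFn fun i : Fin l.length => jordanCode (l.get i) (d i) (N i)
  have hmem : ∀ τ ∈ σ :: T, ∃ X o, τ = jordanCode X (d' o) (N' o) := by
    intro τ hτ
    rcases List.mem_cons.1 hτ with rfl | hτ
    · exact ⟨C, none, rfl⟩
    · obtain ⟨i, rfl⟩ := (List.mem_ofFn' _ _).1 hτ
      exact ⟨l.get i, some i, rfl⟩
  have hPc := matCertified_matCode_mapMatrix P
  have hQc := matCertified_matCode_mapMatrix Q
  have hI := matValid_oneCode n
  refine ⟨((matCode (toC P), matCode (toC Q)), σ, T), ⟨⟨hPc, hQc, ?_⟩, fun τ hτ => ?_, ?_,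
    fun τ hτ => ?_, ?_⟩, rfl, ?_⟩
  · refine (matDotEq_singleton_iff hQc.valid hPc.valid hI hI).2 ?_
    rw [matValue_matCode_mapMatrix, matValue_matCode_mapMatrix, ← map_mul, hQP, map_one,
      matValue_oneCode, one_mul]
  · obtain ⟨X, o, rfl⟩ := hmem τ hτ
    exact jordanCheck_jordanCode X _ (hN' o)
  · have hpart : ∀ X ∈ jordanParts n (σ :: T), ∃ o, ∃ Z, (Z = Matrix.diagonal (d' o) ∨ Z = N' o) ∧
        MatValid n X ∧ matValue n X = toC Z := by
      intro X hX
      rcases List.mem_append.1 hX with hX | hX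
      · obtain ⟨τ, hτ, rfl⟩ := List.mem_map.1 hX
        obtain ⟨X, o, rfl⟩ := hmem τ hτ
        exact ⟨o, _, Or.inl rfl, (vecCertified_vecCode _).matCertified.valid,
          matValue_diagCode_vecCode _⟩
      · obtain ⟨τ, hτ, rfl⟩ := List.mem_map.1 hX
        obtain ⟨X, o, rfl⟩ := hmem τ hτ
        exact ⟨o, _, Or.inr rfl, (matCertified_matCode_mapMatrix _).valid,
          matValue_matCode_mapMatrix _⟩
    intro X hX X' hX'
    obtain ⟨o, Z, hZ, hXv, hXZ⟩ := hpart X hX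
    obtain ⟨p, W, hW, hXv', hXW⟩ := hpart X' hX'
    rw [matDotEq_singleton_iff hXv hXv' hXv' hXv, hXZ, hXW]
    have h : Commute Z W := by
      rcases hZ with rfl | rfl <;> rcases hW with rfl | rfl
      exacts [Matrix.commute_diagonal _ _, hdN' o p, (hdN' p o).symm, hNN' o p]
    exact h.map toC
  · obtain ⟨i, rfl⟩ := (List.mem_ofFn' _ _).1 hτ
    have hX : l.get i = l.getD i [] := by simp [List.getD]
    have hXv : MatValid n (l.get i) := by rw [hX]; exact hl i i.2
    refine (matDotEq_singleton_pair_iff hXv hPc.valid hPc.valid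
      (vecCertified_vecCode _).matCertified.valid hPc.valid
      (matCertified_matCode_mapMatrix _).valid).2 ?_
    rw [matValue_diagCode_vecCode, matValue_matCode_mapMatrix, matValue_matCode_mapMatrix]
    have h := congrArg toC (hAP i)
    rw [map_mul, map_add, map_mul, map_mul, hA, ← hX] at h
    exact h
  · have hF := matCertified_matCode_mapMatrix (Matrix.diagonal c * IsNilpotent.exp L)
    have hE := matCertified_matCode_mapMatrix (IsNilpotent.exp L)
    refine ⟨(matCode _, matCode _), hE, hF, expCheck_matCode hL, ?_, ?_⟩
    · refine (matDotEq_singleton_iff hC hPc.valid hPc.valid hF.valid).2 ?_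
      rw [matValue_matCode_mapMatrix, matValue_matCode_mapMatrix, ← hY, ← map_mul, ← map_mul, hCP]
    · refine (matDotEq_singleton_iff hF.valid hI (vecCertified_vecCode _).matCertified.valid
        hE.valid).2 ?_
      rw [matValue_diagCode_vecCode, matValue_matCode_mapMatrix, matValue_matCode_mapMatrix,
        matValue_oneCode, mul_one, map_mul]
  · simp only [T, List.map_ofFn]
    exact List.ofFn_get l

end Existence

/-! ### The reduction -/

/-- The output `v` is justified by a certificate: either by a normal form of the matrices of the
instance `w`, or by an obstruction to its solvability. -/
def IsReduction (w : GenMEPCode) (v : LEPCode) : Prop :=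
  (∃ z : NormalFormCode, NormalFormCheck w.2.1.length z ∧ z.2.1.1 = w.2.1 ∧
    z.2.2.map (fun τ => τ.1) = w.1 ∧
    v = lepOfEquations w.1.length (equations w.2.1.length z) w.2.2) ∨
  ((CommutatorCheck w.2.1.length w.1 w.2.1 ∨ ZeroDivisorCheck w.2.1.length w.2.1) ∧
    v = lepOfEquations w.1.length [falseEquation w.1.length] w.2.2)

theorem semiDec_normalFormReduction : SemiDec fun x : GenMEPCode × LEPCode =>
    ∃ z : NormalFormCode, NormalFormCheck x.1.2.1.length z ∧ z.2.1.1 = x.1.2.1 ∧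
      z.2.2.map (fun τ => τ.1) = x.1.1 ∧
      x.2 = lepOfEquations x.1.1.length (equations x.1.2.1.length z) x.1.2.2 := by
  have pw : Primrec fun y : (GenMEPCode × LEPCode) × NormalFormCode => y.1.1 :=
    Primrec.fst.comp Primrec.fst
  have pv : Primrec fun y : (GenMEPCode × LEPCode) × NormalFormCode => y.1.2 :=
    Primrec.snd.comp Primrec.fst
  have pz : Primrec fun y : (GenMEPCode × LEPCode) × NormalFormCode => y.2 := Primrec.snd
  have pA : Primrec fun y : (GenMEPCode × LEPCode) × NormalFormCode => y.1.1.1 :=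
    Primrec.fst.comp pw
  have pC : Primrec fun y : (GenMEPCode × LEPCode) × NormalFormCode => y.1.1.2.1 :=
    Primrec.fst.comp (Primrec.snd.comp pw)
  have pP : Primrec fun y : (GenMEPCode × LEPCode) × NormalFormCode => y.1.1.2.2 :=
    Primrec.snd.comp (Primrec.snd.comp pw)
  have pn : Primrec fun y : (GenMEPCode × LEPCode) × NormalFormCode => y.1.1.2.1.length :=
    Primrec.list_length.comp pC
  have pk : Primrec fun y : (GenMEPCode × LEPCode) × NormalFormCode => y.1.1.1.length :=
    Primrec.list_length.comp pA
  have h1 := semiDec_normalFormCheck.comp (pn.pair pz)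
  have pσ : Primrec fun y : (GenMEPCode × LEPCode) × NormalFormCode => y.2.2.1.1 :=
    Primrec.fst.comp (Primrec.fst.comp (Primrec.snd.comp pz))
  have h2 := SemiDec.of_primrec (Primrec.eq.comp pσ pC)
  have pT : Primrec fun y : (GenMEPCode × LEPCode) × NormalFormCode =>
      y.2.2.2.map fun τ => τ.1 :=
    Primrec.list_map (Primrec.snd.comp (Primrec.snd.comp pz)) (Primrec.fst.comp Primrec.snd)
  have h3 := SemiDec.of_primrec (Primrec.eq.comp pT pA)
  have pe : Primrec fun y : (GenMEPCode × LEPCode) × NormalFormCode =>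
      equations y.1.1.2.1.length y.2 := primrec_equations.comp pn pz
  have po := primrec_lepOfEquations.comp (pk.pair (pe.pair pP))
  have h4 := SemiDec.of_primrec (Primrec.eq.comp pv po)
  exact (h1.and (h2.and (h3.and h4))).exists_

theorem semiDec_obstructionReduction : SemiDec fun x : GenMEPCode × LEPCode =>
    (CommutatorCheck x.1.2.1.length x.1.1 x.1.2.1 ∨ ZeroDivisorCheck x.1.2.1.length x.1.2.1) ∧
      x.2 = lepOfEquations x.1.1.length [falseEquation x.1.1.length] x.1.2.2 := by
  have pA : Primrec fun x : GenMEPCode × LEPCode => x.1.1 := Primrec.fst.comp Primrec.fst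
  have pC : Primrec fun x : GenMEPCode × LEPCode => x.1.2.1 :=
    Primrec.fst.comp (Primrec.snd.comp Primrec.fst)
  have pP : Primrec fun x : GenMEPCode × LEPCode => x.1.2.2 :=
    Primrec.snd.comp (Primrec.snd.comp Primrec.fst)
  have pv : Primrec fun x : GenMEPCode × LEPCode => x.2 := Primrec.snd
  have pn : Primrec fun x : GenMEPCode × LEPCode => x.1.2.1.length := Primrec.list_length.comp pC
  have pk : Primrec fun x : GenMEPCode × LEPCode => x.1.1.length := Primrec.list_length.comp pA
  have h1 := semiDec_commutatorCheck.comp (pn.pair (pA.pair pC))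
  have h2 := semiDec_zeroDivisorCheck.comp (pn.pair pC)
  have pf : Primrec fun x : GenMEPCode × LEPCode => [falseEquation x.1.1.length] :=
    Primrec.list_cons.comp (primrec_falseEquation.comp pk) (Primrec.const [])
  have po := primrec_lepOfEquations.comp (pk.pair (pf.pair pP))
  have h3 := SemiDec.of_primrec (Primrec.eq.comp pv po)
  exact (h1.or h2).and h3

theorem semiDec_isReduction : SemiDec fun x : GenMEPCode × LEPCode => IsReduction x.1 x.2 :=
  semiDec_normalFormReduction.or semiDec_obstructionReduction

/-- What the code of an instance says about its matrices. -/
theorem GenMEPCode.Represents.matrices {w : GenMEPCode} {I : GenMEP} (h : w.Represents I) :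
    w.1.length = I.k ∧ w.2.1.length = I.n ∧ (MatValid I.n w.2.1 ∧ matValue I.n w.2.1 = I.C) ∧
      ∀ i : Fin I.k, MatValid I.n (w.1.getD i []) ∧ matValue I.n (w.1.getD i []) = I.A i := by
  obtain ⟨hA, hC, -⟩ := h
  obtain ⟨hk, hA⟩ := (List.forall₂_ofFn_iff []).1 hA
  exact ⟨hk, (representsMat_iff.1 hC).1, ⟨hC.matValid, hC.matValue_eq⟩,
    fun i => ⟨(hA i).matValid, (hA i).matValue_eq⟩⟩

/-- Every justified output is correct. -/
theorem IsReduction.exists_represents {w : GenMEPCode} {v : LEPCode} (hv : IsReduction w v)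
    {I : GenMEP} (h : w.Represents I) (hI : I.Commuting) :
    ∃ L : LEP, LEPCode.Represents v L ∧ (I.Solvable ↔ L.Solvable) := by
  obtain ⟨hk, hn, ⟨hCv, hC⟩, hA⟩ := h.matrices
  rcases hv with ⟨z, hz, hzC, hzA, rfl⟩ | ⟨hb, rfl⟩
  · have hzk : z.2.2.length = I.k := by rw [← hk, ← hzA, List.length_map]
    rw [hn] at hz ⊢
    rw [hk]
    have hval := hz.valid_of_mem_equations
    rw [hzk] at hval
    obtain ⟨L, hL, hLs⟩ := exists_represents_lepOfEquations h.2.2 hval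
    refine ⟨L, hL, ?_⟩
    rw [hLs]
    refine exists_congr fun t => and_congr_left fun _ => ?_
    refine (hz.forall_holds_iff hzk (fun i => ?_) (by rw [hzC]; exact ⟨hCv, hC⟩) t).symm
    have hi : (i : ℕ) < z.2.2.length := by rw [hzk]; exact i.2
    have h1 : (z.2.2.getD i z.2.1).1 = w.1.getD i [] := by
      rw [← hzA]
      simp [List.getD, hi]
    rw [h1]
    exact hA i
  · rw [hk]
    obtain ⟨L, hL, hLs⟩ := exists_represents_lepOfEquations h.2.2
      (rows := [falseEquation I.k]) (by simpa using valid_falseEquation I.k)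
    refine ⟨L, hL, iff_of_false ?_ ?_⟩
    · rintro ⟨t, ht, -⟩
      obtain ⟨hu, hc⟩ := Matrix.isUnit_and_commute_prod_exp hI t
      rw [ht] at hu hc
      rw [hn] at hb
      rcases hb with hb | hb
      · rw [commutatorCheck_iff hCv fun i hi => (hA ⟨i, hk ▸ hi⟩).1] at hb
        obtain ⟨i, hi, hic⟩ := hb
        rw [hC, (hA ⟨i, hk ▸ hi⟩).2] at hic
        exact hic (hc _)
      · exact hb.not_isUnit hCv (hC ▸ hu)
    · rw [hLs]
      rintro ⟨t, ht, -⟩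
      exact not_holds_falseEquation t (ht _ List.mem_cons_self)

/-- There is a justified output for every instance with commuting matrices. -/
theorem exists_isReduction {w : GenMEPCode} {I : GenMEP} (h : w.Represents I) (hI : I.Commuting) :
    ∃ v, IsReduction w v := by
  obtain ⟨hk, hn, ⟨hCv, hC⟩, hA⟩ := h.matrices
  have hAv : ∀ i < w.1.length, MatValid I.n (w.1.getD i []) := fun i hi => (hA ⟨i, hk ▸ hi⟩).1
  by_cases h1 : CommutatorCheck I.n w.1 w.2.1
  · exact ⟨_, Or.inr ⟨Or.inl (by rwa [hn]), rfl⟩⟩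
  by_cases h2 : IsUnit (matValue I.n w.2.1)
  · have hlC : ∀ i < w.1.length,
        Commute (matValue I.n (w.1.getD i [])) (matValue I.n w.2.1) := by
      rw [commutatorCheck_iff hCv hAv] at h1
      push Not at h1
      exact h1
    obtain ⟨z, hz, hzC, hzA⟩ := exists_normalFormCheck hCv hAv (fun i hi j hj => by
      rw [(hA ⟨i, hk ▸ hi⟩).2, (hA ⟨j, hk ▸ hj⟩).2]
      exact hI _ _) hlC h2
    exact ⟨_, Or.inl ⟨z, by rwa [hn], hzC, hzA, rfl⟩⟩
  · exact ⟨_, Or.inr ⟨Or.inr (by rw [hn]; exact exists_zeroDivisorCheck hCv h2), rfl⟩⟩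

theorem exists_partrec_reduction :
    ∃ f : GenMEPCode →. LEPCode, Partrec f ∧
      ∀ (w : GenMEPCode) (I : GenMEP), GenMEPCode.Represents w I → I.Commuting →
        ∃ v ∈ f w, ∃ L : LEP, LEPCode.Represents v L ∧ (I.Solvable ↔ L.Solvable) := by
  obtain ⟨f, hf, h⟩ := semiDec_isReduction.exists_partrec
  refine ⟨f, hf, fun w I hw hI => ?_⟩
  obtain ⟨v, hv, hv'⟩ := h w (exists_isReduction hw hI)
  exact ⟨v, hv, hv'.exists_represents hw hI⟩

end Certificates

theorem mainTheorem4 :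
    ∃ f : GenMEPCode →. LEPCode, Partrec f ∧
      ∀ (w : GenMEPCode) (I : GenMEP), GenMEPCode.Represents w I → I.Commuting →
        ∃ v ∈ f w, ∃ L : LEP, LEPCode.Represents v L ∧ (I.Solvable ↔ L.Solvable) :=
  exists_partrec_reduction
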